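/- **Setting.** A (memoryless) broadcast channel with three receivers has an input alphabet $\mathcal X$, output alphabets $\mathcal Y_1,\mathcal Y_2,\mathcal Y_3$ (measurable spaces in general) and a conditional law $p(y_1,y_2,y_3|x)$. Index the seven nonempty subsets of $\{1,2,3\}$ in the order $1,2,3,12,13,23,123$, and let $\mathbf R=(R_1,R_2,R_3,R_{12},R_{13},R_{23},R_{123})\in\mathbb R_+^7$. A $(2^{n\mathbf R},n)$ code consists of an encoder mapping seven messages $W_{\mathcal I}\in\{1,\dots,\lceil 2^{nR_{\mathcal I}}\rceil\}$ to $\mathcal X^n$ and of twelve (measurable) decoders $\hat W_{i,\mathcal I}$, $i\in\mathcal I$, defined on $\mathcal Y_i^n$. Its error probability $P_e^{(n)}$ is the probability that at least one $\hat W_{i,\mathcal I}\ne W_{\mathcal I}$ when the seven messages are independent and uniform and the channel is used $n$ times independently. $\mathbf R$ is achievable if some sequence of $(2^{n\mathbf R},n)$ codes has $P_e^{(n)}\to0$; the capacity region $\mathcal C$ is the closure of the set of achievable vectors. The $\mathbf R^*$-multicast region is the intersection of the capacity regions of all broadcast channels whose capacity region contains $\mathbf R^*$. Let $$G=\left[\begin{smallmatrix}1&0&0&1&1&0&1&1&1&1&1&2&2&1&2\\0&1&0&1&0&1&1&1&1&1&1&2&1&2&2\\0&0&1&0&1&1&1&1&1&1&1&1&2&2&2\\1&1&0&1&1&1&1&2&1&1&2&2&2&2&2\\1&0&1&1&1&1&1&1&2&1&2&2&2&2&2\\0&1&1&1&1&1&1&1&1&2&2&2&2&2&2\\1&1&1&1&1&1&1&2&2&2&2&3&3&3&3\end{smallmatrix}\right],\quad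 H=\left[\begin{smallmatrix}-1&-1&0&1&0&0&1&0&0&-1&0&0&0&0&0&0\\-1&0&-1&0&1&0&0&-1&0&0&1&0&0&0&0&0\\0&-1&-1&0&0&-1&0&0&1&0&0&1&0&0&0&0\\1&0&0&-1&-1&-1&0&0&0&0&0&0&1&0&0&-1\\0&1&0&0&0&0&-1&-1&-1&0&0&0&0&1&0&-1\\0&0&1&0&0&0&0&0&0&-1&-1&-1&0&0&1&-1\\0&0&0&0&0&1&0&1&0&1&0&0&-1&-1&-1&2\end{smallmatrix}\right].$$ A universal encoding/decoding operation of block length $n\ge1$ from $\mathbf R^W$ to $\mathbf R^M$ (rate vectors such that all $2^{nR^W_{\mathcal J}}$ and $2^{nR^M_{\mathcal I}}$ are integers, $\mathbf R^M\neq\mathbf R^W$) consists of maps $W_{\mathcal J}:\prod_{\mathcal I}\{1,\dots,2^{nR^M_{\mathcal I}}\}\to\{1,\dots,2^{nR^W_{\mathcal J}}\}$ for all $\mathcal J$ and of maps $\hat M_{i,\mathcal I}:\prod_{\mathcal J\ni i}\{1,\dots,2^{nR^W_{\mathcal J}}\}\to\{1,\dots,2^{nR^M_{\mathcal I}}\}$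 for all $i\in\mathcal I$, such that $\hat M_{i,\mathcal I}\big((W_{\mathcal J}(M))_{\mathcal J\ni i}\big)=M_{\mathcal I}$ for all $M$ and all $i\in\mathcal I$. Its normalized difference vector is $d\mathbf R=(\mathbf R^M-\mathbf R^W)/\lVert\mathbf R^M-\mathbf R^W\rVert$ (Euclidean norm). The operation is distinct if $d\mathbf R$ is not a linear combination, with nonnegative coefficients, of normalized difference vectors different from $d\mathbf R$ of universal encoding/decoding operations. Distinct operations are counted by their vectors $d\mathbf R$. **Theorem 4.1.** (a) For every $\mathbf R^*\in\mathbb R_+^7$ the $\mathbf R^*$-multicast region is $$\{\mathbf R\in\mathbb R_+^7: G^T(\mathbf R-\mathbf R^*)\preceq0\}.$$ The same holds if the intersection is taken only over the channels with finite alphabets. The region is a polytope, and it is the set of all $\mathbf R\in\mathbb R_+^7$ with $\mathbf R-\mathbf R^*$ in the cone $K=\{\mathbf R\in\mathbb R^7:G^T\mathbf R\preceq0\}$. (b) The cone $K$ has exactly 16 extremal rays, those spanned by the columns of $H$. (c) The normalized difference vectors of the distinct universal encoding/decoding operations are exactly the normalized columns of $H$; thus there are exactly 16 distinct universal encoding/decoding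 operations. (d) The sixteenth column of $H$ is $(0,0,0,-1,-1,-1,2)^T$, and it is realized by an XOR operation: for $n=1$, $\mathbf R^W=(0,0,0,1,1,1,0)$, $\mathbf R^M=(0,0,0,0,0,0,2)$ there is a universal encoding/decoding operation that sends the two bits $(b_1,b_2)$ of $M_{123}$ as $W_{12}=b_1$, $W_{13}=b_2$, $W_{23}=b_1\oplus b_2$. -/

import Mathlib

open MeasureTheory ProbabilityTheory Filter Topology

noncomputable section

namespace MulticastBC

/-- The seven nonempty subsets of the receivers `{1,2,3}` (numbered `0,1,2` here), in the order
`1, 2, 3, 12, 13, 23, 123`. -/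
def receivers : Fin 7 → Finset (Fin 3) :=
  ![{0}, {1}, {2}, {0, 1}, {0, 2}, {1, 2}, {0, 1, 2}]

/-- Rate vectors `(R₁, R₂, R₃, R₁₂, R₁₃, R₂₃, R₁₂₃)`. -/
abbrev Rates : Type := Fin 7 → ℝ

/-- The indices of the four messages intended for receiver `i`. -/
abbrev Demand (i : Fin 3) : Type := {I : Fin 7 // i ∈ receivers I}

/-- A (memoryless) broadcast channel with three receivers: an input alphabet, three output
alphabets, and the joint conditional law of `(y₁, y₂, y₃)` given the input letter `x`. -/
structure Channel where
  X : Type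
  Y : Fin 3 → Type
  [measX : MeasurableSpace X]
  [measY : ∀ i, MeasurableSpace (Y i)]
  law : Kernel X (∀ i, Y i)
  [markov : IsMarkovKernel law]

attribute [instance] Channel.measX Channel.measY Channel.markov

/-- The channel has finite alphabets, in which every subset is measurable, so that it is given by
a probability transition function `p(y₁, y₂, y₃ | x)`. -/
def Channel.IsFinite (c : Channel) : Prop :=
  Finite c.X ∧ (∀ i, Finite (c.Y i)) ∧ DiscreteMeasurableSpace c.X ∧
    ∀ i, DiscreteMeasurableSpace (c.Y i)

/-- A block code of length `n` with `m I` possible values of the message with index `I`: an encoder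
and, for each receiver `i` and each message intended for it, a decoder. -/
structure Code (c : Channel) (n : ℕ) (m : Fin 7 → ℕ) where
  enc : (∀ I, Fin (m I)) → Fin n → c.X
  dec : ∀ i : Fin 3, ∀ I : Demand i, (Fin n → c.Y i) → Fin (m I.1)
  measurable_dec : ∀ i I, Measurable (dec i I)

/-- The probability that at least one of the twelve decoded messages differs from the transmitted
one, when the seven messages are independent and uniform and the channel is used `n` times
independently. -/
def Code.errorProb {c : Channel} {n : ℕ} {m : Fin 7 → ℕ} (C : Code c n m) : ℝ :=
  (∑ w : ∀ I, Fin (m I),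
      (Measure.pi fun t => c.law (C.enc w t)).real
        {y : Fin n → ∀ i, c.Y i | ∃ i, ∃ I : Demand i, C.dec i I (fun t => y t i) ≠ w I.1}) /
    (Fintype.card (∀ I, Fin (m I)) : ℝ)

/-- The rate vector `R` is achievable: there is a sequence of `(2^{nR}, n)` codes whose error
probability tends to zero (with `⌈2^{n R_I}⌉` values of the message `I`). -/
def Achievable (c : Channel) (R : Rates) : Prop :=
  0 ≤ R ∧ ∃ C : ∀ n : ℕ, Code c n (fun I => ⌈(2 : ℝ) ^ ((n : ℝ) * R I)⌉₊),
    Tendsto (fun n => (C n).errorProb) atTop (𝓝 0)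

/-- The multicast capacity region of a broadcast channel. -/
def capacityRegion (c : Channel) : Set Rates :=
  closure {R | Achievable c R}

/-- The `Rs`-multicast region, for a given class of channels: the intersection of the capacity
regions of all channels of the class whose capacity region contains `Rs`. -/
def multicastRegion (channels : Set Channel) (Rs : Rates) : Set Rates :=
  ⋂ c ∈ {c ∈ channels | Rs ∈ capacityRegion c}, capacityRegion c

/-- The matrix `G_{BC,3}`. -/
def G : Matrix (Fin 7) (Fin 15) ℝ :=
  !![1, 0, 0, 1, 1, 0, 1, 1, 1, 1, 1, 2, 2, 1, 2;
     0, 1, 0, 1, 0, 1, 1, 1, 1, 1, 1, 2, 1, 2, 2;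
     0, 0, 1, 0, 1, 1, 1, 1, 1, 1, 1, 1, 2, 2, 2;
     1, 1, 0, 1, 1, 1, 1, 2, 1, 1, 2, 2, 2, 2, 2;
     1, 0, 1, 1, 1, 1, 1, 1, 2, 1, 2, 2, 2, 2, 2;
     0, 1, 1, 1, 1, 1, 1, 1, 1, 2, 2, 2, 2, 2, 2;
     1, 1, 1, 1, 1, 1, 1, 2, 2, 2, 2, 3, 3, 3, 3]

/-- The matrix `H_{BC,3}`. -/
def H : Matrix (Fin 7) (Fin 16) ℝ :=
  !![-1, -1, 0, 1, 0, 0, 1, 0, 0, -1, 0, 0, 0, 0, 0, 0;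
     -1, 0, -1, 0, 1, 0, 0, -1, 0, 0, 1, 0, 0, 0, 0, 0;
     0, -1, -1, 0, 0, -1, 0, 0, 1, 0, 0, 1, 0, 0, 0, 0;
     1, 0, 0, -1, -1, -1, 0, 0, 0, 0, 0, 0, 1, 0, 0, -1;
     0, 1, 0, 0, 0, 0, -1, -1, -1, 0, 0, 0, 0, 1, 0, -1;
     0, 0, 1, 0, 0, 0, 0, 0, 0, -1, -1, -1, 0, 0, 1, -1;
     0, 0, 0, 0, 0, 1, 0, 1, 0, 1, 0, 0, -1, -1, -1, 2]

/-- The multicast cone `{R : Gᵀ R ≤ 0}`. -/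
def multicastCone : Set Rates :=
  {R | G.transpose.mulVec R ≤ 0}

/-- The ray spanned by a vector. -/
def ray (v : Rates) : Set Rates :=
  {x | ∃ t : ℝ, 0 ≤ t ∧ x = t • v}

/-- The extremal rays of a cone: the rays (with nonzero direction) that are extreme subsets (faces)
of it. -/
def extremalRays (K : Set Rates) : Set (Set Rates) :=
  {ρ | ∃ v : Rates, v ≠ 0 ∧ ρ = ray v ∧ IsExtreme ℝ K ρ}

/-- The vector `v` divided by its Euclidean norm. -/
def normalized (v : Rates) : Rates :=
  ‖WithLp.toLp 2 v‖⁻¹ • v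

/-- A universal encoding/decoding operation over block length `n` that carries the messages `M` of
rates `RM` by the messages `W` of rates `RW`. The encoder computes all seven `W_J` from all seven
`M_I`; receiver `i` knows only the four `W_J` intended for it, and computes from them the four `M_I`
intended for it. The message sets have exactly `2^{nR}` elements. Decoding is correct, so
that in particular all receivers of `M_I` agree on its value. -/
structure UniversalOperation (n : ℕ) (RW RM : Rates) where
  w : Fin 7 → ℕ
  m : Fin 7 → ℕ
  w_eq : ∀ J, (w J : ℝ) = 2 ^ ((n : ℝ) * RW J)
  m_eq : ∀ I, (m I : ℝ) = 2 ^ ((n : ℝ) * RM I)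
  enc : (∀ I, Fin (m I)) → ∀ J, Fin (w J)
  dec : ∀ i : Fin 3, ∀ I : Demand i, (∀ J : Demand i, Fin (w J.1)) → Fin (m I.1)
  dec_enc : ∀ M i, ∀ I : Demand i, dec i I (fun J => enc M J.1) = M I.1

/-- `d` is the normalized difference vector of some universal encoding/decoding operation. -/
def IsUniversalDirection (d : Rates) : Prop :=
  ∃ n : ℕ, 0 < n ∧ ∃ RW RM : Rates,
    Nonempty (UniversalOperation n RW RM) ∧ RM ≠ RW ∧ d = normalized (RM - RW)

/-- The `d`-universal encoding/decoding operations are distinct: they exist, and `d` is not a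
linear combination with nonnegative coefficients of normalized difference vectors, other than `d`,
of universal encoding/decoding operations. -/
def IsDistinct (d : Rates) : Prop :=
  IsUniversalDirection d ∧
    ¬ ∃ (k : ℕ) (v : Fin k → Rates) (a : Fin k → ℝ),
      (∀ j, IsUniversalDirection (v j) ∧ v j ≠ d ∧ 0 ≤ a j) ∧ d = ∑ j, a j • v j

end MulticastBC

end

open MeasureTheory ProbabilityTheory Filter Topology

noncomputable section

namespace MulticastBC


/-! ### Double description of the multicast cone -/

/-! Two facts meet: the operations given by the columns of `H` are possible over every channel, and
one family of channels allows nothing beyond the fifteen inequalities of `G`. They fit because the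
columns of `H` generate the cone cut out by `G` (`multicastCone_subset_coneOf`), a finite
computation by the double description method.

Inner bound. Each column of `H` consumes one unit of some messages (its sources) and adds to one
message (its target): every source gives up room for a small piece, and each receiver of the target
recovers the additional content from the pieces it sees. Fifteen columns copy one piece into all
sources; the last sends two pieces and their sum, of which every receiver sees two. Hence a capacity
region is stable under each column as long as rates stay nonnegative (`capacityRegion_operation`).
To follow an arbitrary vector of the cone, one walks along a segment in small steps, which works
while all rates are positive (`capacityRegion_of_pos`). A starting point with vanishing rates is
first pushed into the positive orthant by the operations themselves. This is impossible only when
the support lies in some {i, j, ij}; there the problem is one with two receivers and is solved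
directly (`capacityRegion_of_sub_mem_multicastCone`).

Outer bound. For given rates, take seven multicast links with a common alphabet, of which a random
one is on at each time, with probability proportional to its rate. Random coding reaches the given
vector. Conversely, given the states the channel is deterministic, and receivers decode from the
links they see; submodularity of entropy, together with the fact that links determine the messages
decoded from them, yields each column of `G` (`sum_G_log_le`). So this single finite channel has its
capacity region inside the claimed region.

Operations. The same entropy inequalities put every universal direction into the cone, and the
columns of `H` are realized by actual operations. Each column is exposed by a linear functional
(`exists_exposing`), so the columns span exactly the extremal rays, and distinctness among unit
vectors of the cone singles out precisely their normalizations. -/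

/-- The convex cone generated by finitely many integer vectors. -/
def coneOf {k : ℕ} (V : Fin k → Fin 7 → ℤ) : Set Rates :=
  {x | ∃ a : Fin k → ℝ, 0 ≤ a ∧ x = fun i => ∑ j, a j * V j i}

lemma coneOf_zero {k : ℕ} (V : Fin k → Fin 7 → ℤ) : (0 : Rates) ∈ coneOf V :=
  ⟨0, le_rfl, by ext; simp⟩

lemma coneOf_add {k : ℕ} {V : Fin k → Fin 7 → ℤ} {x y : Rates} (hx : x ∈ coneOf V)
    (hy : y ∈ coneOf V) : x + y ∈ coneOf V := by
  obtain ⟨a, ha, rfl⟩ := hx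
  obtain ⟨b, hb, rfl⟩ := hy
  exact ⟨a + b, add_nonneg ha hb, by ext; simp [add_mul, Finset.sum_add_distrib]⟩

lemma coneOf_smul {k : ℕ} {V : Fin k → Fin 7 → ℤ} {x : Rates} (hx : x ∈ coneOf V) {t : ℝ}
    (ht : 0 ≤ t) : t • x ∈ coneOf V := by
  obtain ⟨a, ha, rfl⟩ := hx
  exact ⟨t • a, smul_nonneg ht ha, by ext; simp [Finset.mul_sum, mul_assoc]⟩

lemma coneOf_sum {k : ℕ} {V : Fin k → Fin 7 → ℤ} {ι : Type*} (s : Finset ι) (f : ι → Rates)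
    (h : ∀ i ∈ s, f i ∈ coneOf V) : ∑ i ∈ s, f i ∈ coneOf V :=
  Finset.sum_induction f (· ∈ coneOf V) (fun _ _ => coneOf_add) (coneOf_zero V) h

lemma coneOf_mem {k : ℕ} (V : Fin k → Fin 7 → ℤ) (j : Fin k) :
    (fun i => (V j i : ℝ)) ∈ coneOf V :=
  ⟨Pi.single j 1, by simp, by
    ext i; simp [Pi.single_apply, Finset.sum_ite_eq']⟩

lemma coneOf_mem_list {k : ℕ} (V : Fin k → Fin 7 → ℤ) (L : List (Fin k)) :
    (fun i => (((L.map V).sum i : ℤ) : ℝ)) ∈ coneOf V := by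
  induction L with
  | nil => convert coneOf_zero V using 1; ext; simp
  | cons j L ih => convert coneOf_add (coneOf_mem V j) ih using 1; ext; simp

/-- One step of the double description method: the part of a finitely generated cone that lies in
a halfspace is generated by the generators in the halfspace and by the combinations, on the
boundary, of a generator outside and a generator inside. -/
lemma coneOf_halfspace {k k' : ℕ} (V : Fin k → Fin 7 → ℤ) (V' : Fin k' → Fin 7 → ℤ)
    (g : Fin 7 → ℤ) (certs : List (List (Fin k')))
    (h1 : ∀ j, g ⬝ᵥ V j ≤ 0 → ∃ i, V' i = V j)
    (h2 : ∀ p q, 0 < g ⬝ᵥ V p → g ⬝ᵥ V q < 0 →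
      ∃ L ∈ certs, (L.map V').sum = (-(g ⬝ᵥ V q)) • V p + (g ⬝ᵥ V p) • V q)
    {x : Rates} (hx : x ∈ coneOf V) (hg : ∑ i, (g i : ℝ) * x i ≤ 0) : x ∈ coneOf V' := by
  obtain ⟨a, ha, rfl⟩ := hx
  set e : Fin k → ℝ := fun j => ((g ⬝ᵥ V j : ℤ) : ℝ) with he
  have hsum : ∑ j, a j * e j ≤ 0 := by
    refine le_of_eq_of_le ?_ hg
    simp only [he, dotProduct, Int.cast_sum, Int.cast_mul, Finset.mul_sum]
    rw [Finset.sum_comm]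
    exact Finset.sum_congr rfl fun i _ => Finset.sum_congr rfl fun j _ => by ring
  have hin : ∀ j, e j ≤ 0 → (fun i => (V j i : ℝ)) ∈ coneOf V' := by
    intro j hj
    obtain ⟨i, hi⟩ := h1 j (Int.cast_nonpos.1 hj)
    rw [← hi]; exact coneOf_mem V' i
  have hpq : ∀ p q, 0 < e p → e q < 0 →
      (fun i => -e q * (V p i : ℝ) + e p * V q i) ∈ coneOf V' := by
    intro p q hp hq
    obtain ⟨L, -, hL⟩ := h2 p q (Int.cast_pos.1 hp) (Int.cast_lt_zero.1 hq)
    have := coneOf_mem_list V' L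
    rw [hL] at this
    simpa [he] using this
  -- positive and negative parts of the evaluations
  set A : ℝ := ∑ j, a j * max (e j) 0 with hA
  set B : ℝ := ∑ j, a j * max (-e j) 0 with hB
  have hAB : A ≤ B := by
    have : A - B = ∑ j, a j * e j := by
      rw [hA, hB, ← Finset.sum_sub_distrib]
      refine Finset.sum_congr rfl fun j _ => ?_
      rw [← mul_sub]
      rcases le_total (e j) 0 with h | h
      · rw [max_eq_right h, max_eq_left (by linarith)]; ring
      · rw [max_eq_left h, max_eq_right (by linarith)]; ring
    linarith
  have hA0 : 0 ≤ A := Finset.sum_nonneg fun j _ => mul_nonneg (ha j) (le_max_right _ _)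
  rcases hA0.eq_or_lt with hA0 | hA0
  · have hz := (Finset.sum_eq_zero_iff_of_nonneg
      (fun j _ => mul_nonneg (ha j) (le_max_right (e j) 0))).1 hA0.symm
    have : (fun i => ∑ j, a j * (V j i : ℝ)) = ∑ j, a j • (fun i => (V j i : ℝ)) := by
      ext i; simp
    rw [this]
    refine coneOf_sum _ _ fun j _ => ?_
    by_cases hj : e j ≤ 0
    · exact coneOf_smul (hin j hj) (ha j)
    · have := hz j (Finset.mem_univ j)
      rw [max_eq_left (by linarith)] at this
      have : a j = 0 := by
        rcases mul_eq_zero.1 this with h | h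
        · exact h
        · exact absurd h.le hj
      rw [this, zero_smul]; exact coneOf_zero V'
  · have hB0 : 0 < B := hA0.trans_le hAB
    -- Every generator p outside is paired with all generators q strictly inside, with weights `a p
    -- * a q / B`. Since `B` is the total of `a q * (-e q)`, the pairs absorb exactly `a p` of each
    -- p and a share `A / B ≤ 1` of each q; the rest of q and the generators on the boundary remain.
    have key : (fun i => ∑ j, a j * (V j i : ℝ)) =
        (∑ p, ∑ q, (a p * a q / B) •
          (fun i => if 0 < e p ∧ e q < 0 then -e q * (V p i : ℝ) + e p * V q i else 0)) +
        ∑ q, (a q * (1 - if e q < 0 then A / B else 0)) •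
          (fun i => if e q ≤ 0 then (V q i : ℝ) else 0) := by
      ext i
      have e1 : ∀ p q, (a p * a q / B) * (if 0 < e p ∧ e q < 0 then
            -e q * (V p i : ℝ) + e p * V q i else 0) =
          (if 0 < e p then a p * V p i else 0) * (a q * max (-e q) 0) / B +
          (a p * max (e p) 0) * (if e q < 0 then a q * V q i else 0) / B := by
        intro p q
        by_cases hp : 0 < e p
        · by_cases hq : e q < 0
          · rw [if_pos ⟨hp, hq⟩, if_pos hp, if_pos hq, max_eq_left hp.le,
              max_eq_left (by linarith)]; ring
          · rw [if_neg (fun h => hq h.2), if_neg hq, max_eq_right (by linarith)]; ring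
        · rw [if_neg (fun h => hp h.1), if_neg hp, max_eq_right (not_lt.1 hp)]; ring
      simp only [Pi.add_apply, Finset.sum_apply, Pi.smul_apply, smul_eq_mul]
      simp_rw [e1, Finset.sum_add_distrib, ← Finset.sum_div, ← Finset.mul_sum, ← Finset.sum_mul]
      rw [← hA, ← hB, mul_div_assoc, div_self hB0.ne', mul_one]
      rw [mul_comm A, mul_div_assoc, Finset.sum_mul, add_assoc, ← Finset.sum_add_distrib,
        ← Finset.sum_add_distrib]
      refine Finset.sum_congr rfl fun j _ => ?_
      rcases lt_trichotomy (e j) 0 with h | h | h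
      · rw [if_neg h.not_gt, if_pos h, if_pos h, if_pos h.le]; ring
      · rw [if_neg h.not_gt, if_neg h.not_lt, if_neg h.not_lt, if_pos h.le]; ring
      · rw [if_pos h, if_neg h.not_gt, if_neg h.not_gt, if_neg h.not_ge]; ring
    rw [key]
    refine coneOf_add (coneOf_sum _ _ fun p _ => coneOf_sum _ _ fun q _ => coneOf_smul ?_
      (div_nonneg (mul_nonneg (ha p) (ha q)) hB0.le)) (coneOf_sum _ _ fun q _ => coneOf_smul ?_
      (mul_nonneg (ha q) ?_))
    · by_cases h : 0 < e p ∧ e q < 0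
      · simpa only [if_pos h] using hpq p q h.1 h.2
      · simp only [if_neg h]; exact coneOf_zero V'
    · by_cases h : e q ≤ 0
      · simpa only [h, if_true] using hin q h
      · simp only [if_neg h]; exact coneOf_zero V'
    · split_ifs
      · exact sub_nonneg.2 ((div_le_one hB0).2 hAB)
      · simp

/-- The matrix `G` over the integers. -/
def intG : Matrix (Fin 7) (Fin 15) ℤ :=
  !![1, 0, 0, 1, 1, 0, 1, 1, 1, 1, 1, 2, 2, 1, 2;
     0, 1, 0, 1, 0, 1, 1, 1, 1, 1, 1, 2, 1, 2, 2;
     0, 0, 1, 0, 1, 1, 1, 1, 1, 1, 1, 1, 2, 2, 2;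
     1, 1, 0, 1, 1, 1, 1, 2, 1, 1, 2, 2, 2, 2, 2;
     1, 0, 1, 1, 1, 1, 1, 1, 2, 1, 2, 2, 2, 2, 2;
     0, 1, 1, 1, 1, 1, 1, 1, 1, 2, 2, 2, 2, 2, 2;
     1, 1, 1, 1, 1, 1, 1, 2, 2, 2, 2, 3, 3, 3, 3]

/-- The columns of the matrix `H` over the integers. -/
def intH : Fin 16 → Fin 7 → ℤ :=
  ![![-1, -1, 0, 1, 0, 0, 0], ![-1, 0, -1, 0, 1, 0, 0], ![0, -1, -1, 0, 0, 1, 0],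
    ![1, 0, 0, -1, 0, 0, 0], ![0, 1, 0, -1, 0, 0, 0], ![0, 0, -1, -1, 0, 0, 1],
    ![1, 0, 0, 0, -1, 0, 0], ![0, -1, 0, 0, -1, 0, 1], ![0, 0, 1, 0, -1, 0, 0],
    ![-1, 0, 0, 0, 0, -1, 1], ![0, 1, 0, 0, 0, -1, 0], ![0, 0, 1, 0, 0, -1, 0],
    ![0, 0, 0, 1, 0, 0, -1], ![0, 0, 0, 0, 1, 0, -1], ![0, 0, 0, 0, 0, 1, -1],
    ![0, 0, 0, -1, -1, -1, 2]]

lemma G_apply (I : Fin 7) (l : Fin 15) : G I l = intG I l := by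
  fin_cases I <;> fin_cases l <;> simp [G, intG]

lemma H_apply (I : Fin 7) (j : Fin 16) : H I j = intH j I := by
  fin_cases I <;> fin_cases j <;> simp [H, intH]

lemma H_col_eq (j : Fin 16) : H.col j = fun I => (intH j I : ℝ) := by
  ext I; exact H_apply I j

lemma mem_multicastCone {x : Rates} :
    x ∈ multicastCone ↔ ∀ l, ∑ I, (intG I l : ℝ) * x I ≤ 0 := by
  simp only [multicastCone, Set.mem_ofPred_eq, Pi.le_def, Matrix.mulVec, dotProduct,
    Matrix.transpose_apply, G_apply, Pi.zero_apply]

/-- Seven columns of `G` are linearly independent and cut out a simplicial cone; the other eight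
halfspaces are imposed one by one. At each step the new generators are listed, and the certificates
write every combination on the boundary, redundant ones included, as a sum of generators from the
list. Thus only integer identities are left to the kernel. -/
lemma multicastCone_subset_coneOf {x : Rates} (hx : x ∈ multicastCone) : x ∈ coneOf intH := by
  rw [mem_multicastCone] at hx
  have h0 : x ∈ coneOf
      ![![0, -1, 1, 0, 0, 0, 0], ![1, 0, 0, -1, 0, 0, 0], ![0, 0, 0, -1, -1, -1, 2], ![-1, 0, -1,
      1, 1, 1, -1], ![0, 1, 0, -1, 0, 0, 0], ![0, 1, 0, 0, 0, -1, 0], ![0, 0, 0, 1, -1, 0, 0]] := by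
    -- The generators are, up to sign, the dual basis of the seven chosen columns, so the
    -- coefficients are the slacks in these inequalities.
    refine ⟨fun j => -∑ I, (intG I (![11, 13, 6, 14, 0, 9, 8] j) : ℝ) * x I, fun j => ?_, ?_⟩
    · simpa using hx _
    · ext I
      fin_cases I <;> simp [intG, Fin.sum_univ_succ] <;> ring
  replace h0 := coneOf_halfspace _ 
      (![![-1, -1, 0, 1, 1, 1, -1], ![0, 0, -1, 0, 1, 1, -1], ![0, -1, 1, 1, -1, 0, 0], ![1, 0, 0,
       0, -1, 0, 0], ![0, -1, 1, 0, 0, 0, 0], ![1, 0, 0, -1, 0, 0, 0], ![0, 0, 0, -1, -1, -1, 2],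
       ![0, 1, 0, -1, 0, 0, 0], ![0, 1, 0, 0, 0, -1, 0]])
      (fun I => intG I 1) [[0], [1], [2], [3]]
      (by decide +kernel) (by decide +kernel) h0 (hx 1)
  replace h0 := coneOf_halfspace _ 
      (![![-1, 0, 0, 1, 1, 0, -1], ![0, 0, 1, 0, 0, -1, 0], ![1, 0, 0, 0, -1, 0, 0], ![0, 1, 0, 0,
       0, -1, 0], ![0, 0, -1, 0, 1, 1, -1], ![0, -1, 1, 1, -1, 0, 0], ![1, 0, 0, -1, 0, 0, 0],
       ![0, 0, 0, -1, -1, -1, 2], ![0, 1, 0, -1, 0, 0, 0]])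
      (fun I => intG I 2) [[4, 5], [0], [5, 6], [1]]
      (by decide +kernel) (by decide +kernel) h0 (hx 2)
  replace h0 := coneOf_halfspace _ 
      (![![0, -1, 0, 1, 0, 1, -1], ![1, -1, 1, 0, -1, 0, 0], ![0, 0, 1, 0, -1, 0, 0], ![0, 0, -1,
       0, 1, 1, -1], ![1, 0, 0, -1, 0, 0, 0], ![0, 1, 0, -1, 0, 0, 0], ![-1, 0, 0, 1, 1, 0, -1],
       ![0, 0, 1, 0, 0, -1, 0], ![1, 0, 0, 0, -1, 0, 0], ![0, 1, 0, 0, 0, -1, 0], ![0, 0, 0, -1,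
       -1, -1, 2]])
      (fun I => intG I 7) [[0], [1], [2]]
      (by decide +kernel) (by decide +kernel) h0 (hx 7)
  replace h0 := coneOf_halfspace _ 
      (![![-1, 0, 0, 0, 0, -1, 1], ![1, -1, 1, 0, -1, 0, 0], ![1, 0, 0, -1, 0, 0, 0], ![1, 0, 0,
       0, -1, 0, 0], ![0, 0, 0, -1, -1, -1, 2], ![0, -1, 0, 1, 0, 1, -1], ![0, 0, 1, 0, -1, 0, 0],
       ![0, 0, -1, 0, 1, 1, -1], ![0, 1, 0, -1, 0, 0, 0], ![0, 0, 1, 0, 0, -1, 0], ![0, 1, 0, 0,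
       0, -1, 0]])
      (fun I => intG I 5) [[5, 9], [7, 9], [5, 10], [0]]
      (by decide +kernel) (by decide +kernel) h0 (hx 5)
  replace h0 := coneOf_halfspace _ 
      (![![-1, 0, 0, 0, 0, -1, 1], ![0, 0, -1, 0, 1, 1, -1], ![0, 1, 0, -1, 0, 0, 0], ![0, 1, 0,
       0, 0, -1, 0], ![1, 0, 0, -1, 0, 0, 0], ![1, 0, 0, 0, -1, 0, 0], ![0, 0, 0, -1, -1, -1, 2],
       ![0, -1, 0, 1, 0, 1, -1], ![0, 0, 1, 0, -1, 0, 0], ![0, 0, 1, 0, 0, -1, 0]])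
      (fun I => intG I 12) [[6, 7, 9], [4, 7], [4, 8], [5, 9]]
      (by decide +kernel) (by decide +kernel) h0 (hx 12)
  replace h0 := coneOf_halfspace _ 
      (![![-1, -1, 0, 1, 0, 0, 0], ![0, 0, 0, 1, 0, 0, -1], ![0, -1, 0, 0, -1, 0, 1], ![-1, 0, 0,
       0, 0, -1, 1], ![0, 1, 0, -1, 0, 0, 0], ![0, 1, 0, 0, 0, -1, 0], ![0, 0, 0, -1, -1, -1, 2],
       ![0, 0, -1, 0, 1, 1, -1], ![1, 0, 0, -1, 0, 0, 0], ![1, 0, 0, 0, -1, 0, 0], ![0, 0, 1, 0,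
       -1, 0, 0], ![0, 0, 1, 0, 0, -1, 0]])
      (fun I => intG I 4) [[0], [7, 10], [1], [2]]
      (by decide +kernel) (by decide +kernel) h0 (hx 4)
  replace h0 := coneOf_halfspace _ 
      (![![-1, -1, -1, 1, 1, 1, -1], ![0, -1, -1, 0, 0, 1, 0], ![-1, 0, -1, 0, 1, 0, 0], ![0, 0,
       -1, -1, 0, 0, 1], ![0, 0, 0, 0, 0, 1, -1], ![0, 0, 0, 0, 1, 0, -1], ![-1, -1, 0, 1, 0, 0,
       0], ![0, -1, 0, 0, -1, 0, 1], ![-1, 0, 0, 0, 0, -1, 1], ![0, 0, 0, -1, -1, -1, 2], ![0, 0,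
       1, 0, -1, 0, 0], ![0, 0, 1, 0, 0, -1, 0], ![0, 0, 0, 1, 0, 0, -1], ![0, 1, 0, -1, 0, 0, 0],
       ![0, 1, 0, 0, 0, -1, 0], ![1, 0, 0, -1, 0, 0, 0], ![1, 0, 0, 0, -1, 0, 0]])
      (fun I => intG I 3) [[0], [1], [2], [3], [4], [5]]
      (by decide +kernel) (by decide +kernel) h0 (hx 3)
  replace h0 := coneOf_halfspace _ intH
      (fun I => intG I 10) [[1, 2], [0, 2], [0, 1], [0, 1, 2], [0, 14], [0, 13], [1, 14], [1, 12], [2, 13], [2, 12]]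
      (by decide +kernel) (by decide +kernel) h0 (hx 10)
  exact h0


/-! ### Extremal rays of the multicast cone -/

lemma intG_dot_intH_nonpos : ∀ l j, ∑ I, intG I l * intH j I ≤ 0 := by decide +kernel

/-- The combinatorial criterion for extremality: among the constraints tight at one generator, some
constraint is slack at any other generator. -/
lemma exists_intG_dot_intH_neg :
    ∀ j k, k ≠ j → ∃ l, ∑ I, intG I l * intH j I = 0 ∧ ∑ I, intG I l * intH k I < 0 := by
  decide +kernel

lemma multicastCone_add {x y : Rates} (hx : x ∈ multicastCone) (hy : y ∈ multicastCone) :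
    x + y ∈ multicastCone := by
  rw [mem_multicastCone] at *
  intro l
  simpa [mul_add, Finset.sum_add_distrib] using add_nonpos (hx l) (hy l)

lemma multicastCone_smul {x : Rates} (hx : x ∈ multicastCone) {t : ℝ} (ht : 0 ≤ t) :
    t • x ∈ multicastCone := by
  rw [mem_multicastCone] at *
  intro l
  have : ∑ I, (intG I l : ℝ) * (t • x) I = t * ∑ I, (intG I l : ℝ) * x I := by
    simp only [Pi.smul_apply, smul_eq_mul, Finset.mul_sum]
    exact Finset.sum_congr rfl fun I _ => by ring
  rw [this]
  exact mul_nonpos_of_nonneg_of_nonpos ht (hx l)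

lemma H_col_mem_multicastCone (j : Fin 16) : H.col j ∈ multicastCone := by
  rw [mem_multicastCone]
  intro l
  have := intG_dot_intH_nonpos l j
  simp only [H_col_eq]
  exact_mod_cast this

/-- The multicast cone is generated by the columns of `H`. -/
lemma exists_eq_sum_H_col {x : Rates} (hx : x ∈ multicastCone) :
    ∃ a : Fin 16 → ℝ, 0 ≤ a ∧ x = ∑ j, a j • H.col j := by
  obtain ⟨a, ha, rfl⟩ := multicastCone_subset_coneOf hx
  refine ⟨a, ha, ?_⟩
  ext I
  simp [H_col_eq]

/-- Each column of `H` is exposed by a supporting functional of the multicast cone. -/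
lemma exists_exposing (j : Fin 16) : ∃ c : Rates →ₗ[ℝ] ℝ, (∀ x ∈ multicastCone, c x ≤ 0) ∧
    c (H.col j) = 0 ∧ (∀ k, k ≠ j → c (H.col k) < 0) ∧
    ∀ x ∈ multicastCone, c x = 0 → x ∈ ray (H.col j) := by
  let g : Fin 15 → Rates →ₗ[ℝ] ℝ := fun l => ∑ I, (intG I l : ℝ) • LinearMap.proj I
  have hg : ∀ l x, g l x = ∑ I, (intG I l : ℝ) * x I := fun l x => by
    simp [g, LinearMap.sum_apply]
  have hgH : ∀ l k, g l (H.col k) = ((∑ I, intG I l * intH k I : ℤ) : ℝ) := fun l k => by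
    rw [hg, H_col_eq]; push_cast; rfl
  let s : Finset (Fin 15) := Finset.univ.filter fun l => ∑ I, intG I l * intH j I = 0
  -- The sum of all constraints tight at column j: it vanishes there and is negative on every other
  -- column.
  let c : Rates →ₗ[ℝ] ℝ := ∑ l ∈ s, g l
  have hc : ∀ x, c x = ∑ l ∈ s, g l x := fun x => by simp [c, LinearMap.sum_apply]
  have h1 : ∀ x ∈ multicastCone, c x ≤ 0 := fun x hx => by
    rw [hc]
    exact Finset.sum_nonpos fun l _ => by rw [hg]; exact mem_multicastCone.1 hx l
  have h2 : c (H.col j) = 0 := by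
    rw [hc]
    refine Finset.sum_eq_zero fun l hl => ?_
    rw [hgH, (Finset.mem_filter.1 hl).2, Int.cast_zero]
  have h3 : ∀ k, k ≠ j → c (H.col k) < 0 := fun k hk => by
    obtain ⟨l, hl, hl'⟩ := exists_intG_dot_intH_neg j k hk
    rw [hc]
    refine Finset.sum_neg' (fun l _ => ?_) ⟨l, Finset.mem_filter.2 ⟨Finset.mem_univ _, hl⟩, ?_⟩
    · rw [hgH]; exact_mod_cast intG_dot_intH_nonpos l k
    · rw [hgH]; exact_mod_cast hl'
  refine ⟨c, h1, h2, h3, fun x hx hx0 => ?_⟩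
  obtain ⟨a, ha, rfl⟩ := exists_eq_sum_H_col hx
  have hz : ∀ k, a k * c (H.col k) = 0 := by
    have h0 : ∑ k, a k * c (H.col k) = 0 := by simpa using hx0
    have := (Finset.sum_eq_zero_iff_of_nonpos (fun k _ =>
      mul_nonpos_of_nonneg_of_nonpos (ha k) (h1 _ (H_col_mem_multicastCone k)))).1 h0
    exact fun k => this k (Finset.mem_univ k)
  refine ⟨a j, ha j, Finset.sum_eq_single j (fun k _ hk => ?_) (by simp)⟩
  rw [(mul_eq_zero.1 (hz k)).resolve_right (h3 k hk).ne, zero_smul]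

lemma H_col_ne_zero (j : Fin 16) : H.col j ≠ 0 := by
  have h : ∀ j, intH j ≠ 0 := by decide +kernel
  intro h0
  refine h j (funext fun I => ?_)
  have := congrFun h0 I
  simp only [H_col_eq, Pi.zero_apply] at this
  exact_mod_cast this

lemma mem_ray_self (v : Rates) : v ∈ ray v := ⟨1, zero_le_one, (one_smul _ _).symm⟩

lemma ray_smul {v : Rates} {t : ℝ} (ht : 0 < t) : ray (t • v) = ray v := by
  ext x
  constructor
  · rintro ⟨s, hs, rfl⟩
    exact ⟨s * t, by positivity, smul_smul _ _ _⟩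
  · rintro ⟨s, hs, rfl⟩
    exact ⟨s / t, by positivity, by rw [smul_smul, div_mul_cancel₀ _ ht.ne']⟩

lemma eq_of_H_col_mem_ray {j k : Fin 16} (h : H.col k ∈ ray (H.col j)) : k = j := by
  obtain ⟨c, -, h2, h3, -⟩ := exists_exposing j
  by_contra hkj
  obtain ⟨t, -, ht⟩ := h
  have := h3 k hkj
  rw [ht] at this
  simp [h2] at this

lemma isExtreme_ray_H_col (j : Fin 16) : IsExtreme ℝ multicastCone (ray (H.col j)) := by
  obtain ⟨c, h1, h2, -, h4⟩ := exists_exposing j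
  refine ⟨?_, ?_⟩
  · rintro _ ⟨t, ht, rfl⟩
    exact multicastCone_smul (H_col_mem_multicastCone j) ht
  · rintro x hx y hy z ⟨t, -, hz⟩ ⟨a, b, ha, hb, -, hab⟩
    have hc : a * c x + b * c y = 0 := by
      have := congrArg c (hab.trans hz)
      simpa [h2] using this
    have hx1 := h1 x hx
    have hy1 := h1 y hy
    refine h4 x hx (le_antisymm hx1 ?_)
    by_contra hlt
    nlinarith [mul_nonpos_of_nonneg_of_nonpos hb.le hy1, mul_neg_of_pos_of_neg ha (not_le.1 hlt)]

lemma extremalRays_multicastCone :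
    extremalRays multicastCone = Set.range fun j : Fin 16 => ray (H.col j) := by
  ext ρ
  constructor
  · rintro ⟨v, hv, rfl, hsub, hext⟩
    have hvK := hsub (mem_ray_self v)
    obtain ⟨a, ha, hva⟩ := exists_eq_sum_H_col hvK
    obtain ⟨j, hj⟩ : ∃ j, a j ≠ 0 := by
      by_contra! h
      exact hv (by simp [hva, h])
    have hj' : 0 < a j := lt_of_le_of_ne (ha j) (Ne.symm hj)
    have hrest : v - a j • H.col j ∈ multicastCone := by
      have : v - a j • H.col j = ∑ k ∈ Finset.univ.erase j, a k • H.col k := by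
        rw [hva, ← Finset.add_sum_erase _ _ (Finset.mem_univ j), add_sub_cancel_left]
      rw [this]
      refine Finset.sum_induction _ (· ∈ multicastCone) (fun _ _ => multicastCone_add) ?_
        fun k _ => multicastCone_smul (H_col_mem_multicastCone k) (ha k)
      rw [mem_multicastCone]; simp
    -- `v` is the midpoint of `2 a_j H_j` and `2 (v - a_j H_j)`, both in the cone, so extremality
    -- forces the first onto the ray of `v`.
    have hmem := hext (multicastCone_smul (H_col_mem_multicastCone j)
        (t := 2 * a j) (by positivity)) (multicastCone_smul hrest zero_le_two)
        (mem_ray_self v) ⟨1 / 2, 1 / 2, by norm_num, by norm_num, by norm_num, by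
          ext I; simp; ring⟩
    obtain ⟨t, ht, hteq⟩ := hmem
    have ht0 : 0 < t := by
      refine lt_of_le_of_ne ht fun h => ?_
      rw [← h, zero_smul, smul_eq_zero] at hteq
      exact hteq.elim (fun h => by linarith) (H_col_ne_zero j)
    refine ⟨j, ?_⟩
    change ray (H.col j) = ray v
    rw [← ray_smul (v := H.col j) (t := 2 * a j) (by positivity), hteq, ray_smul ht0]
  · rintro ⟨j, rfl⟩
    exact ⟨H.col j, H_col_ne_zero j, rfl, isExtreme_ray_H_col j⟩

lemma ncard_extremalRays : (extremalRays multicastCone).ncard = 16 := by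
  rw [extremalRays_multicastCone, Set.ncard_range_of_injective, Nat.card_fin]
  intro j k h
  have h' : ray (H.col j) = ray (H.col k) := h
  exact eq_of_H_col_mem_ray (h' ▸ mem_ray_self _)

/-! ### Normalized vectors -/

lemma normalized_eq_smul (v : Rates) : normalized v = ‖WithLp.toLp 2 v‖⁻¹ • v := rfl

lemma norm_toLp_pos {v : Rates} (hv : v ≠ 0) : 0 < ‖WithLp.toLp 2 v‖ := by
  rw [norm_pos_iff]
  intro h
  exact hv (by simpa using congrArg WithLp.ofLp h)

lemma norm_toLp_normalized {v : Rates} (hv : v ≠ 0) : ‖WithLp.toLp 2 (normalized v)‖ = 1 := by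
  rw [normalized_eq_smul, WithLp.toLp_smul, norm_smul, norm_inv, norm_norm,
    inv_mul_cancel₀ (norm_toLp_pos hv).ne']

lemma normalized_smul {v : Rates} {t : ℝ} (ht : 0 < t) : normalized (t • v) = normalized v := by
  rw [normalized_eq_smul, normalized_eq_smul, WithLp.toLp_smul, norm_smul, Real.norm_of_nonneg ht.le,
    smul_smul, mul_inv, mul_right_comm, inv_mul_cancel₀ ht.ne', one_mul]

lemma normalized_H_col_injective : Function.Injective fun j : Fin 16 => normalized (H.col j) := by
  intro j k h
  have h' : normalized (H.col j) = normalized (H.col k) := h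
  refine eq_of_H_col_mem_ray ?_
  have := mem_ray_self (normalized (H.col j))
  rw [normalized_eq_smul, ray_smul (inv_pos.2 (norm_toLp_pos (H_col_ne_zero j)))] at this
  have h2 := ray_smul (v := H.col j) (inv_pos.2 (norm_toLp_pos (H_col_ne_zero j)))
  have h3 := ray_smul (v := H.col k) (inv_pos.2 (norm_toLp_pos (H_col_ne_zero k)))
  rw [← normalized_eq_smul] at h2 h3
  rw [← h3, ← h', h2]
  exact mem_ray_self _

/-- If the universal directions are unit vectors of the multicast cone, and include the directions
of the columns of `H`, then the latter are the distinct ones. -/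
lemma setOf_isDistinct_eq
    (hmem : ∀ d, IsUniversalDirection d → d ∈ multicastCone ∧ ‖WithLp.toLp 2 d‖ = 1)
    (hH : ∀ j, IsUniversalDirection (normalized (H.col j))) :
    {d | IsDistinct d} = Set.range fun j : Fin 16 => normalized (H.col j) := by
  ext d
  constructor
  · rintro ⟨hd, hdist⟩
    by_contra hne
    obtain ⟨a, ha, hda⟩ := exists_eq_sum_H_col (hmem d hd).1
    -- If `d` is not a normalized column, its expansion in the columns uses only universal
    -- directions different from `d`.
    refine hdist ⟨16, fun j => normalized (H.col j),
      fun j => a j * ‖WithLp.toLp 2 (H.col j)‖, fun j => ⟨hH j, fun h => hne ⟨j, h⟩,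
        mul_nonneg (ha j) (norm_nonneg _)⟩, ?_⟩
    rw [hda]
    refine Finset.sum_congr rfl fun j _ => ?_
    beta_reduce
    rw [normalized_eq_smul, smul_smul, mul_assoc,
      mul_inv_cancel₀ (norm_toLp_pos (H_col_ne_zero j)).ne', mul_one]
  · rintro ⟨j, rfl⟩
    refine ⟨hH j, ?_⟩
    rintro ⟨k, v, a, hv, hsum⟩
    obtain ⟨c, h1, h2, -, h4⟩ := exists_exposing j
    have hne : normalized (H.col j) ≠ 0 := by
      intro h
      have := (hmem _ (hH j)).2
      rw [h] at this
      simp at this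
    have hc0 : ∑ i, a i * c (v i) = 0 := by
      have := congrArg c hsum
      beta_reduce at this
      rw [normalized_eq_smul, map_smul, h2, smul_zero] at this
      simpa using this.symm
    -- The exposing functional is nonpositive on all terms and vanishes on their sum, so a term with
    -- nonzero coefficient lies on the ray of column j. Having norm one, it would equal the excluded
    -- vector; hence all coefficients vanish, which is absurd.
    have hz := (Finset.sum_eq_zero_iff_of_nonpos (fun i _ =>
      mul_nonpos_of_nonneg_of_nonpos (hv i).2.2 (h1 _ (hmem _ (hv i).1).1))).1 hc0
    refine hne (hsum.trans (Finset.sum_eq_zero fun i hi => ?_))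
    rcases mul_eq_zero.1 (hz i hi) with h | h
    · rw [h, zero_smul]
    · exfalso
      obtain ⟨hiK, hin⟩ := hmem _ (hv i).1
      obtain ⟨t, ht, hvi⟩ := h4 _ hiK h
      have ht0 : 0 < t := by
        refine lt_of_le_of_ne ht fun h => ?_
        rw [hvi, ← h] at hin
        simp at hin
      refine (hv i).2.1 ?_
      have : normalized (v i) = v i := by
        rw [normalized_eq_smul, hin, inv_one, one_smul]
      rw [← this, hvi, normalized_smul ht0]


/-! ### Entropy of partitions of a finite uniform probability space -/

section Entropy

variable {Ω : Type*} [Fintype Ω]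

open Classical in
/-- The equivalence class of a point, as a finite set. -/
def classOf (r : Setoid Ω) (ω : Ω) : Finset Ω := Finset.univ.filter fun ω' => r ω ω'

lemma mem_classOf {r : Setoid Ω} {ω ω' : Ω} : ω' ∈ classOf r ω ↔ r ω ω' := by
  simp [classOf]

/-- The number of points equivalent to a given point, as a real number. -/
def classSize (r : Setoid Ω) (ω : Ω) : ℝ := (classOf r ω).card

/-- The Shannon entropy (in nats) of the class of a uniform random point. -/
def entropy (r : Setoid Ω) : ℝ :=
  Real.log (Fintype.card Ω) - (∑ ω, Real.log (classSize r ω)) / Fintype.card Ω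

lemma classSize_pos (r : Setoid Ω) (ω : Ω) : 0 < classSize r ω :=
  Nat.cast_pos.2 (Finset.card_pos.2 ⟨ω, mem_classOf.2 (r.refl ω)⟩)

lemma classSize_mono {r s : Setoid Ω} (h : r ≤ s) (ω : Ω) : classSize r ω ≤ classSize s ω :=
  Nat.cast_le.2 (Finset.card_le_card fun _ hx => mem_classOf.2 (h (mem_classOf.1 hx)))

lemma classSize_eq {r : Setoid Ω} {ω ω' : Ω} (h : r ω ω') : classSize r ω = classSize r ω' := by
  have : classOf r ω = classOf r ω' := by
    ext x
    rw [mem_classOf, mem_classOf]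
    exact ⟨fun hx => r.trans (r.symm h) hx, fun hx => r.trans h hx⟩
  rw [classSize, this, classSize]

/-- At most c points of a class of size c contribute 1/c each. -/
lemma sum_inv_classSize_le_one (r : Setoid Ω) (s : Finset Ω) (h : ∀ x ∈ s, ∀ y ∈ s, r x y) :
    ∑ ω ∈ s, (classSize r ω)⁻¹ ≤ 1 := by
  rcases s.eq_empty_or_nonempty with rfl | ⟨x, hx⟩
  · simp
  · have hs : (s.card : ℝ) ≤ classSize r x :=
      Nat.cast_le.2 (Finset.card_le_card fun y hy => mem_classOf.2 (h x hx y hy))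
    have : ∑ ω ∈ s, (classSize r ω)⁻¹ = s.card * (classSize r x)⁻¹ := by
      rw [Finset.sum_congr rfl fun y hy => by rw [← classSize_eq (h x hx y hy)]]
      simp
    rw [this, ← div_eq_mul_inv]
    exact (div_le_one (classSize_pos r x)).2 hs

/-- A partition plays the role of a random variable. In the order on setoids the smaller relation is
the finer partition, hence has more entropy, and `⊓` is the joint variable. -/
lemma entropy_anti {r s : Setoid Ω} (h : r ≤ s) : entropy s ≤ entropy r := by
  unfold entropy
  refine sub_le_sub_left (div_le_div_of_nonneg_right ?_ (Nat.cast_nonneg _)) _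
  exact Finset.sum_le_sum fun ω _ => Real.log_le_log (classSize_pos r ω) (classSize_mono h ω)

variable [Nonempty Ω]

lemma entropy_nonneg (r : Setoid Ω) : 0 ≤ entropy r := by
  have hN : (0 : ℝ) < Fintype.card Ω := Nat.cast_pos.2 Fintype.card_pos
  rw [entropy, sub_nonneg, div_le_iff₀ hN, mul_comm]
  have : ∑ _ω : Ω, Real.log (Fintype.card Ω) = Fintype.card Ω * Real.log (Fintype.card Ω) := by
    simp
  rw [← this]
  exact Finset.sum_le_sum fun ω _ => Real.log_le_log (classSize_pos r ω)
    (Nat.cast_le.2 (Finset.card_le_univ _))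

omit [Nonempty Ω] in
lemma entropy_of_injective {r : Setoid Ω} (h : ∀ x y, r x y → x = y) :
    entropy r = Real.log (Fintype.card Ω) := by
  have : ∀ ω, classSize r ω = 1 := fun ω => by
    have : classOf r ω = {ω} := by
      ext x
      rw [mem_classOf, Finset.mem_singleton]
      exact ⟨fun hx => (h _ _ hx).symm, fun hx => hx ▸ r.refl _⟩
    rw [classSize, this]; simp
  simp [entropy, this]

/-- A function with few values has small entropy. -/
lemma entropy_ker_le {β : Type*} [Fintype β] (f : Ω → β) :
    entropy (Setoid.ker f) ≤ Real.log (Fintype.card β) := by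
  classical
  have hN : (0 : ℝ) < Fintype.card Ω := Nat.cast_pos.2 Fintype.card_pos
  have : Nonempty β := ⟨f (Classical.arbitrary Ω)⟩
  have hb : (0 : ℝ) < Fintype.card β := Nat.cast_pos.2 Fintype.card_pos
  have hsum : ∑ ω, (classSize (Setoid.ker f) ω)⁻¹ ≤ Fintype.card β := by
    rw [← Finset.sum_fiberwise Finset.univ f]
    refine (Finset.sum_le_sum fun b _ => sum_inv_classSize_le_one _ _ ?_).trans (by simp)
    intro x hx y hy
    rw [Setoid.ker_def, (Finset.mem_filter.1 hx).2, (Finset.mem_filter.1 hy).2]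
  -- Jensen's inequality in the form log x ≤ x - 1; the mean of x is at most 1 because the
  -- reciprocal class sizes add up to at most one over each value of `f`.
  have hlog : ∀ ω, Real.log (Fintype.card Ω) - Real.log (classSize (Setoid.ker f) ω)
      - Real.log (Fintype.card β) ≤
      Fintype.card Ω / Fintype.card β * (classSize (Setoid.ker f) ω)⁻¹ - 1 := by
    intro ω
    have hc := classSize_pos (Setoid.ker f) ω
    rw [← Real.log_div hN.ne' hc.ne', ← Real.log_div (by positivity) hb.ne']
    refine (Real.log_le_sub_one_of_pos (by positivity)).trans (le_of_eq ?_)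
    field_simp
  have := Finset.sum_le_sum fun ω (_ : ω ∈ Finset.univ) => hlog ω
  simp only [Finset.sum_sub_distrib, ← Finset.mul_sum, Finset.sum_const, Finset.card_univ,
    nsmul_eq_mul, mul_one] at this
  have h2 : (Fintype.card Ω : ℝ) / Fintype.card β * ∑ ω, (classSize (Setoid.ker f) ω)⁻¹ ≤
      Fintype.card Ω := by
    calc _ ≤ (Fintype.card Ω : ℝ) / Fintype.card β * Fintype.card β := by gcongr
      _ = _ := by field_simp
  have h3 : entropy (Setoid.ker f) * Fintype.card Ω = Fintype.card Ω * Real.log (Fintype.card Ω) -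
      ∑ ω, Real.log (classSize (Setoid.ker f) ω) := by
    rw [entropy]; field_simp
  have h4 : entropy (Setoid.ker f) * Fintype.card Ω ≤
      Real.log (Fintype.card β) * Fintype.card Ω := by
    rw [h3]; linarith
  exact le_of_mul_le_mul_right h4 hN

/-- Submodularity of entropy. -/
lemma entropy_submodular {r s t : Setoid Ω} (hr : r ≤ t) (hs : s ≤ t) :
    entropy (r ⊓ s) + entropy t ≤ entropy r + entropy s := by
  classical
  have hN : (0 : ℝ) < Fintype.card Ω := Nat.cast_pos.2 Fintype.card_pos
  have hcount : ∀ (q : Setoid Ω) ω, classSize q ω = ∑ u, if q ω u then (1 : ℝ) else 0 := by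
    intro q ω
    rw [classSize, classOf, ← Finset.sum_filter, Finset.sum_const, nsmul_eq_mul, mul_one]
  -- By log x ≤ x - 1 it suffices that these ratios have mean at most 1. Expanding the sizes of the
  -- r- and s-class of ω sums over triples (ω, u, v) with u and v in those classes. For fixed u and
  -- v all such ω lie in one class of `r ⊓ s`, so they contribute at most the reciprocal of the
  -- t-class of u, and only if u and v are t-equivalent.
  have hsum : ∑ ω, classSize r ω * classSize s ω * (classSize t ω)⁻¹ * (classSize (r ⊓ s) ω)⁻¹
      ≤ Fintype.card Ω := by
    calc ∑ ω, classSize r ω * classSize s ω * (classSize t ω)⁻¹ * (classSize (r ⊓ s) ω)⁻¹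
        = ∑ ω, ∑ u, ∑ v, if r ω u ∧ s ω v then
            (classSize t ω)⁻¹ * (classSize (r ⊓ s) ω)⁻¹ else 0 := by
          refine Finset.sum_congr rfl fun ω _ => ?_
          rw [hcount r, hcount s, Finset.sum_mul_sum, Finset.sum_mul, Finset.sum_mul]
          refine Finset.sum_congr rfl fun u _ => ?_
          rw [Finset.sum_mul, Finset.sum_mul]
          refine Finset.sum_congr rfl fun v _ => ?_
          by_cases h1 : r ω u <;> by_cases h2 : s ω v <;> simp [h1, h2]
      _ = ∑ u, ∑ v, ∑ ω, if r ω u ∧ s ω v then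
            (classSize t ω)⁻¹ * (classSize (r ⊓ s) ω)⁻¹ else 0 := by
          rw [Finset.sum_comm]
          exact Finset.sum_congr rfl fun u _ => Finset.sum_comm
      _ ≤ ∑ u, ∑ v, if t u v then (classSize t u)⁻¹ else 0 := by
          refine Finset.sum_le_sum fun u _ => Finset.sum_le_sum fun v _ => ?_
          rw [← Finset.sum_filter]
          by_cases hne : (Finset.univ.filter fun ω => r ω u ∧ s ω v).Nonempty
          · obtain ⟨ω₀, hω₀⟩ := hne
            have h₀ := (Finset.mem_filter.1 hω₀).2
            have huv : t u v := t.trans (t.symm (hr h₀.1)) (hs h₀.2)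
            rw [if_pos huv]
            calc _ = ∑ ω ∈ Finset.univ.filter (fun ω => r ω u ∧ s ω v),
                  (classSize t u)⁻¹ * (classSize (r ⊓ s) ω)⁻¹ := by
                  refine Finset.sum_congr rfl fun ω hω => ?_
                  rw [classSize_eq (hr (Finset.mem_filter.1 hω).2.1)]
              _ ≤ (classSize t u)⁻¹ * 1 := by
                  rw [← Finset.mul_sum]
                  refine mul_le_mul_of_nonneg_left (sum_inv_classSize_le_one _ _ ?_)
                    (inv_nonneg.2 (classSize_pos t u).le)
                  intro x hx y hy
                  have hx := (Finset.mem_filter.1 hx).2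
                  have hy := (Finset.mem_filter.1 hy).2
                  exact ⟨r.trans hx.1 (r.symm hy.1), s.trans hx.2 (s.symm hy.2)⟩
              _ = _ := mul_one _
          · rw [Finset.not_nonempty_iff_eq_empty.1 hne, Finset.sum_empty]
            split_ifs
            · exact inv_nonneg.2 (classSize_pos t u).le
            · exact le_rfl
      _ = ∑ u, classSize t u * (classSize t u)⁻¹ := by
          refine Finset.sum_congr rfl fun u _ => ?_
          rw [hcount t u, Finset.sum_mul]
          refine Finset.sum_congr rfl fun v _ => ?_
          rw [ite_mul, one_mul, zero_mul, ← hcount t u]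
      _ = Fintype.card Ω := by
          rw [Finset.sum_congr rfl fun u _ => mul_inv_cancel₀ (classSize_pos t u).ne']
          simp
  have hlog : ∀ ω, Real.log (classSize r ω) + Real.log (classSize s ω) -
      Real.log (classSize t ω) - Real.log (classSize (r ⊓ s) ω) ≤
      classSize r ω * classSize s ω * (classSize t ω)⁻¹ * (classSize (r ⊓ s) ω)⁻¹ - 1 := by
    intro ω
    have h1 := classSize_pos r ω
    have h2 := classSize_pos s ω
    have h3 := classSize_pos t ω
    have h4 := classSize_pos (r ⊓ s) ω
    rw [← Real.log_mul h1.ne' h2.ne', ← Real.log_div (by positivity) h3.ne',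
      ← Real.log_div (by positivity) h4.ne', ← div_eq_mul_inv, ← div_eq_mul_inv]
    exact Real.log_le_sub_one_of_pos (by positivity)
  have := Finset.sum_le_sum fun ω (_ : ω ∈ Finset.univ) => hlog ω
  simp only [Finset.sum_sub_distrib, Finset.sum_add_distrib, Finset.sum_const, Finset.card_univ,
    nsmul_eq_mul, mul_one] at this
  have h0 : (∑ ω, Real.log (classSize r ω) + ∑ ω, Real.log (classSize s ω)) / Fintype.card Ω ≤
      (∑ ω, Real.log (classSize t ω) + ∑ ω, Real.log (classSize (r ⊓ s) ω)) / Fintype.card Ω :=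
    div_le_div_of_nonneg_right (by linarith) hN.le
  rw [add_div, add_div] at h0
  unfold entropy
  linarith

lemma entropy_inf_ker_le {β : Type*} [Fintype β] (r : Setoid Ω) (f : Ω → β) :
    entropy (r ⊓ Setoid.ker f) ≤ entropy r + Real.log (Fintype.card β) := by
  have h1 := entropy_submodular (r := r) (s := Setoid.ker f) le_top le_top
  linarith [entropy_ker_le f, entropy_nonneg (⊤ : Setoid Ω)]

end Entropy

/-! ### The inequalities between message sizes and link sizes -/

/-- The indices of the messages intended for a receiver, as a finite set. -/
def demand (i : Fin 3) : Finset (Fin 7) := Finset.univ.filter fun I => i ∈ receivers I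

/-- The indices of the messages that are decoded by somebody who sees all the links in `S`. -/
def decoded (S : Finset (Fin 7)) : Finset (Fin 7) :=
  Finset.univ.filter fun I => ∃ i, i ∈ receivers I ∧ demand i ⊆ S

/-- The numerical consequences of the entropy bounds, one for each column of `G`. -/
lemma sum_G_le_of_bounds {x y : Fin 7 → ℝ} {D : ℝ} (hL : 0 ≤ D)
    (basic : ∀ S, ∑ I ∈ decoded S, x I - D ≤ ∑ J ∈ S, y J)
    (pair : ∀ i j, ∑ I ∈ decoded Finset.univ, x I + ∑ I ∈ demand i ∩ demand j, x I - 2 * D ≤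
      ∑ J ∈ demand i, y J + ∑ J ∈ demand j, y J + ∑ J ∈ (demand i ∪ demand j)ᶜ, y J)
    (eleven : ∑ I, x I + ∑ I ∈ {3, 4, 5, 6}, x I - 2 * D ≤
      ∑ J ∈ {0, 3, 4, 6}, y J + ∑ J ∈ {1, 3, 5}, y J + ∑ J ∈ {2, 4, 5, 6}, y J)
    (triple : ∀ i j k, i ≠ j → i ≠ k → j ≠ k → ∀ U,
      ∑ I ∈ decoded (demand i ∪ demand j ∪ U), x I + ∑ I, x I + x 6 - 3 * D ≤
      ∑ J ∈ demand i, y J + ∑ J ∈ demand j, y J + ∑ J ∈ demand k, y J +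
      ∑ J ∈ (demand i ∩ demand j ∪ demand k)ᶜ, y J + ∑ J ∈ U, y J) (l : Fin 15) :
    ∑ I, G I l * x I ≤ ∑ J, G J l * y J + 3 * D := by
  have d0 : demand 0 = {0, 3, 4, 6} := by decide +kernel
  have d1 : demand 1 = {1, 3, 5, 6} := by decide +kernel
  have d2 : demand 2 = {2, 4, 5, 6} := by decide +kernel
  have du : decoded Finset.univ = Finset.univ := by decide +kernel
  -- Taken in this order, with `eleven` between `p12` and `t01`, the bounds are those of the fifteen
  -- columns of `G`. None costs more than `3 * D`.
  have b0 := basic {0, 3, 4, 6}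
  have b1 := basic {1, 3, 5, 6}
  have b2 := basic {2, 4, 5, 6}
  have b01 := basic {0, 1, 3, 4, 5, 6}
  have b02 := basic {0, 2, 3, 4, 5, 6}
  have b12 := basic {1, 2, 3, 4, 5, 6}
  have bu := basic Finset.univ
  have p01 := pair 0 1
  have p02 := pair 0 2
  have p12 := pair 1 2
  have t01 := triple 0 1 2 (by decide) (by decide) (by decide) ∅
  have t02 := triple 0 2 1 (by decide) (by decide) (by decide) ∅
  have t12 := triple 1 2 0 (by decide) (by decide) (by decide) ∅
  have tu := triple 0 1 2 (by decide) (by decide) (by decide) {2}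
  rw [show decoded {0, 3, 4, 6} = {0, 3, 4, 6} by decide +kernel] at b0
  rw [show decoded {1, 3, 5, 6} = {1, 3, 5, 6} by decide +kernel] at b1
  rw [show decoded {2, 4, 5, 6} = {2, 4, 5, 6} by decide +kernel] at b2
  rw [show decoded {0, 1, 3, 4, 5, 6} = {0, 1, 3, 4, 5, 6} by decide +kernel] at b01
  rw [show decoded {0, 2, 3, 4, 5, 6} = {0, 2, 3, 4, 5, 6} by decide +kernel] at b02
  rw [show decoded {1, 2, 3, 4, 5, 6} = {1, 2, 3, 4, 5, 6} by decide +kernel] at b12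
  rw [du] at bu
  rw [du, show demand 0 ∩ demand 1 = {3, 6} by decide +kernel,
    show (demand 0 ∪ demand 1)ᶜ = {2} by decide +kernel, d0, d1] at p01
  rw [du, show demand 0 ∩ demand 2 = {4, 6} by decide +kernel,
    show (demand 0 ∪ demand 2)ᶜ = {1} by decide +kernel, d0, d2] at p02
  rw [du, show demand 1 ∩ demand 2 = {5, 6} by decide +kernel,
    show (demand 1 ∪ demand 2)ᶜ = {0} by decide +kernel, d1, d2] at p12
  rw [show decoded (demand 0 ∪ demand 1 ∪ ∅) = {0, 1, 3, 4, 5, 6} by decide +kernel,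
    show (demand 0 ∩ demand 1 ∪ demand 2)ᶜ = {0, 1} by decide +kernel, d0, d1, d2] at t01
  rw [show decoded (demand 0 ∪ demand 2 ∪ ∅) = {0, 2, 3, 4, 5, 6} by decide +kernel,
    show (demand 0 ∩ demand 2 ∪ demand 1)ᶜ = {0, 2} by decide +kernel, d0, d1, d2] at t02
  rw [show decoded (demand 1 ∪ demand 2 ∪ ∅) = {1, 2, 3, 4, 5, 6} by decide +kernel,
    show (demand 1 ∩ demand 2 ∪ demand 0)ᶜ = {1, 2} by decide +kernel, d0, d1, d2] at t12
  rw [show decoded (demand 0 ∪ demand 1 ∪ {2}) = Finset.univ by decide +kernel,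
    show (demand 0 ∩ demand 1 ∪ demand 2)ᶜ = {0, 1} by decide +kernel, d0, d1, d2] at tu
  simp [G_apply, Fin.sum_univ_seven] at b0 b1 b2 b01 b02 b12 bu p01 p02 p12 eleven t01 t02 t12 tu ⊢
  fin_cases l <;> simp [intG] <;> linarith

section Links

variable {Ω : Type*} [Fintype Ω] [Nonempty Ω] {m : Fin 7 → ℕ} {β : Fin 7 → Type*}
  [∀ J, Fintype (β J)]

/-- The joint entropy of the links in `S` and the messages in `T`. -/
def jointEntropy (A : ∀ J, Ω → β J) (M : Ω → ∀ I, Fin (m I)) (S T : Finset (Fin 7)) : ℝ :=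
  entropy (Setoid.ker (fun ω (J : S) => A J.1 ω) ⊓ Setoid.ker (fun ω (I : T) => M ω I.1))

omit [Fintype Ω] [Nonempty Ω] [∀ J, Fintype (β J)] in
lemma joint_rel_iff {A : ∀ J, Ω → β J} {M : Ω → ∀ I, Fin (m I)} {S T : Finset (Fin 7)} {x y : Ω} :
    (Setoid.ker (fun ω (J : S) => A J.1 ω) ⊓ Setoid.ker (fun ω (I : T) => M ω I.1)) x y ↔
      (∀ J ∈ S, A J x = A J y) ∧ ∀ I ∈ T, M x I = M y I := by
  rw [Setoid.inf_def]
  simp [Setoid.ker_def, funext_iff]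

variable {A : ∀ J, Ω → β J} {M : Ω → ∀ I, Fin (m I)}
  (hdec : ∀ i x y, (∀ J, i ∈ receivers J → A J x = A J y) → ∀ I, i ∈ receivers I → M x I = M y I)

include hdec

omit [Fintype Ω] [Nonempty Ω] [∀ J, Fintype (β J)] in
lemma eq_of_mem_decoded {S : Finset (Fin 7)} {x y : Ω} (h : ∀ J ∈ S, A J x = A J y) {I : Fin 7}
    (hI : I ∈ decoded S) : M x I = M y I := by
  obtain ⟨i, hi, hS⟩ := (Finset.mem_filter.1 hI).2
  exact hdec i x y (fun J hJ => h J (hS (Finset.mem_filter.2 ⟨Finset.mem_univ _, hJ⟩))) I hi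

-- Messages decodable from the links in S are functions of these links and add no entropy.
omit [Nonempty Ω] [∀ J, Fintype (β J)] in
lemma jointEntropy_mono {S T S' T' : Finset (Fin 7)} (hS : S' ⊆ S) (hT : T' ⊆ T ∪ decoded S) :
    jointEntropy A M S' T' ≤ jointEntropy A M S T := by
  refine entropy_anti fun {x y} h => ?_
  rw [joint_rel_iff] at h ⊢
  refine ⟨fun J hJ => h.1 J (hS hJ), fun I hI => ?_⟩
  rcases Finset.mem_union.1 (hT hI) with h1 | h1
  · exact h.2 I h1
  · exact eq_of_mem_decoded hdec h.1 h1

-- The common part may contain every message that both sides can decode, even from different links.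
-- This is where decoding strengthens plain submodularity, and why `entropy_submodular` allows any
-- common coarsening.
omit [∀ J, Fintype (β J)] in
lemma jointEntropy_submodular {S₁ T₁ S₂ T₂ S₃ T₃ S₄ T₄ : Finset (Fin 7)} (h3 : S₃ ⊆ S₁ ∪ S₂)
    (h3' : T₃ ⊆ T₁ ∪ T₂ ∪ decoded (S₁ ∪ S₂)) (h4 : S₄ ⊆ S₁ ∩ S₂)
    (h4' : T₄ ⊆ (T₁ ∪ decoded S₁) ∩ (T₂ ∪ decoded S₂)) :
    jointEntropy A M S₃ T₃ + jointEntropy A M S₄ T₄ ≤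
      jointEntropy A M S₁ T₁ + jointEntropy A M S₂ T₂ := by
  have key := entropy_submodular
    (r := Setoid.ker (fun ω (J : S₁) => A J.1 ω) ⊓ Setoid.ker (fun ω (I : T₁) => M ω I.1))
    (s := Setoid.ker (fun ω (J : S₂) => A J.1 ω) ⊓ Setoid.ker (fun ω (I : T₂) => M ω I.1))
    (t := Setoid.ker (fun ω (J : S₄) => A J.1 ω) ⊓ Setoid.ker (fun ω (I : T₄) => M ω I.1))
    (fun {x y} h => by
      rw [joint_rel_iff] at h ⊢
      refine ⟨fun J hJ => h.1 J (Finset.mem_inter.1 (h4 hJ)).1, fun I hI => ?_⟩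
      rcases Finset.mem_union.1 (Finset.mem_inter.1 (h4' hI)).1 with h1 | h1
      · exact h.2 I h1
      · exact eq_of_mem_decoded hdec h.1 h1)
    (fun {x y} h => by
      rw [joint_rel_iff] at h ⊢
      refine ⟨fun J hJ => h.1 J (Finset.mem_inter.1 (h4 hJ)).2, fun I hI => ?_⟩
      rcases Finset.mem_union.1 (Finset.mem_inter.1 (h4' hI)).2 with h1 | h1
      · exact h.2 I h1
      · exact eq_of_mem_decoded hdec h.1 h1)
  refine le_trans (add_le_add ?_ le_rfl) key
  refine entropy_anti fun {x y} h => ?_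
  rw [Setoid.inf_def] at h
  have ha := joint_rel_iff.1 h.1
  have hb := joint_rel_iff.1 h.2
  have hS : ∀ J ∈ S₁ ∪ S₂, A J x = A J y := fun J hJ =>
    (Finset.mem_union.1 hJ).elim (ha.1 J) (hb.1 J)
  rw [joint_rel_iff]
  refine ⟨fun J hJ => hS J (h3 hJ), fun I hI => ?_⟩
  rcases Finset.mem_union.1 (h3' hI) with h1 | h1
  · exact (Finset.mem_union.1 h1).elim (ha.2 I) (hb.2 I)
  · exact eq_of_mem_decoded hdec hS h1

lemma jointEntropy_union_le {S S' T S₃ T₃ : Finset (Fin 7)} (h3 : S₃ ⊆ S ∪ S')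
    (h3' : T₃ ⊆ T ∪ decoded (S ∪ S')) :
    jointEntropy A M S₃ T₃ ≤
      jointEntropy A M S T + ∑ J ∈ S', Real.log (Fintype.card (β J)) := by
  refine (jointEntropy_mono hdec h3 h3').trans ?_
  clear h3 h3'
  induction S' using Finset.induction_on with
  | empty => simp
  | insert J S' hJ ih =>
    rw [Finset.sum_insert hJ]
    have h1 := entropy_inf_ker_le
      (Setoid.ker (fun ω (J : ↑(S ∪ S')) => A J.1 ω) ⊓ Setoid.ker (fun ω (I : T) => M ω I.1)) (A J)
    have h2 : jointEntropy A M (S ∪ insert J S') T ≤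
        entropy (Setoid.ker (fun ω (J : ↑(S ∪ S')) => A J.1 ω) ⊓
          Setoid.ker (fun ω (I : T) => M ω I.1) ⊓ Setoid.ker (A J)) := by
      refine entropy_anti fun {x y} h => ?_
      rw [Setoid.inf_def] at h
      have ha := joint_rel_iff.1 h.1
      rw [joint_rel_iff]
      refine ⟨fun K hK => ?_, ha.2⟩
      rw [Finset.union_insert, Finset.mem_insert] at hK
      rcases hK with rfl | hK
      · exact h.2
      · exact ha.1 K hK
    have h3 : jointEntropy A M (S ∪ S') T = entropy (Setoid.ker (fun ω (J : ↑(S ∪ S')) => A J.1 ω) ⊓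
          Setoid.ker (fun ω (I : T) => M ω I.1)) := rfl
    linarith

lemma jointEntropy_le {S : Finset (Fin 7)} :
    jointEntropy A M S ∅ ≤ ∑ J ∈ S, Real.log (Fintype.card (β J)) := by
  have h := jointEntropy_union_le hdec (S := ∅) (S' := S) (T := ∅) (S₃ := S) (T₃ := ∅)
    (by simp) (by simp)
  have h0 : jointEntropy A M ∅ ∅ ≤ 0 := by
    refine (entropy_anti fun {x y} _ => ?_).trans (by simpa using entropy_ker_le fun _ : Ω => ())
    rw [joint_rel_iff]
    simp
  linarith

-- All messages together have entropy log |Ω|, and those outside T' account for at most the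
-- logarithms of their sizes. The subtracted deficit is the price for allowing Ω to be only a part
-- of all message tuples.
omit [∀ J, Fintype (β J)] in
lemma le_jointEntropy (hM : Function.Injective M) {S T T' : Finset (Fin 7)}
    (hT : T' ⊆ T ∪ decoded S) :
    ∑ I ∈ T', Real.log (m I) -
      (∑ I, Real.log (m I) - Real.log (Fintype.card Ω)) ≤ jointEntropy A M S T := by
  have h1 := jointEntropy_mono (A := A) hdec (Finset.empty_subset S) hT
  -- Here the messages themselves serve as links, so decoding is trivial.
  have h2 := jointEntropy_union_le (A := fun J ω => M ω J) (M := M)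
    (fun _ _ _ h => h) (S := ∅) (S' := T'ᶜ) (T := T') (S₃ := T'ᶜ) (T₃ := T')
    (by simp) Finset.subset_union_left
  have h3 : jointEntropy (fun J ω => M ω J) M T'ᶜ T' = Real.log (Fintype.card Ω) := by
    refine entropy_of_injective fun x y h => hM (funext fun I => ?_)
    rw [joint_rel_iff (A := fun J ω => M ω J)] at h
    by_cases hI : I ∈ T'
    · exact h.2 I hI
    · exact h.1 I (Finset.mem_compl.2 hI)
  have h4 : jointEntropy (fun J ω => M ω J) M ∅ T' = jointEntropy A M ∅ T' := by
    unfold jointEntropy; congr 1; ext x y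
    rw [joint_rel_iff (A := fun J ω => M ω J), joint_rel_iff]; simp
  have h5 := Finset.sum_add_sum_compl T' fun I => Real.log (m I)
  simp only [Fintype.card_fin] at h2
  linarith

lemma log_messages_le_decoded (hM : Function.Injective M) (S : Finset (Fin 7)) :
    ∑ I ∈ decoded S, Real.log (m I) - (∑ I, Real.log (m I) - Real.log (Fintype.card Ω)) ≤
      ∑ J ∈ S, Real.log (Fintype.card (β J)) :=
  (le_jointEntropy hdec hM (T := ∅) (by simp)).trans (jointEntropy_le hdec)

/-- The links of two receivers are split into their union, completed to all links, and the messages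
that both receivers decode. -/
lemma log_messages_le_of_pair (hM : Function.Injective M) : ∀ i j, ∑ I ∈ decoded Finset.univ, Real.log (m I) +
      ∑ I ∈ demand i ∩ demand j, Real.log (m I) - 2 * (∑ I, Real.log (m I) - Real.log (Fintype.card Ω)) ≤
      ∑ J ∈ demand i, Real.log (Fintype.card (β J)) +
      ∑ J ∈ demand j, Real.log (Fintype.card (β J)) +
      ∑ J ∈ (demand i ∪ demand j)ᶜ, Real.log (Fintype.card (β J)) := by
  intro i j
  have hsub : ∀ i j, demand i ∩ demand j ⊆
      (∅ ∪ decoded (demand i)) ∩ (∅ ∪ decoded (demand j)) := by decide +kernel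
  have h1 := jointEntropy_submodular hdec (A := A) (M := M) (S₁ := demand i) (T₁ := ∅)
    (S₂ := demand j) (T₂ := ∅) (S₃ := demand i ∪ demand j) (T₃ := ∅) (S₄ := ∅)
    (T₄ := demand i ∩ demand j) subset_rfl (by simp) (by simp) (hsub i j)
  have h2 := jointEntropy_union_le hdec (S := demand i ∪ demand j) (S' := (demand i ∪ demand j)ᶜ)
    (T := ∅) (S₃ := Finset.univ) (T₃ := ∅) (Finset.union_compl _).ge (by simp)
  have h3 := le_jointEntropy (A := A) hdec hM (S := Finset.univ) (T := ∅)
    (T' := decoded Finset.univ) (by simp)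
  have h4 := le_jointEntropy (A := A) hdec hM (S := ∅) (T := demand i ∩ demand j)
    (T' := demand i ∩ demand j) (by simp)
  have h5 := jointEntropy_le hdec (S := demand i)
  have h6 := jointEntropy_le hdec (S := demand j)
  linarith

/-- Write L for links, by their indices, and M for messages. Receivers 0 and 1 leave the overlap
(L6, M3, M6). Trading it with receiver 2 gives (L2456, M3) and leaves L6. The union of the first two
receivers and (L2456, M3) then share the messages 3, 4, 5, 6. The entropy of L6 left over pays for
link 6 of receiver 1, which is why that link is missing on the right-hand side. -/
lemma log_messages_le_of_overlaps (hM : Function.Injective M) : ∑ I, Real.log (m I) + ∑ I ∈ {3, 4, 5, 6}, Real.log (m I) - 2 * (∑ I, Real.log (m I) - Real.log (Fintype.card Ω)) ≤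
      ∑ J ∈ {0, 3, 4, 6}, Real.log (Fintype.card (β J)) +
      ∑ J ∈ {1, 3, 5}, Real.log (Fintype.card (β J)) +
      ∑ J ∈ {2, 4, 5, 6}, Real.log (Fintype.card (β J)) := by
  have h1 := jointEntropy_submodular hdec (A := A) (M := M) (S₁ := {0, 3, 4, 6}) (T₁ := ∅)
    (S₂ := {1, 3, 5, 6}) (T₂ := ∅) (S₃ := {0, 1, 3, 4, 5, 6}) (T₃ := ∅) (S₄ := {6})
    (T₄ := {3, 6}) (by decide +kernel) (by decide +kernel) (by decide +kernel) (by decide +kernel)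
  have h2 := jointEntropy_submodular hdec (A := A) (M := M) (S₁ := {6}) (T₁ := {3, 6})
    (S₂ := {2, 4, 5, 6}) (T₂ := ∅) (S₃ := {2, 4, 5, 6}) (T₃ := {3}) (S₄ := {6})
    (T₄ := ∅) (by decide +kernel) (by decide +kernel) (by decide +kernel) (by decide +kernel)
  have h3 := jointEntropy_submodular hdec (A := A) (M := M) (S₁ := {0, 1, 3, 4, 5, 6}) (T₁ := ∅)
    (S₂ := {2, 4, 5, 6}) (T₂ := {3}) (S₃ := Finset.univ) (T₃ := ∅) (S₄ := ∅)
    (T₄ := {3, 4, 5, 6}) (by decide +kernel) (by decide +kernel) (by decide +kernel)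
    (by decide +kernel)
  have h4 := jointEntropy_union_le hdec (A := A) (M := M) (S := {6}) (S' := {1, 3, 5}) (T := ∅)
    (S₃ := {1, 3, 5, 6}) (T₃ := ∅) (by decide +kernel) (by decide +kernel)
  have h5 := jointEntropy_le hdec (A := A) (S := {0, 3, 4, 6})
  have h6 := jointEntropy_le hdec (A := A) (S := {2, 4, 5, 6})
  have h7 := le_jointEntropy (A := A) hdec hM (S := Finset.univ) (T := ∅)
    (T' := Finset.univ) (by decide +kernel)
  have h8 := le_jointEntropy (A := A) hdec hM (S := ∅) (T := {3, 4, 5, 6})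
    (T' := {3, 4, 5, 6}) (by decide +kernel)
  linarith

/-- The overlap of receivers i and j retains their common links and common messages. It is then
merged with receiver k, the two sharing the message intended for everybody. One of the two resulting
unions is completed to all links, the other is extended by U. -/
lemma log_messages_le_of_triple (hM : Function.Injective M) : ∀ i j k, i ≠ j → i ≠ k → j ≠ k → ∀ U,
      ∑ I ∈ decoded (demand i ∪ demand j ∪ U), Real.log (m I) + ∑ I, Real.log (m I) +
        Real.log (m 6) - 3 * (∑ I, Real.log (m I) - Real.log (Fintype.card Ω)) ≤
      ∑ J ∈ demand i, Real.log (Fintype.card (β J)) +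
      ∑ J ∈ demand j, Real.log (Fintype.card (β J)) +
      ∑ J ∈ demand k, Real.log (Fintype.card (β J)) +
      ∑ J ∈ (demand i ∩ demand j ∪ demand k)ᶜ, Real.log (Fintype.card (β J)) +
      ∑ J ∈ U, Real.log (Fintype.card (β J)) := by
  intro i j k hij hik hjk U
  have hsub : ∀ i j k, i ≠ j → i ≠ k → j ≠ k → demand i ∩ demand j ⊆
      (∅ ∪ decoded (demand i)) ∩ (∅ ∪ decoded (demand j)) ∧
      ({6} : Finset (Fin 7)) ⊆ (demand i ∩ demand j ∪ decoded (demand i ∩ demand j)) ∩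
        (∅ ∪ decoded (demand k)) := by decide +kernel
  obtain ⟨hs1, hs2⟩ := hsub i j k hij hik hjk
  have h1 := jointEntropy_submodular hdec (A := A) (M := M) (S₁ := demand i) (T₁ := ∅)
    (S₂ := demand j) (T₂ := ∅) (S₃ := demand i ∪ demand j) (T₃ := ∅) (S₄ := demand i ∩ demand j)
    (T₄ := demand i ∩ demand j) subset_rfl (by simp) subset_rfl hs1
  have h2 := jointEntropy_submodular hdec (A := A) (M := M) (S₁ := demand i ∩ demand j)
    (T₁ := demand i ∩ demand j) (S₂ := demand k) (T₂ := ∅)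
    (S₃ := demand i ∩ demand j ∪ demand k) (T₃ := ∅) (S₄ := ∅)
    (T₄ := {6}) subset_rfl (by simp) (by simp) hs2
  have h3 := jointEntropy_union_le hdec (A := A) (M := M) (S := demand i ∩ demand j ∪ demand k)
    (S' := (demand i ∩ demand j ∪ demand k)ᶜ) (T := ∅)
    (S₃ := Finset.univ) (T₃ := ∅) (Finset.union_compl _).ge (by simp)
  have h4 := jointEntropy_union_le hdec (A := A) (M := M) (S := demand i ∪ demand j)
    (S' := U) (T := ∅) (S₃ := demand i ∪ demand j ∪ U) (T₃ := ∅) (by simp) (by simp)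
  have h5 := jointEntropy_le hdec (A := A) (S := demand i)
  have h6 := jointEntropy_le hdec (A := A) (S := demand j)
  have h7 := jointEntropy_le hdec (A := A) (S := demand k)
  have h8 := le_jointEntropy (A := A) hdec hM (S := Finset.univ) (T := ∅)
    (T' := Finset.univ) (by decide +kernel)
  have h9 := le_jointEntropy (A := A) hdec hM (S := ∅) (T := {6}) (T' := {6}) (by simp)
  have h10 := le_jointEntropy (A := A) hdec hM (S := demand i ∪ demand j ∪ U) (T := ∅)
    (T' := decoded (demand i ∪ demand j ∪ U)) (by simp)
  rw [Finset.sum_singleton] at h9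
  linarith

/-- Messages that the receivers decode from the links intended for them cannot be larger than
what the columns of `G` allow. -/
theorem sum_G_log_le (hM : Function.Injective M) (l : Fin 15) :
    ∑ I, G I l * Real.log (m I) ≤ ∑ J, G J l * Real.log (Fintype.card (β J)) +
      3 * (∑ I, Real.log (m I) - Real.log (Fintype.card Ω)) := by
  have hL : 0 ≤ ∑ I, Real.log (m I) - Real.log (Fintype.card Ω) := by
    have h1 := le_jointEntropy hdec hM (S := ∅) (T := ∅) (T' := ∅) (by simp)
    have h2 := jointEntropy_le hdec (S := ∅)
    simp only [Finset.sum_empty] at h1 h2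
    linarith
  exact sum_G_le_of_bounds hL (log_messages_le_decoded hdec hM) (log_messages_le_of_pair hdec hM)
    (log_messages_le_of_overlaps hdec hM) (log_messages_le_of_triple hdec hM) l

end Links


/-! ### Carrying messages by messages -/

/-- Messages of sizes `m` can be carried by messages of sizes `w`: there is an encoder for which
every receiver can decode. -/
def Carries (w m : Fin 7 → ℕ) : Prop :=
  ∃ enc : (∀ I, Fin (m I)) → ∀ J, Fin (w J), ∀ i M M',
    (∀ J, i ∈ receivers J → enc M J = enc M' J) → ∀ I, i ∈ receivers I → M I = M' I

/-- The message `B` can be enlarged by a factor `card Q` if the value in `Q` is conveyed by pieces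
that replace parts of the messages in `A`. -/
lemma carries_of_pieces {P Q : Type*} [Fintype P] [Fintype Q] {w m : Fin 7 → ℕ}
    {A : Finset (Fin 7)} {B : Fin 7} (f : Fin 7 → Q → P)
    (hf : ∀ i ∈ receivers B, ∀ x x', (∀ J ∈ A, i ∈ receivers J → f J x = f J x') → x = x')
    (hA : ∀ J ∈ A, m J * Fintype.card P ≤ w J) (hB : m B ≤ w B * Fintype.card Q) (hBA : B ∉ A)
    (ho : ∀ J, J ∉ A → J ≠ B → m J ≤ w J) : Carries w m := by
  -- The enlarged message B is written as a pair: a part sent as message B and a value in `Q`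
  -- conveyed by the pieces.
  obtain ⟨ψ⟩ := Function.Embedding.nonempty_of_card_le
    (α := Fin (m B)) (β := Fin (w B) × Q) (by simpa using hB)
  -- Messages in `A` carry their own value and a piece, B carries the first component of `ψ`, and
  -- all others carry their own value only.
  have he : ∀ J, ∃ e : Fin (m J) → P → Fin (w J),
      (J ∈ A → ∀ a a' b b', e a b = e a' b' → a = a' ∧ b = b') ∧
      (J ∉ A → J ≠ B → ∀ a a' b b', e a b = e a' b' → a = a') ∧
      (∀ h : J = B, ∀ a b, e a b = h ▸ (ψ (h ▸ a)).1) := by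
    intro J
    by_cases hJ : J ∈ A
    · obtain ⟨φ⟩ := Function.Embedding.nonempty_of_card_le
        (α := Fin (m J) × P) (β := Fin (w J)) (by simpa using hA J hJ)
      refine ⟨fun a b => φ (a, b), fun _ a a' b b' h => ?_, fun h => absurd hJ h,
        fun h => absurd (h ▸ hJ) hBA⟩
      simpa using φ.injective h
    · by_cases hJB : J = B
      · subst hJB
        exact ⟨fun a _ => (ψ a).1, fun h => absurd h hJ, fun _ h => absurd rfl h,
          fun h a b => rfl⟩
      · exact ⟨fun a _ => Fin.castLE (ho J hJ hJB) a, fun h => absurd h hJ,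
          fun _ _ a a' b b' h => Fin.castLE_injective _ h, fun h => absurd h hJB⟩
  choose e he1 he2 he3 using he
  refine ⟨fun M J => e J (M J) (f J (ψ (M B)).2), fun i M M' h I hI => ?_⟩
  by_cases hIA : I ∈ A
  · exact (he1 I hIA _ _ _ _ (h I hI)).1
  · by_cases hIB : I = B
    · subst hIB
      have h1 := h I hI
      beta_reduce at h1
      rw [he3 I rfl, he3 I rfl] at h1
      refine ψ.injective (Prod.ext h1 (hf i hI _ _ fun J hJ hiJ => ?_))
      exact (he1 J hJ _ _ _ _ (h J hiJ)).2
    · exact he2 I hIA hIB _ _ _ _ (h I hI)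

lemma carries_of_le {w m : Fin 7 → ℕ} (h : ∀ I, m I ≤ w I) : Carries w m :=
  ⟨fun M J => Fin.castLE (h J) (M J), fun _ _ _ hJ I hI => Fin.castLE_injective _ (hJ I hI)⟩

/-- The message that gains from the `j`-th elementary operation. -/
def target : Fin 16 → Fin 7 := ![3, 4, 5, 0, 1, 6, 0, 6, 2, 6, 1, 2, 3, 4, 5, 6]

/-- The messages that the `j`-th elementary operation consumes. -/
def sources (j : Fin 16) : Finset (Fin 7) := Finset.univ.filter fun J => intH j J < 0

/-- The multiplicity with which the `j`-th elementary operation produces its target. -/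
def gain (j : Fin 16) : ℕ := if j = 15 then 2 else 1

lemma intH_eq : ∀ j J, intH j J =
    if J = target j then (gain j : ℤ) else if J ∈ sources j then -1 else 0 := by decide +kernel

lemma target_notMem_sources : ∀ j, target j ∉ sources j := by decide +kernel

/-- The elementary operations, with pieces of size `p`. -/
lemma carries_of_operation (j : Fin 16) {w m : Fin 7 → ℕ} {p : ℕ} (hp : 0 < p)
    (hA : ∀ J ∈ sources j, m J * p ≤ w J) (hB : m (target j) ≤ w (target j) * p ^ gain j)
    (ho : ∀ J, J ∉ sources j → J ≠ target j → m J ≤ w J) : Carries w m := by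
  by_cases hj : j = 15
  · subst hj
    have : NeZero p := ⟨hp.ne'⟩
    -- The exclusive or, with addition modulo `p`: messages 12, 13, 23 carry x, y, x + y. Each
    -- receiver sees two of the three, and any two determine (x, y).
    refine carries_of_pieces (P := Fin p) (Q := Fin p × Fin p)
      (fun J x => if J = 3 then x.1 else if J = 4 then x.2 else x.1 + x.2) ?_
      (by simpa using hA) (by simpa [gain, sq] using hB) (target_notMem_sources 15) ho
    rintro i - ⟨x, y⟩ ⟨x', y'⟩ h
    have h3 := h 3 (by decide +kernel)
    have h4 := h 4 (by decide +kernel)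
    have h5 := h 5 (by decide +kernel)
    have hr : ∀ i : Fin 3, (i ∈ receivers 3 ∧ i ∈ receivers 4) ∨
        (i ∈ receivers 3 ∧ i ∈ receivers 5) ∨ (i ∈ receivers 4 ∧ i ∈ receivers 5) := by
      decide +kernel
    simp only [if_true, show (4 : Fin 7) ≠ 3 by decide, show (5 : Fin 7) ≠ 3 by decide,
      show (5 : Fin 7) ≠ 4 by decide, if_false] at h3 h4 h5
    rcases hr i with ⟨ha, hb⟩ | ⟨ha, hb⟩ | ⟨ha, hb⟩
    · rw [h3 ha, h4 hb]
    · have h1 := h3 ha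
      have h2 := h5 hb
      rw [h1] at h2
      rw [h1, add_left_cancel h2]
    · have h1 := h4 ha
      have h2 := h5 hb
      rw [h1] at h2
      rw [h1, add_right_cancel h2]
  -- In the other columns all sources carry the same piece, and every receiver of the target sees at
  -- least one source.
  · refine carries_of_pieces (P := Fin p) (Q := Fin p) (fun _ x => x) ?_
      (by simpa using hA) (by simpa [gain, hj] using hB) (target_notMem_sources j) ho
    intro i hi x x' h
    have hr : ∀ j, j ≠ 15 → ∀ i ∈ receivers (target j), ∃ J ∈ sources j, i ∈ receivers J := by
      decide +kernel
    obtain ⟨J, hJ, hiJ⟩ := hr j hj i hi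
    exact h J hJ hiJ

/-! ### Universal encoding/decoding operations -/

/-- A universal operation, from an encoder for which every receiver can decode. -/
def UniversalOperation.ofEncoder {n : ℕ} {RW RM : Rates} (w m : Fin 7 → ℕ)
    (hw : ∀ J, (w J : ℝ) = 2 ^ ((n : ℝ) * RW J)) (hm : ∀ I, (m I : ℝ) = 2 ^ ((n : ℝ) * RM I))
    (enc : (∀ I, Fin (m I)) → ∀ J, Fin (w J))
    (henc : ∀ i M M', (∀ J, i ∈ receivers J → enc M J = enc M' J) →
      ∀ I, i ∈ receivers I → M I = M' I) : UniversalOperation n RW RM where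
  w := w
  m := m
  w_eq := hw
  m_eq := hm
  enc := enc
  dec i I W := by
    classical
    exact if h : ∃ M, (fun J : Demand i => enc M J.1) = W then h.choose I.1 else
      ⟨0, by
        have : (0 : ℝ) < m I.1 := by rw [hm]; positivity
        exact_mod_cast this⟩
  dec_enc M i I := by
    have h : ∃ M', (fun J : Demand i => enc M' J.1) = fun J : Demand i => enc M J.1 := ⟨M, rfl⟩
    rw [dif_pos h]
    exact henc i _ _ (fun J hJ => congrFun h.choose_spec ⟨J, hJ⟩) I.1 I.2

lemma isUniversalDirection_H_col (j : Fin 16) : IsUniversalDirection (normalized (H.col j)) := by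
  -- At block length one: a bit on each source carries `gain j` bits of the target.
  set RW : Rates := fun J => if J ∈ sources j then 1 else 0 with hRW
  set RM : Rates := fun J => if J = target j then gain j else 0 with hRM
  have hdiff : RM - RW = H.col j := by
    ext J
    rw [H_col_eq]
    beta_reduce
    rw [intH_eq]
    by_cases h1 : J = target j
    · have h2 : J ∉ sources j := h1 ▸ target_notMem_sources j
      simp [hRW, hRM, h1, target_notMem_sources]
    · by_cases h2 : J ∈ sources j <;> simp [hRW, hRM, h1, h2]
  refine ⟨1, one_pos, RW, RM, ?_, ?_, by rw [hdiff]⟩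
  · obtain ⟨enc, henc⟩ := carries_of_operation j (p := 2)
      (w := fun J => if J ∈ sources j then 2 else 1)
      (m := fun J => if J = target j then 2 ^ gain j else 1) two_pos
      (fun J hJ => by
        have : J ≠ target j := fun h => target_notMem_sources j (h ▸ hJ)
        simp [hJ, this])
      (by simp [target_notMem_sources])
      (fun J h1 h2 => by simp [h1, h2])
    refine ⟨UniversalOperation.ofEncoder _ _ (fun J => ?_) (fun J => ?_) enc henc⟩
    · by_cases h : J ∈ sources j <;> simp [hRW, h]
    · by_cases h : J = target j <;> simp [hRM, h]
  · intro h
    apply H_col_ne_zero j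
    rw [← hdiff, h, sub_self]

/-- Decoding is correct for every message tuple, so the entropy bound applies with all tuples as Ω
and no deficit. -/
lemma UniversalOperation.sub_mem_multicastCone {n : ℕ} (hn : 0 < n) {RW RM : Rates}
    (u : UniversalOperation n RW RM) : RM - RW ∈ multicastCone := by
  have hw : ∀ J, Real.log (u.w J) = n * RW J * Real.log 2 := fun J => by
    rw [u.w_eq, Real.log_rpow two_pos]
  have hm : ∀ I, Real.log (u.m I) = n * RM I * Real.log 2 := fun I => by
    rw [u.m_eq, Real.log_rpow two_pos]
  have hmpos : ∀ I, 0 < u.m I := fun I => by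
    have : (0 : ℝ) < u.m I := by rw [u.m_eq]; positivity
    exact_mod_cast this
  have : Nonempty (∀ I, Fin (u.m I)) := ⟨fun I => ⟨0, hmpos I⟩⟩
  have key := sum_G_log_le (Ω := ∀ I, Fin (u.m I)) (β := fun J => Fin (u.w J))
    (A := fun J M => u.enc M J) (M := fun M => M) (fun i M M' h I hI => by
      rw [← u.dec_enc M i ⟨I, hI⟩, ← u.dec_enc M' i ⟨I, hI⟩]
      congr 1
      funext J
      exact h J.1 J.2) Function.injective_id
  have hcard : Real.log (Fintype.card (∀ I, Fin (u.m I))) = ∑ I, Real.log (u.m I) := by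
    rw [Fintype.card_pi, Nat.cast_prod, Real.log_prod fun I _ => by
      simpa using (hmpos I).ne']
    simp
  simp only [hcard, sub_self, mul_zero, add_zero, Fintype.card_fin, hw, hm] at key
  rw [mem_multicastCone]
  intro l
  have hpos : (0 : ℝ) < n * Real.log 2 :=
    mul_pos (Nat.cast_pos.2 hn) (Real.log_pos one_lt_two)
  have hkl := key l
  rw [← sub_nonpos, ← Finset.sum_sub_distrib] at hkl
  have : ∑ I, (G I l * (n * RM I * Real.log 2) - G I l * (n * RW I * Real.log 2)) =
      (n * Real.log 2) * ∑ I, (intG I l : ℝ) * (RM - RW) I := by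
    rw [Finset.mul_sum]
    refine Finset.sum_congr rfl fun I _ => ?_
    rw [G_apply, Pi.sub_apply]; ring
  rw [this] at hkl
  exact nonpos_of_mul_nonpos_right hkl hpos

theorem setOf_isDistinct :
    {d | IsDistinct d} = Set.range fun j : Fin 16 => normalized (H.col j) := by
  refine setOf_isDistinct_eq ?_ isUniversalDirection_H_col
  rintro d ⟨n, hn, RW, RM, ⟨u⟩, hne, rfl⟩
  have h0 : RM - RW ≠ 0 := sub_ne_zero.2 hne
  exact ⟨multicastCone_smul (u.sub_mem_multicastCone hn) (inv_nonneg.2 (norm_nonneg _)),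
    norm_toLp_normalized h0⟩

theorem ncard_isDistinct : {d | IsDistinct d}.ncard = 16 := by
  rw [setOf_isDistinct, Set.ncard_range_of_injective normalized_H_col_injective, Nat.card_fin]

theorem H_col_fifteen : H.col 15 = ![0, 0, 0, -1, -1, -1, 2] := by
  ext I
  fin_cases I <;> simp [H]

/-- The operation that sends the two bits of `M₁₂₃` and their exclusive or. -/
theorem exists_xor_operation :
    ∃ u : UniversalOperation 1 ![0, 0, 0, 1, 1, 1, 0] ![0, 0, 0, 0, 0, 0, 2],
      ∀ M, (u.enc M 3 : ℕ) = (M 6 : ℕ) / 2 ∧ (u.enc M 4 : ℕ) = (M 6 : ℕ) % 2 ∧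
        (u.enc M 5 : ℕ) = (u.enc M 3 : ℕ) ^^^ (u.enc M 4 : ℕ) := by
  let w : Fin 7 → ℕ := ![1, 1, 1, 2, 2, 2, 1]
  let m : Fin 7 → ℕ := ![1, 1, 1, 1, 1, 1, 4]
  let val : Fin 7 → ℕ → ℕ := fun J x =>
    if J = 3 then x / 2 else if J = 4 then x % 2 else if J = 5 then (x / 2) ^^^ (x % 2) else 0
  have hval : ∀ J : Fin 7, ∀ x : Fin 4, val J x < w J := by decide +kernel
  have hdec : ∀ i : Fin 3, ∀ x y : Fin 4, (∀ J, i ∈ receivers J → val J x = val J y) → x = y := by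
    decide +kernel
  have hm1 : ∀ I, I ≠ 6 → m I = 1 := by decide +kernel
  refine ⟨UniversalOperation.ofEncoder w m (fun J => ?_) (fun I => ?_)
    (fun M J => ⟨val J (M 6), hval J (M 6)⟩) ?_, fun M => ⟨rfl, rfl, rfl⟩⟩
  · fin_cases J <;> simp [w]
  · fin_cases I <;> norm_num [m]
  · intro i M M' h I hI
    by_cases hI6 : I = 6
    · subst hI6
      exact hdec i _ _ fun J hJ => congrArg Fin.val (h J hJ)
    · have : Subsingleton (Fin (m I)) := by rw [hm1 I hI6]; infer_instance
      exact Subsingleton.elim _ _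


/-! ### Capacity regions are closed under the elementary operations -/

lemma Code.errorProb_nonneg {c : Channel} {n : ℕ} {m : Fin 7 → ℕ} (C : Code c n m) :
    0 ≤ C.errorProb :=
  div_nonneg (Finset.sum_nonneg fun _ _ => measureReal_nonneg) (Nat.cast_nonneg _)

/-- If messages of sizes `m` can be carried by messages of sizes `w`, then a code for the latter
yields one for the former, with no larger error probability. Since the carrying messages are not
uniform, they are shifted by constants, of which the best choice is taken. -/
lemma Code.exists_of_carries {c : Channel} {n : ℕ} {w m : Fin 7 → ℕ} (C : Code c n w)
    (h : Carries w m) (hw : ∀ J, 0 < w J) (hm : ∀ I, 0 < m I) :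
    ∃ C' : Code c n m, C'.errorProb ≤ C.errorProb := by
  classical
  have : ∀ J, NeZero (w J) := fun J => ⟨(hw J).ne'⟩
  have : ∀ I, NeZero (m I) := fun I => ⟨(hm I).ne'⟩
  obtain ⟨enc, henc⟩ := h
  set e : (∀ J, Fin (w J)) → ℝ := fun v =>
    (Measure.pi fun t => c.law (C.enc v t)).real
        {y : Fin n → ∀ i, c.Y i | ∃ i, ∃ I : Demand i, C.dec i I (fun t => y t i) ≠ v I.1} with he
  obtain ⟨d, -, hd⟩ := Finset.exists_le_of_sum_le (s := (Finset.univ : Finset (∀ J, Fin (w J))))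
    (f := fun d => ∑ M, e (enc M + d))
    (g := fun _ => (Fintype.card (∀ I, Fin (m I)) : ℝ) * (∑ v, e v) /
      Fintype.card (∀ J, Fin (w J))) Finset.univ_nonempty (by
    rw [Finset.sum_comm, Finset.sum_const, nsmul_eq_mul, Finset.card_univ,
      mul_div_cancel₀ _ (Nat.cast_ne_zero.2 Fintype.card_ne_zero)]
    have : ∀ M, ∑ d, e (enc M + d) = ∑ v, e v := fun M =>
      Fintype.sum_equiv (Equiv.addLeft (enc M)) _ _ fun d => rfl
    simp [this])
  let D : ∀ i : Fin 3, ∀ I : Demand i, (∀ J : Demand i, Fin (w J.1)) → Fin (m I.1) :=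
    fun i I V => if h : ∃ M, (fun J : Demand i => enc M J.1) = V then h.choose I.1 else 0
  refine ⟨⟨fun M => C.enc (enc M + d), fun i I y => D i I fun J => C.dec i J y - d J.1,
    fun i I => ?_⟩, ?_⟩
  · exact (Measurable.of_discrete (f := fun V : ∀ J : Demand i, Fin (w J.1) =>
      D i I fun J => V J - d J.1)).comp (measurable_pi_lambda _ fun J => C.measurable_dec i J)
  · have hle : ∀ M, (Measure.pi fun t => c.law (C.enc (enc M + d) t)).real
        {y : Fin n → ∀ i, c.Y i | ∃ i, ∃ I : Demand i,
          D i I (fun J => C.dec i J (fun t => y t i) - d J.1) ≠ M I.1} ≤ e (enc M + d) := by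
      intro M
      refine measureReal_mono ?_ (measure_ne_top _ _)
      rintro y ⟨i, I, hne⟩
      by_contra hcon
      simp only [Set.mem_ofPred_eq, not_exists, not_not] at hcon
      refine hne ?_
      have h1 : (fun J : Demand i => C.dec i J (fun t => y t i) - d J.1) =
          fun J : Demand i => enc M J.1 := by
        funext J
        rw [hcon i J, Pi.add_apply, add_sub_cancel_right]
      have h2 : ∃ M', (fun J : Demand i => enc M' J.1) = fun J : Demand i => enc M J.1 := ⟨M, rfl⟩
      rw [h1]
      simp only [D]
      rw [dif_pos h2]
      exact henc i _ _ (fun J hJ => congrFun h2.choose_spec ⟨J, hJ⟩) I.1 I.2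
    have hN : (0 : ℝ) < Fintype.card (∀ I, Fin (m I)) := Nat.cast_pos.2 Fintype.card_pos
    rw [Code.errorProb, Code.errorProb, div_le_iff₀ hN]
    refine (Finset.sum_le_sum fun M _ => hle M).trans (hd.trans (le_of_eq ?_))
    rw [he]; ring

/-- The number of values of the message `I` at rates `R` and block length `n`. -/
def size (n : ℕ) (R : Rates) (I : Fin 7) : ℕ := ⌈(2 : ℝ) ^ ((n : ℝ) * R I)⌉₊

lemma size_pos (n : ℕ) (R : Rates) (I : Fin 7) : 0 < size n R I := Nat.ceil_pos.2 (by positivity)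

lemma Achievable.of_carries {c : Channel} {R R' : Rates} (hR : Achievable c R) (hR' : 0 ≤ R')
    (h : ∀ᶠ n in atTop, Carries (size n R) (size n R')) : Achievable c R' := by
  classical
  obtain ⟨-, C, hC⟩ := hR
  have hex : ∀ n, ∃ C' : Code c n (size n R'),
      Carries (size n R) (size n R') → C'.errorProb ≤ (C n).errorProb := by
    intro n
    by_cases hn : Carries (size n R) (size n R')
    · obtain ⟨C', hC'⟩ := (C n).exists_of_carries hn (size_pos n R) (size_pos n R')
      exact ⟨C', fun _ => hC'⟩
    -- An arbitrary code for the block lengths not covered; the given encoder supplies the input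
    -- letters.
    · exact ⟨⟨fun _ => (C n).enc fun J => ⟨0, size_pos n R J⟩, fun _ I _ => ⟨0, size_pos n R' I.1⟩,
        fun _ _ => measurable_const⟩, fun h => absurd h hn⟩
  choose C' hC' using hex
  refine ⟨hR', C', squeeze_zero' (Eventually.of_forall fun n => (C' n).errorProb_nonneg) ?_ hC⟩
  filter_upwards [h] with n hn using hC' n hn

lemma ceil_two_rpow_le {x : ℝ} (hx : 0 ≤ x) : (⌈(2 : ℝ) ^ x⌉₊ : ℝ) ≤ 2 * 2 ^ x := by
  have h1 : (1 : ℝ) ≤ 2 ^ x := Real.one_le_rpow one_le_two hx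
  linarith [(Nat.ceil_lt_add_one (by positivity : (0 : ℝ) ≤ 2 ^ x)).le]

lemma eventually_ceil_mul_ceil_le {a t r : ℝ} (ha : 0 ≤ a) (ht : 0 ≤ t) (h : a + t < r) :
    ∀ᶠ n : ℕ in atTop, ⌈(2 : ℝ) ^ ((n : ℝ) * a)⌉₊ * ⌈(2 : ℝ) ^ ((n : ℝ) * t)⌉₊ ≤
      ⌈(2 : ℝ) ^ ((n : ℝ) * r)⌉₊ := by
  have hpos : 0 < r - (a + t) := sub_pos.2 h
  -- Rounding up costs a factor of at most 2 in each of the two sizes on the left, that is, two bits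
  -- in the exponent.
  filter_upwards [eventually_ge_atTop ⌈2 / (r - (a + t))⌉₊] with n hn
  have hn' : 2 ≤ n * (r - (a + t)) := (div_le_iff₀ hpos).1 (Nat.ceil_le.1 hn)
  rw [← Nat.cast_le (α := ℝ), Nat.cast_mul]
  calc (⌈(2 : ℝ) ^ ((n : ℝ) * a)⌉₊ : ℝ) * ⌈(2 : ℝ) ^ ((n : ℝ) * t)⌉₊
      ≤ (2 * 2 ^ ((n : ℝ) * a)) * (2 * 2 ^ ((n : ℝ) * t)) := by
        gcongr <;> exact ceil_two_rpow_le (by positivity)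
    _ = 2 ^ (2 + n * a + n * t : ℝ) := by
        rw [Real.rpow_add two_pos, Real.rpow_add two_pos, Real.rpow_two]; ring
    _ ≤ 2 ^ ((n : ℝ) * r) := Real.rpow_le_rpow_of_exponent_le one_le_two (by linarith)
    _ ≤ _ := Nat.le_ceil _

lemma eventually_ceil_le_mul_pow {b r t : ℝ} (k : ℕ) (hb : 0 ≤ b) (h : b < r + k * t) :
    ∀ᶠ n : ℕ in atTop, ⌈(2 : ℝ) ^ ((n : ℝ) * b)⌉₊ ≤
      ⌈(2 : ℝ) ^ ((n : ℝ) * r)⌉₊ * ⌈(2 : ℝ) ^ ((n : ℝ) * t)⌉₊ ^ k := by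
  have hpos : 0 < r + k * t - b := sub_pos.2 h
  filter_upwards [eventually_ge_atTop ⌈1 / (r + k * t - b)⌉₊] with n hn
  have hn' : 1 ≤ n * (r + k * t - b) := (div_le_iff₀ hpos).1 (Nat.ceil_le.1 hn)
  rw [← Nat.cast_le (α := ℝ), Nat.cast_mul, Nat.cast_pow]
  calc (⌈(2 : ℝ) ^ ((n : ℝ) * b)⌉₊ : ℝ) ≤ 2 * 2 ^ ((n : ℝ) * b) :=
        ceil_two_rpow_le (by positivity)
    _ = 2 ^ (1 + n * b : ℝ) := by rw [Real.rpow_add two_pos, Real.rpow_one]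
    _ ≤ 2 ^ (n * r + n * t * k : ℝ) :=
        Real.rpow_le_rpow_of_exponent_le one_le_two (by linarith)
    _ = 2 ^ ((n : ℝ) * r) * (2 ^ ((n : ℝ) * t)) ^ k := by
        rw [Real.rpow_add two_pos, Real.rpow_mul_natCast two_pos.le]
    _ ≤ _ := by gcongr <;> exact Nat.le_ceil _

/-- The pieces have about 2^{nt} values. Sources and target need strict slack to absorb the
rounding; the other messages need none, since rounding is monotone. -/
lemma Achievable.of_operation {c : Channel} {R R' : Rates} (hR : Achievable c R) (hR' : 0 ≤ R')
    (j : Fin 16) {t : ℝ} (ht : 0 ≤ t) (hA : ∀ J ∈ sources j, R' J + t < R J)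
    (hB : R' (target j) < R (target j) + gain j * t)
    (ho : ∀ J, J ∉ sources j → J ≠ target j → R' J ≤ R J) : Achievable c R' := by
  refine hR.of_carries hR' ?_
  have h1 : ∀ᶠ n : ℕ in atTop, ∀ J ∈ sources j,
      size n R' J * ⌈(2 : ℝ) ^ ((n : ℝ) * t)⌉₊ ≤ size n R J :=
    (Finset.eventually_all _).2 fun J hJ => eventually_ceil_mul_ceil_le (hR' J) ht (hA J hJ)
  filter_upwards [h1, eventually_ceil_le_mul_pow (gain j) (hR' (target j)) hB] with n hn1 hn2
  refine carries_of_operation j (Nat.ceil_pos.2 (by positivity)) hn1 hn2 fun J h1 h2 => ?_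
  exact Nat.ceil_mono (Real.rpow_le_rpow_of_exponent_le one_le_two
    (mul_le_mul_of_nonneg_left (ho J h1 h2) (Nat.cast_nonneg n)))

lemma capacityRegion_nonneg {c : Channel} {R : Rates} (hR : R ∈ capacityRegion c) : 0 ≤ R := by
  have h : capacityRegion c ⊆ Set.Ici 0 := closure_minimal (fun _ h => h.1) isClosed_Ici
  exact h hR

lemma capacityRegion_of_le {c : Channel} {R R' : Rates} (hR : R ∈ capacityRegion c) (hR' : 0 ≤ R')
    (hle : R' ≤ R) : R' ∈ capacityRegion c := by
  -- Truncation by `R'` preserves achievability, is continuous and sends `R` to `R'`, so it can be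
  -- applied to the closure.
  have hcont : Continuous fun S : Rates => S ⊓ R' := 
    continuous_pi fun I => (continuous_apply I).min continuous_const
  have hmaps : Set.MapsTo (fun S : Rates => S ⊓ R') {S | Achievable c S} {S | Achievable c S} := by
    intro S hS
    refine Achievable.of_carries (R := S) hS (le_inf hS.1 hR') (Eventually.of_forall fun n => ?_)
    refine carries_of_le fun I => Nat.ceil_mono (Real.rpow_le_rpow_of_exponent_le one_le_two
      (mul_le_mul_of_nonneg_left ?_ (Nat.cast_nonneg n)))
    exact inf_le_left
  have := hmaps.closure hcont hR
  simp only [inf_eq_right.2 hle] at this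
  exact this

lemma capacityRegion_operation {c : Channel} {R : Rates} (hR : R ∈ capacityRegion c) (j : Fin 16)
    {t : ℝ} (ht : 0 ≤ t) (h0 : 0 ≤ R + t • H.col j) : R + t • H.col j ∈ capacityRegion c := by
  rcases ht.eq_or_lt with rfl | ht
  · simpa using hR
  have hcol : ∀ J, (R + t • H.col j) J =
      R J + t * (if J = target j then (gain j : ℝ) else if J ∈ sources j then -1 else 0) := by
    intro J
    rw [Pi.add_apply, Pi.smul_apply, smul_eq_mul, H_col_eq]
    beta_reduce
    rw [intH_eq]
    push_cast
    rfl
  set R' := R + t • H.col j with hR'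
  set k : ℝ := (gain j : ℝ) with hk
  have hk1 : 1 ≤ k := by rw [hk, gain]; split_ifs <;> norm_num
  rw [capacityRegion, Metric.mem_closure_iff] at hR ⊢
  intro ε hε
  -- The operation is applied to an achievable `S` within δ of `R`, with `t - δ` instead of `t`. The
  -- target thereby loses up to `(k + 1) * δ`: the first bound on δ keeps the result within ε, the
  -- second keeps it nonnegative, as k ≥ 1.
  set δ := min (ε / (2 * (k + 1))) (t / (k + 1)) with hδ
  have hδ0 : 0 < δ := by positivity
  have hδε : (k + 1) * δ ≤ ε / 2 := by
    calc (k + 1) * δ ≤ (k + 1) * (ε / (2 * (k + 1))) :=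
          mul_le_mul_of_nonneg_left (min_le_left _ _) (by positivity)
      _ = ε / 2 := by field_simp
  have hδt : (k + 1) * δ ≤ t := by
    calc (k + 1) * δ ≤ (k + 1) * (t / (k + 1)) :=
          mul_le_mul_of_nonneg_left (min_le_right _ _) (by positivity)
      _ = t := by field_simp
  have hδε' : δ < ε := by nlinarith
  obtain ⟨S, hS, hRS⟩ := hR δ hδ0
  have hRS' : ∀ J, |R J - S J| < δ := fun J =>
    (Real.dist_eq _ _ ▸ (dist_le_pi_dist R S J)).trans_lt hRS
  have hR0 : ∀ J, 0 ≤ S J := hS.1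
  have htgt : R' (target j) = R (target j) + t * k := by rw [hcol, if_pos rfl]
  have hRt : 0 ≤ R (target j) + δ := by
    have := abs_lt.1 (hRS' (target j)); linarith [hR0 (target j)]
  refine ⟨fun J => if J = target j then R' J - (k + 1) * δ else
    if J ∈ sources j then R' J else S J, ?_, ?_⟩
  · refine Achievable.of_operation (R := S) hS ?_ j (t := t - δ) (by nlinarith) ?_ ?_ ?_
    · intro J
      change 0 ≤ if J = target j then R' J - (k + 1) * δ else if J ∈ sources j then R' J else S J
      split_ifs with h1 h2
      · subst h1
        have hge : 0 ≤ R (target j) := by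
          by_contra hneg
          have hcl : R ∈ capacityRegion c := by
            rw [capacityRegion, Metric.mem_closure_iff]; assumption
          exact hneg (capacityRegion_nonneg hcl (target j))
        rw [htgt]; nlinarith
      · exact h0 J
      · exact hR0 J
    · intro J hJ
      have hne : J ≠ target j := fun h => target_notMem_sources j (h ▸ hJ)
      have := abs_lt.1 (hRS' J)
      rw [if_neg hne, if_pos hJ, hcol, if_neg hne, if_pos hJ]
      linarith
    · rw [if_pos rfl, htgt]
      have := abs_lt.1 (hRS' (target j))
      linarith
    · intro J h1 h2
      rw [if_neg h2, if_neg h1]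
  · refine lt_of_le_of_lt ((dist_pi_le_iff (by positivity : 0 ≤ max δ (ε / 2))).2 fun J => ?_)
      (max_lt hδε' (by linarith))
    rw [Real.dist_eq]
    split_ifs with h1 h2
    · rw [sub_sub_cancel, abs_of_nonneg (by positivity)]
      exact hδε.trans (le_max_right _ _)
    · simp [hδ0.le]
    · rw [hcol, if_neg h1, if_neg h2, mul_zero, add_zero]
      exact (hRS' J).le.trans (le_max_left _ _)


/-! ### Capacity regions are closed under moves in the multicast cone -/

lemma neg_one_le_intH : ∀ j J, -1 ≤ intH j J := by decide +kernel

lemma H_col_apply (j : Fin 16) (J : Fin 7) : H.col j J = intH j J := H_apply J j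

/-- No entry of `H` is below -1, so when all rates are at least the total weight, the operations can
be performed one after another without leaving the orthant. -/
lemma capacityRegion_add_sum {c : Channel} {P : Rates} (hP : P ∈ capacityRegion c)
    {a : Fin 16 → ℝ} (ha : 0 ≤ a) (hle : ∀ I, ∑ j, a j ≤ P I) :
    P + ∑ j, a j • H.col j ∈ capacityRegion c := by
  classical
  suffices h : ∀ F : Finset (Fin 16), P + ∑ j ∈ F, a j • H.col j ∈ capacityRegion c from h _
  intro F
  induction F using Finset.induction_on with
  | empty => simpa using hP
  | insert j F hj ih =>
    have hnonneg : 0 ≤ P + ∑ j ∈ insert j F, a j • H.col j := by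
      intro I
      have h1 : -∑ k, a k ≤ (∑ k ∈ insert j F, a k • H.col k) I := by
        rw [Finset.sum_apply]
        calc -∑ k, a k ≤ -∑ k ∈ insert j F, a k :=
              neg_le_neg (Finset.sum_le_sum_of_subset_of_nonneg (Finset.subset_univ _)
                fun k _ _ => ha k)
          _ = ∑ k ∈ insert j F, a k * (-1) := by
              rw [← Finset.sum_mul, mul_neg_one]
          _ ≤ _ := Finset.sum_le_sum fun k _ => by
              rw [Pi.smul_apply, smul_eq_mul, H_col_apply]
              exact mul_le_mul_of_nonneg_left (by exact_mod_cast neg_one_le_intH k I) (ha k)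
      have := hle I
      change 0 ≤ P I + _
      linarith
    rw [Finset.sum_insert hj, add_comm (a j • _), ← add_assoc] at hnonneg ⊢
    exact capacityRegion_operation ih j (ha j) hnonneg

/-- Continuous induction along the segment from R to S: before its end all rates are bounded below
by some μ > 0, so a step with total weight at most μ is possible, and the capacity region is closed.
-/
lemma capacityRegion_of_pos {c : Channel} {R S : Rates} (hR : R ∈ capacityRegion c)
    (hR0 : ∀ I, 0 < R I) (hS0 : ∀ I, 0 < S I) (hRS : S - R ∈ multicastCone) :
    S ∈ capacityRegion c := by
  obtain ⟨a, ha, hsum⟩ := exists_eq_sum_H_col hRS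
  have hcont : Continuous fun t : ℝ => R + t • (S - R) := by fun_prop
  have hclosed : IsClosed ((fun t : ℝ => R + t • (S - R)) ⁻¹' capacityRegion c) :=
    isClosed_closure.preimage hcont
  have key := (hclosed.inter isClosed_Icc).Icc_subset_of_forall_exists_gt
    (a := (0 : ℝ)) (b := 1) (by simpa using hR) ?_ (Set.right_mem_Icc.2 zero_le_one)
  · simpa using key
  rintro x ⟨hx, hx0, hx1⟩ y (hy : x < y)
  have hpos : ∀ I, 0 < (R + x • (S - R)) I := fun I => by
    have : (R + x • (S - R)) I = (1 - x) * R I + x * S I := by simp; ring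
    rw [this]
    have h1 := mul_pos (sub_pos.2 hx1) (hR0 I)
    have h2 := mul_nonneg hx0 (hS0 I).le
    linarith
  obtain ⟨μ, hμ, hμle⟩ : ∃ μ > 0, ∀ I, μ ≤ (R + x • (S - R)) I := by
    obtain ⟨I, -, hI⟩ := Finset.exists_min_image Finset.univ (R + x • (S - R)) Finset.univ_nonempty
    exact ⟨_, hpos I, fun K => hI K (Finset.mem_univ K)⟩
  have hA : 0 ≤ ∑ j, a j := Finset.sum_nonneg fun j _ => ha j
  set ε := min (y - x) (μ / (∑ j, a j + 1)) with hε
  have hε0 : 0 < ε := lt_min (sub_pos.2 hy) (by positivity)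
  refine ⟨x + ε, ?_, by linarith, by linarith [min_le_left (y - x) (μ / (∑ j, a j + 1))]⟩
  have h1 := capacityRegion_add_sum hx (a := ε • a) (smul_nonneg hε0.le ha) fun I => by
    refine le_trans ?_ (hμle I)
    calc ∑ j, (ε • a) j = ε * ∑ j, a j := by simp [Finset.mul_sum]
      _ ≤ μ / (∑ j, a j + 1) * (∑ j, a j + 1) :=
          mul_le_mul (min_le_right _ _) (by linarith) hA (by positivity)
      _ = μ := by field_simp
  have h2 : R + (x + ε) • (S - R) = R + x • (S - R) + ∑ j, (ε • a) j • H.col j := by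
    have : ∑ j, (ε • a) j • H.col j = ε • (S - R) := by
      rw [hsum, Finset.smul_sum]
      exact Finset.sum_congr rfl fun j _ => by simp [smul_smul]
    rw [this, add_smul, add_assoc]
  change R + (x + ε) • (S - R) ∈ capacityRegion c
  rw [h2]
  exact h1

/-! ### Rate vectors with vanishing components -/

/-- From `R` one can move in some direction that makes the rates in `T` positive. -/
def Spreads (c : Channel) (R : Rates) (T : Finset (Fin 7)) : Prop :=
  ∃ v : Rates, (∀ δ : ℝ, 0 ≤ δ → δ ≤ 1 → R + δ • v ∈ capacityRegion c) ∧ ∀ I ∈ T, 0 < (R + v) I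

lemma Spreads.insert_target {c : Channel} {R : Rates} {T : Finset (Fin 7)} (h : Spreads c R T)
    {j : Fin 16} (hj : sources j ⊆ T) : Spreads c R (insert (target j) T) := by
  obtain ⟨v, hv, hT⟩ := h
  have hR : 0 ≤ R := capacityRegion_nonneg (by simpa using hv 0 le_rfl zero_le_one)
  -- The amount `t` lies below all rates already made positive, so the sources stay positive while
  -- the target becomes so.
  obtain ⟨t, ht, htT⟩ : ∃ t > 0, ∀ I ∈ T, t < (R + v) I := by
    rcases T.eq_empty_or_nonempty with rfl | hne
    · exact ⟨1, one_pos, by simp⟩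
    · obtain ⟨I, hI, hmin⟩ := Finset.exists_min_image T (R + v) hne
      exact ⟨(R + v) I / 2, half_pos (hT I hI), fun K hK =>
        (half_lt_self (hT I hI)).trans_le (hmin K hK)⟩
  have hcol : ∀ J, H.col j J =
      if J = target j then (gain j : ℝ) else if J ∈ sources j then -1 else 0 := by
    intro J
    rw [H_col_apply, intH_eq]
    push_cast
    rfl
  have hgain : (0 : ℝ) < gain j := by rw [gain]; split_ifs <;> norm_num
  refine ⟨v + t • H.col j, fun δ h0 h1 => ?_, fun I hI => ?_⟩
  · have hmem := hv δ h0 h1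
    have heq : R + δ • (v + t • H.col j) = R + δ • v + (δ * t) • H.col j := by
      rw [smul_add, smul_smul, add_assoc]
    rw [heq]
    refine capacityRegion_operation hmem j (by positivity) fun I => ?_
    have hnn := capacityRegion_nonneg hmem I
    simp only [Pi.add_apply, Pi.smul_apply, smul_eq_mul, Pi.zero_apply, hcol] at hnn ⊢
    split_ifs with h2 h3
    · positivity
    · have h4 := htT I (hj h3)
      rw [Pi.add_apply] at h4
      -- The rate is (1 - δ) R + δ (R + v) ≥ δ t, enough to consume δ t.
      have h5 := mul_nonneg (sub_nonneg.2 h1) (hR I)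
      have h6 := mul_nonneg h0 (sub_pos.2 h4).le
      nlinarith
    · simpa using hnn
  · have h1 : (R + (v + t • H.col j)) I = (R + v) I + t * H.col j I := by simp; ring
    have h0 : 0 ≤ (R + v) I := by
      simpa using capacityRegion_nonneg (hv 1 zero_le_one le_rfl) I
    rw [h1, hcol]
    split_ifs with h2 h3
    · positivity
    · linarith [htT I (hj h3)]
    · rw [mul_zero, add_zero]
      exact hT I ((Finset.mem_insert.1 hI).resolve_left h2)

/-- An order of operations in which every support that is not contained in one of the sets
`{i, j, ij}` becomes everything. -/
def spreadOrder : List (Fin 16) :=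
  [3, 4, 6, 8, 10, 11, 12, 13, 14, 0, 1, 2, 5, 7, 9, 12, 13, 14, 3, 4, 6, 8]

/-- The support after an operation, if its sources are available. -/
def spreadStep (T : Finset (Fin 7)) (j : Fin 16) : Finset (Fin 7) :=
  if sources j ⊆ T then insert (target j) T else T

/-- Inside a set {i, j, ij} the operations only exchange two private messages and their common
message, so such supports cannot grow beyond it. All other supports do grow; the 128 cases are
checked by evaluation. -/
lemma spread_univ : ∀ T : Finset (Fin 7), ¬ T ⊆ {0, 1, 3} → ¬ T ⊆ {0, 2, 4} → ¬ T ⊆ {1, 2, 5} →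
    spreadOrder.foldl spreadStep T = Finset.univ := by
  decide +kernel

lemma Spreads.foldl {c : Channel} {R : Rates} (L : List (Fin 16)) {T : Finset (Fin 7)}
    (h : Spreads c R T) : Spreads c R (L.foldl spreadStep T) := by
  induction L generalizing T with
  | nil => exact h
  | cons j L ih =>
    rw [List.foldl_cons]
    refine ih ?_
    rw [spreadStep]
    split_ifs with hj
    · exact h.insert_target hj
    · exact h

lemma Spreads.univ {c : Channel} {R : Rates} {T : Finset (Fin 7)} (h : Spreads c R T)
    (h1 : ¬ T ⊆ {0, 1, 3}) (h2 : ¬ T ⊆ {0, 2, 4}) (h3 : ¬ T ⊆ {1, 2, 5}) :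
    Spreads c R Finset.univ := by
  rw [← spread_univ T h1 h2 h3]
  exact h.foldl _

/-- Both ends are moved towards R + v by the fraction δ. They become positive, their difference is
merely scaled by 1 - δ and stays in the cone, and δ → 0 recovers S. -/
lemma capacityRegion_of_spreads {c : Channel} {R S : Rates} (hR : R ∈ capacityRegion c)
    (hS : 0 ≤ S) (hRS : S - R ∈ multicastCone) (h : Spreads c R Finset.univ) :
    S ∈ capacityRegion c := by
  obtain ⟨v, hv, hpos⟩ := h
  have hR0 := capacityRegion_nonneg hR
  have hcont : Continuous fun δ : ℝ => (1 - δ) • S + δ • (R + v) := by fun_prop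
  have htend : Tendsto (fun δ : ℝ => (1 - δ) • S + δ • (R + v)) (𝓝[>] 0) (𝓝 S) := by
    have := (hcont.tendsto 0).mono_left (nhdsWithin_le_nhds (s := Set.Ioi 0))
    simpa using this
  refine isClosed_closure.mem_of_tendsto htend ?_
  filter_upwards [Ioo_mem_nhdsGT (zero_lt_one (α := ℝ))] with δ hδ
  have h1 : 0 < 1 - δ := sub_pos.2 hδ.2
  refine capacityRegion_of_pos (hv δ hδ.1.le hδ.2.le) (fun I => ?_) (fun I => ?_) ?_
  · have h2 : (R + δ • v) I = (1 - δ) * R I + δ * (R + v) I := by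
      simp only [Pi.add_apply, Pi.smul_apply, smul_eq_mul]; ring
    rw [h2]
    have := mul_pos hδ.1 (hpos I (Finset.mem_univ I))
    have := mul_nonneg h1.le (hR0 I)
    linarith
  · have h2 : ((1 - δ) • S + δ • (R + v)) I = (1 - δ) * S I + δ * (R + v) I := rfl
    rw [h2]
    have := mul_pos hδ.1 (hpos I (Finset.mem_univ I))
    have := mul_nonneg h1.le (hS I)
    linarith
  · have : (1 - δ) • S + δ • (R + v) - (R + δ • v) = (1 - δ) • (S - R) := by
      ext I; simp; ring
    rw [this]
    exact multicastCone_smul hRS h1.le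

/-- Moves between two private messages and their common message. -/
lemma capacityRegion_of_two {c : Channel} {R S : Rates} (hR : R ∈ capacityRegion c) (hS : 0 ≤ S)
    {a b d : Fin 7} {jm ja jb : Fin 16} (hab : a ≠ b) (had : a ≠ d) (hbd : b ≠ d)
    (hm : intH jm = Pi.single d 1 - Pi.single a 1 - Pi.single b 1)
    (ha : intH ja = Pi.single a 1 - Pi.single d 1) (hb : intH jb = Pi.single b 1 - Pi.single d 1)
    (h0 : ∀ I, I ≠ a → I ≠ b → I ≠ d → S I = 0)
    (h1 : S a + S d ≤ R a + R d) (h2 : S b + S d ≤ R b + R d)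
    (h3 : S a + S b + S d ≤ R a + R b + R d) : S ∈ capacityRegion c := by
  have hR0 := capacityRegion_nonneg hR
  have hSa := hS a
  have hSb := hS b
  have hSd := hS d
  have hRa := hR0 a
  have hRb := hR0 b
  have hRd := hR0 d
  simp only [Pi.zero_apply] at hSa hSb hSd hRa hRb hRd
  have hcases : ∀ {P : Fin 7 → Prop}, P a → P b → P d →
      (∀ I, I ≠ a → I ≠ b → I ≠ d → P I) → ∀ I, P I := by
    intro P pa pb pd po I
    by_cases e1 : I = a
    · exact e1 ▸ pa
    by_cases e2 : I = b
    · exact e2 ▸ pb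
    by_cases e3 : I = d
    · exact e3 ▸ pd
    exact po I e1 e2 e3
  have em : ∀ (X : Rates) (t : ℝ) I, (X + t • H.col jm) I =
      X I + t * ((if I = d then 1 else 0) - (if I = a then 1 else 0) - (if I = b then 1 else 0)) := by
    intro X t I
    rw [Pi.add_apply, Pi.smul_apply, H_col_apply, hm]
    simp [Pi.single_apply]
  have ea : ∀ (X : Rates) (t : ℝ) I, (X + t • H.col ja) I =
      X I + t * ((if I = a then 1 else 0) - (if I = d then 1 else 0)) := by
    intro X t I
    rw [Pi.add_apply, Pi.smul_apply, H_col_apply, ha]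
    simp [Pi.single_apply]
  have eb : ∀ (X : Rates) (t : ℝ) I, (X + t • H.col jb) I =
      X I + t * ((if I = b then 1 else 0) - (if I = d then 1 else 0)) := by
    intro X t I
    rw [Pi.add_apply, Pi.smul_apply, H_col_apply, hb]
    simp [Pi.single_apply]
  rcases le_total (R d) (S d) with hd | hd
  -- If the common rate has to grow, exactly the missing amount is merged from both private
  -- messages, and any excess is dropped.
  · refine capacityRegion_of_le (capacityRegion_operation hR jm (t := S d - R d) (by linarith) ?_)
      hS ?_
    · refine hcases ?_ ?_ ?_ fun I e1 e2 e3 => ?_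
      all_goals simp only [em, Pi.zero_apply]
      · simp [hab, had]; linarith
      · simp [hab.symm, hbd]; linarith
      · simp [had.symm, hbd.symm]; linarith
      · simpa [e1, e2, e3] using hR0 I
    · refine hcases ?_ ?_ ?_ fun I e1 e2 e3 => ?_
      all_goals simp only [em]
      · simp [hab, had]; linarith
      · simp [hab.symm, hbd]; linarith
      · simp [had.symm, hbd.symm]
      · simpa [e1, e2, e3, h0 I e1 e2 e3] using hR0 I
  -- Otherwise the surplus of the common rate is split: `a` gets just what it lacks, `b` gets the
  -- rest.
  · set α := max 0 (S a - R a) with hα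
    have hα0 : 0 ≤ α := le_max_left _ _
    have hαS : S a - R a ≤ α := le_max_right _ _
    have hαd : α ≤ R d - S d := max_le (by linarith) (by linarith)
    have hαb : S b ≤ R b + (R d - S d - α) := by
      rcases max_choice 0 (S a - R a) with h | h <;> rw [← hα] at h <;> linarith
    have hmem := capacityRegion_operation hR ja (t := α) hα0 (by
      refine hcases ?_ ?_ ?_ fun I e1 e2 e3 => ?_
      all_goals simp only [ea, Pi.zero_apply]
      · simp [had]; linarith
      · simp [hab.symm, hbd]; linarith
      · simp [had.symm]; linarith
      · simpa [e1, e2, e3] using hR0 I)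
    refine capacityRegion_of_le (capacityRegion_operation hmem jb (t := R d - S d - α)
      (by linarith) ?_) hS ?_
    · refine hcases ?_ ?_ ?_ fun I e1 e2 e3 => ?_
      all_goals simp only [eb, ea, Pi.zero_apply]
      · simp [hab, had]; linarith
      · simp [hab.symm, hbd]; linarith
      · simp [had.symm, hbd.symm]; linarith
      · simpa [e1, e2, e3] using hR0 I
    · refine hcases ?_ ?_ ?_ fun I e1 e2 e3 => ?_
      all_goals simp only [eb, ea]
      · simp [hab, had]; linarith
      · simp [hab.symm, hbd]; linarith
      · simp [had.symm, hbd.symm]; linarith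
      · simpa [e1, e2, e3, h0 I e1 e2 e3] using hR0 I

theorem capacityRegion_of_sub_mem_multicastCone {c : Channel} {R S : Rates}
    (hR : R ∈ capacityRegion c) (hS : 0 ≤ S) (hRS : S - R ∈ multicastCone) :
    S ∈ capacityRegion c := by
  classical
  have hR0 := capacityRegion_nonneg hR
  set T : Finset (Fin 7) := Finset.univ.filter fun I => 0 < R I with hT
  have hspread : Spreads c R T :=
    ⟨0, fun δ _ _ => by simpa using hR, fun I hI => by simpa using (Finset.mem_filter.1 hI).2⟩
  have hz : ∀ U : Finset (Fin 7), T ⊆ U → ∀ I, I ∉ U → R I = 0 := fun U hU I hI => by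
    refine le_antisymm (not_lt.1 fun h => hI (hU ?_)) (hR0 I)
    exact Finset.mem_filter.2 ⟨Finset.mem_univ _, h⟩
  have hK := mem_multicastCone.1 hRS
  -- When the support of `R` lies in {i, j, ij}, the column of the third receiver forces all rates
  -- of `S` outside this set to vanish, and the columns of i, j and of both together are the three
  -- inequalities for two receivers.
  have c0 := hK 0
  have c1 := hK 1
  have c2 := hK 2
  have c3 := hK 3
  have c4 := hK 4
  have c5 := hK 5
  have s0 := hS 0
  have s1 := hS 1
  have s2 := hS 2
  have s3 := hS 3
  have s4 := hS 4
  have s5 := hS 5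
  have s6 := hS 6
  simp [intG, Fin.sum_univ_seven] at c0 c1 c2 c3 c4 c5 s0 s1 s2 s3 s4 s5 s6
  by_cases h1 : T ⊆ {0, 1, 3}
  · have z2 := hz _ h1 2 (by decide)
    have z4 := hz _ h1 4 (by decide)
    have z5 := hz _ h1 5 (by decide)
    have z6 := hz _ h1 6 (by decide)
    refine capacityRegion_of_two hR hS (a := 0) (b := 1) (d := 3) (jm := 0) (ja := 3) (jb := 4)
      (by decide) (by decide) (by decide) (by decide +kernel) (by decide +kernel)
      (by decide +kernel) (fun I i1 i2 i3 => ?_) (by linarith) (by linarith) (by linarith)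
    fin_cases I <;> simp at i1 i2 i3 ⊢ <;> linarith
  by_cases h2 : T ⊆ {0, 2, 4}
  · have z1 := hz _ h2 1 (by decide)
    have z3 := hz _ h2 3 (by decide)
    have z5 := hz _ h2 5 (by decide)
    have z6 := hz _ h2 6 (by decide)
    refine capacityRegion_of_two hR hS (a := 0) (b := 2) (d := 4) (jm := 1) (ja := 6) (jb := 8)
      (by decide) (by decide) (by decide) (by decide +kernel) (by decide +kernel)
      (by decide +kernel) (fun I i1 i2 i3 => ?_) (by linarith) (by linarith) (by linarith)
    fin_cases I <;> simp at i1 i2 i3 ⊢ <;> linarith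
  by_cases h3 : T ⊆ {1, 2, 5}
  · have z0 := hz _ h3 0 (by decide)
    have z3 := hz _ h3 3 (by decide)
    have z4 := hz _ h3 4 (by decide)
    have z6 := hz _ h3 6 (by decide)
    refine capacityRegion_of_two hR hS (a := 1) (b := 2) (d := 5) (jm := 2) (ja := 10) (jb := 11)
      (by decide) (by decide) (by decide) (by decide +kernel) (by decide +kernel)
      (by decide +kernel) (fun I i1 i2 i3 => ?_) (by linarith) (by linarith) (by linarith)
    fin_cases I <;> simp at i1 i2 i3 ⊢ <;> linarith
  exact capacityRegion_of_spreads hR hS hRS (hspread.univ h1 h2 h3)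


/-! ### The channel with seven multicast links, one of which is on at a time -/

/-- What receiver `i` sees when the link inputs are `x` and the state is `s`: the state, and, if
link `J` is on and intended for the receiver, its input. The last state means that all links are
off. -/
def linkOutput {q : ℕ} [NeZero q] (x : Fin 7 → Fin q) (s : Fin 8) (i : Fin 3) :
    Fin 8 × (Fin 7 → Fin q) :=
  (s, fun J => if i ∈ receivers J ∧ s = J.castSucc then x J else 0)

/-- The channel with seven `q`-ary multicast links, of which a random one is on. -/
abbrev linkChannel (q : ℕ) [NeZero q] (ν : Measure (Fin 8)) [IsProbabilityMeasure ν] : Channel where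
  X := Fin 7 → Fin q
  Y _ := Fin 8 × (Fin 7 → Fin q)
  law := Kernel.ofFunOfCountable fun x => ν.map (linkOutput x)
  markov := ⟨fun _ => Measure.isProbabilityMeasure_map (Measurable.of_discrete).aemeasurable⟩

section LinkChannel

variable {q : ℕ} [NeZero q] {ν : Measure (Fin 8)} [IsProbabilityMeasure ν]

lemma linkChannel_isFinite : (linkChannel q ν).IsFinite := by
  refine ⟨inferInstanceAs (Finite (Fin 7 → Fin q)),
    fun _ => inferInstanceAs (Finite (Fin 8 × (Fin 7 → Fin q))),
    inferInstanceAs (DiscreteMeasurableSpace (Fin 7 → Fin q)),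
    fun _ => inferInstanceAs (DiscreteMeasurableSpace (Fin 8 × (Fin 7 → Fin q)))⟩

/-- The transmission of `w` in the state sequence `s` leads to an error. -/
def Code.Errs {n : ℕ} {m : Fin 7 → ℕ} (C : Code (linkChannel q ν) n m) (w : ∀ I, Fin (m I))
    (s : Fin n → Fin 8) : Prop :=
  ∃ i, ∃ I : Demand i, C.dec i I (fun t => linkOutput (C.enc w t) (s t) i) ≠ w I.1

/-- The probability of a state sequence. -/
def stateProb (ν : Measure (Fin 8)) {n : ℕ} (s : Fin n → Fin 8) : ℝ := ∏ t, ν.real {s t}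

omit [IsProbabilityMeasure ν] in
lemma stateProb_nonneg {n : ℕ} (s : Fin n → Fin 8) : 0 ≤ stateProb ν s :=
  Finset.prod_nonneg fun _ _ => measureReal_nonneg

lemma sum_real_singleton : ∑ x, ν.real {x} = 1 := by
  rw [sum_measureReal_singleton]
  simp

omit [IsProbabilityMeasure ν] in
lemma sum_stateProb_mul_prod {n : ℕ} (f : Fin n → Fin 8 → ℝ) :
    ∑ s, stateProb ν s * ∏ t, f t (s t) = ∏ t, ∑ x, ν.real {x} * f t x := by
  rw [Finset.prod_univ_sum, Fintype.piFinset_univ]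
  exact Finset.sum_congr rfl fun s _ => Finset.prod_mul_distrib.symm

lemma sum_stateProb {n : ℕ} : ∑ s : Fin n → Fin 8, stateProb ν s = 1 := by
  have := sum_stateProb_mul_prod (ν := ν) (n := n) fun _ _ => 1
  simpa [sum_real_singleton] using this

/-- The expected number of times at which a given state occurs. -/
lemma sum_stateProb_mul_card {n : ℕ} (x : Fin 8) :
    ∑ s : Fin n → Fin 8, stateProb ν s * (Fintype.card {t // s t = x} : ℝ) = n * ν.real {x} := by
  have h1 : ∀ s : Fin n → Fin 8, (Fintype.card {t // s t = x} : ℝ) =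
      ∑ t, if s t = x then (1 : ℝ) else 0 := by
    intro s
    rw [Fintype.card_subtype, Finset.sum_boole]
  have h2 : ∀ t : Fin n, ∑ s : Fin n → Fin 8, stateProb ν s * (if s t = x then (1 : ℝ) else 0) =
      ν.real {x} := by
    intro t
    have h := sum_stateProb_mul_prod (ν := ν) (n := n)
      fun u y => if u = t then (if y = x then 1 else 0) else 1
    have e1 : ∀ s : Fin n → Fin 8,
        (∏ u, if u = t then (if s u = x then (1 : ℝ) else 0) else 1) =
          if s t = x then 1 else 0 := fun s => by
      rw [Finset.prod_ite_eq' Finset.univ t fun u => if s u = x then (1 : ℝ) else 0]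
      simp
    simp only [e1] at h
    rw [h, Finset.prod_eq_single t (fun u _ hu => by simp [hu]) (by simp)]
    simp
  simp only [h1, Finset.mul_sum]
  rw [Finset.sum_comm, Finset.sum_congr rfl fun t _ => h2 t]
  simp

-- Given the states the channel is deterministic, so randomness enters only through messages and
-- state sequence.
open Classical in
lemma Code.errorProb_linkChannel {n : ℕ} {m : Fin 7 → ℕ} (C : Code (linkChannel q ν) n m) :
    C.errorProb = (∑ w, ∑ s, stateProb ν s * if C.Errs w s then 1 else 0) /
      (Fintype.card (∀ I, Fin (m I)) : ℝ) := by
  rw [Code.errorProb]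
  congr 1
  refine Finset.sum_congr rfl fun w _ => ?_
  have hmap : (Measure.pi fun t => (linkChannel q ν).law (C.enc w t)) =
      (Measure.pi fun _ : Fin n => ν).map
        fun (s : Fin n → Fin 8) t => linkOutput (q := q) (C.enc w t) (s t) :=
    (Measure.pi_map_pi (μ := fun _ : Fin n => ν)
      (f := fun t s => linkOutput (q := q) (C.enc w t) s)
      fun t => (Measurable.of_discrete).aemeasurable).symm
  have hmeas : MeasurableSet {y : Fin n → ∀ i, (linkChannel q ν).Y i |
      ∃ i, ∃ I : Demand i, C.dec i I (fun t => y t i) ≠ w I.1} := by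
    have : DiscreteMeasurableSpace (Fin n → ∀ i, (linkChannel q ν).Y i) :=
      inferInstanceAs (DiscreteMeasurableSpace (Fin n → Fin 3 → Fin 8 × (Fin 7 → Fin q)))
    exact MeasurableSet.of_discrete
  rw [hmap, map_measureReal_apply Measurable.of_discrete hmeas]
  have hset : ((fun (s : Fin n → Fin 8) t => linkOutput (q := q) (C.enc w t) (s t)) ⁻¹'
      {y : Fin n → ∀ i, (linkChannel q ν).Y i |
        ∃ i, ∃ I : Demand i, C.dec i I (fun t => y t i) ≠ w I.1}) =
      ((Finset.univ.filter fun s => C.Errs w s : Finset (Fin n → Fin 8)) : Set _) := by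
    ext s
    simp [Code.Errs]
  rw [hset, ← sum_measureReal_singleton, Finset.sum_filter]
  refine Finset.sum_congr rfl fun s _ => ?_
  rw [mul_ite, mul_one, mul_zero]
  refine if_congr Iff.rfl ?_ rfl
  rw [measureReal_def, Measure.pi_singleton, ENNReal.toReal_prod]
  rfl

lemma G_nonneg (I : Fin 7) (l : Fin 15) : 0 ≤ G I l := by
  have h : ∀ l I, 0 ≤ intG I l := by decide +kernel
  rw [G_apply]; exact_mod_cast h l I

open Classical in
/-- The converse bound in a given state sequence. -/
lemma Code.converse_of_state {n : ℕ} {m : Fin 7 → ℕ} (hm : ∀ I, 0 < m I)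
    (C : Code (linkChannel q ν) n m) (s : Fin n → Fin 8) (l : Fin 15) :
    (1 - 2 * ((∑ w, if C.Errs w s then (1 : ℝ) else 0) / Fintype.card (∀ I, Fin (m I)))) *
        ∑ I, G I l * Real.log (m I) ≤
      ∑ J, G J l * (Fintype.card {t // s t = J.castSucc} * Real.log q) + 3 * Real.log 2 := by
  have hΛ : 0 ≤ ∑ I, G I l * Real.log (m I) := Finset.sum_nonneg fun I _ =>
    mul_nonneg (G_nonneg I l) (Real.log_natCast_nonneg _)
  have hq : 0 ≤ ∑ J, G J l * (Fintype.card {t // s t = J.castSucc} * Real.log q) :=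
    Finset.sum_nonneg fun J _ => mul_nonneg (G_nonneg J l)
      (mul_nonneg (Nat.cast_nonneg _) (Real.log_natCast_nonneg _))
  have hlog2 : 0 < Real.log 2 := Real.log_pos one_lt_two
  have : Nonempty (∀ I, Fin (m I)) := ⟨fun I => ⟨0, hm I⟩⟩
  have hN : (0 : ℝ) < Fintype.card (∀ I, Fin (m I)) := Nat.cast_pos.2 Fintype.card_pos
  set ε := (∑ w, if C.Errs w s then (1 : ℝ) else 0) / Fintype.card (∀ I, Fin (m I)) with hε
  have hε0 : 0 ≤ ε := div_nonneg (Finset.sum_nonneg fun _ _ => by split_ifs <;> norm_num) hN.le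
  -- If at least half of the tuples fail, the left-hand side is not positive. Otherwise the entropy
  -- bound is applied to the tuples decoded correctly, with deficit at most log 2. The factor 1 - 2ε
  -- covers both cases and, being affine in ε, can be averaged over the states.
  rcases le_total (1 / 2) ε with h | h
  · nlinarith [mul_nonneg (by linarith : (0 : ℝ) ≤ 2 * ε - 1) hΛ]
  let Ω := {w : ∀ I, Fin (m I) // ¬ C.Errs w s}
  have hΩ : (Fintype.card (∀ I, Fin (m I)) : ℝ) / 2 ≤ Fintype.card Ω := by
    have h1 : (Fintype.card Ω : ℝ) = Fintype.card (∀ I, Fin (m I)) -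
        ∑ w, if C.Errs w s then (1 : ℝ) else 0 := by
      rw [Fintype.card_subtype, eq_sub_iff_add_eq, Finset.sum_boole, add_comm, ← Nat.cast_add,
        Finset.card_filter_add_card_filter_not]
      simp
    have h2 : ∑ w, (if C.Errs w s then (1 : ℝ) else 0) = ε * Fintype.card (∀ I, Fin (m I)) := by
      rw [hε]; field_simp
    rw [h1, h2]
    nlinarith
  have hΩ0 : (0 : ℝ) < Fintype.card Ω := lt_of_lt_of_le (by positivity) hΩ
  have : Nonempty Ω := Fintype.card_pos_iff.1 (Nat.cast_pos.1 hΩ0)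
  -- Link J is represented by its inputs at the times at which it is on.
  have key := sum_G_log_le (Ω := Ω) (β := fun J => {t // s t = J.castSucc} → Fin q)
    (A := fun J w t => C.enc w.1 t.1 J) (M := fun w => w.1) (fun i w w' h I hI => by
      have hc : ∀ v : Ω, C.dec i ⟨I, hI⟩ (fun t => linkOutput (C.enc v.1 t) (s t) i) = v.1 I := by
        intro v
        by_contra hne
        exact v.2 ⟨i, ⟨I, hI⟩, hne⟩
      rw [← hc w, ← hc w']
      congr 1
      funext t
      refine Prod.ext rfl (funext fun J => ?_)
      change (if i ∈ receivers J ∧ s t = J.castSucc then C.enc w.1 t J else 0) =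
        if i ∈ receivers J ∧ s t = J.castSucc then C.enc w'.1 t J else 0
      split_ifs with hJ
      · exact congrFun (h J hJ.1) ⟨t, hJ.2⟩
      · rfl) Subtype.val_injective l
  have hD : ∑ I, Real.log (m I) - Real.log (Fintype.card Ω) ≤ Real.log 2 := by
    have hcard : Real.log (Fintype.card (∀ I, Fin (m I))) = ∑ I, Real.log (m I) := by
      rw [Fintype.card_pi, Nat.cast_prod, Real.log_prod fun I _ => by
        simpa using (hm I).ne']
      simp
    rw [← hcard, sub_le_iff_le_add, ← Real.log_mul two_ne_zero hΩ0.ne']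
    exact Real.log_le_log hN (by linarith)
  have hcardβ : ∀ J : Fin 7, Real.log (Fintype.card ({t // s t = J.castSucc} → Fin q)) =
      Fintype.card {t // s t = J.castSucc} * Real.log q := by
    intro J
    rw [Fintype.card_fun, Fintype.card_fin, Nat.cast_pow, Real.log_pow]
  simp only [hcardβ] at key
  nlinarith [mul_nonneg hε0 hΛ]

/-- The converse for the link channel at a finite block length. -/
lemma Code.converse {n : ℕ} {m : Fin 7 → ℕ} (hm : ∀ I, 0 < m I)
    (C : Code (linkChannel q ν) n m) (l : Fin 15) :
    (1 - 2 * C.errorProb) * ∑ I, G I l * Real.log (m I) ≤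
      n * (∑ J, G J l * (ν.real {J.castSucc} * Real.log q)) + 3 * Real.log 2 := by
  classical
  have hsum := Finset.sum_le_sum fun s (_ : s ∈ Finset.univ) =>
    mul_le_mul_of_nonneg_left (C.converse_of_state hm s l) (stateProb_nonneg (ν := ν) s)
  have hl : ∑ s, stateProb ν s * ((1 - 2 * ((∑ w, if C.Errs w s then (1 : ℝ) else 0) /
      Fintype.card (∀ I, Fin (m I)))) * ∑ I, G I l * Real.log (m I)) =
      (1 - 2 * C.errorProb) * ∑ I, G I l * Real.log (m I) := by
    have h1 : C.errorProb = ∑ s, stateProb ν s * ((∑ w, if C.Errs w s then (1 : ℝ) else 0) /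
        Fintype.card (∀ I, Fin (m I))) := by
      rw [C.errorProb_linkChannel, Finset.sum_comm, Finset.sum_div]
      exact Finset.sum_congr rfl fun s _ => by rw [← Finset.mul_sum, mul_div_assoc]
    simp only [← mul_assoc, ← Finset.sum_mul]
    congr 1
    simp only [mul_sub, mul_one, Finset.sum_sub_distrib, sum_stateProb]
    rw [h1, Finset.mul_sum]
    congr 1
    exact Finset.sum_congr rfl fun s _ => by ring
  have hr : ∑ s : Fin n → Fin 8, stateProb ν s * (∑ J, G J l * (Fintype.card {t // s t = J.castSucc} *
      Real.log q) + 3 * Real.log 2) =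
      n * (∑ J, G J l * (ν.real {J.castSucc} * Real.log q)) + 3 * Real.log 2 := by
    simp only [mul_add, Finset.sum_add_distrib, ← Finset.sum_mul, sum_stateProb, one_mul,
      Finset.mul_sum]
    congr 1
    rw [Finset.sum_comm]
    refine Finset.sum_congr rfl fun J _ => ?_
    have := sum_stateProb_mul_card (ν := ν) (n := n) J.castSucc
    calc _ = G J l * Real.log q *
          ∑ s : Fin n → Fin 8, stateProb ν s * (Fintype.card {t // s t = J.castSucc} : ℝ) := by
          rw [Finset.mul_sum]
          exact Finset.sum_congr rfl fun s _ => by ring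
      _ = _ := by rw [this]; ring
  rw [hl, hr] at hsum
  exact hsum

/-- The converse for the link channel. -/
lemma capacityRegion_linkChannel_le {Rs : Rates}
    (hα : ∀ J : Fin 7, ν.real {J.castSucc} * Real.log q = Rs J * Real.log 2) {R : Rates}
    (hR : R ∈ capacityRegion (linkChannel q ν)) (l : Fin 15) :
    ∑ I, G I l * R I ≤ ∑ I, G I l * Rs I := by
  have hclosed : IsClosed {R : Rates | ∑ I, G I l * R I ≤ ∑ I, G I l * Rs I} :=
    isClosed_le (by fun_prop) continuous_const
  refine closure_minimal (fun R hR => ?_) hclosed hR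
  obtain ⟨hR0, C, hC⟩ := hR
  have hlog2 : 0 < Real.log 2 := Real.log_pos one_lt_two
  have hbound : ∀ᶠ n : ℕ in atTop, (1 - 2 * (C n).errorProb) * ∑ I, G I l * R I ≤
      ∑ I, G I l * Rs I + 3 / n := by
    filter_upwards [hC.eventually (gt_mem_nhds (show (0 : ℝ) < 1 / 2 by norm_num)),
      eventually_gt_atTop 0] with n hn hn0
    have hn0' : (0 : ℝ) < n := Nat.cast_pos.2 hn0
    have h1 := (C n).converse (size_pos n R) l
    have h2 : n * Real.log 2 * ∑ I, G I l * R I ≤ ∑ I, G I l * Real.log (size n R I) := by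
      rw [Finset.mul_sum]
      refine Finset.sum_le_sum fun I _ => ?_
      have h3 : (n * R I) * Real.log 2 ≤ Real.log (size n R I) := by
        rw [← Real.log_rpow two_pos]
        exact Real.log_le_log (by positivity) (Nat.le_ceil _)
      calc n * Real.log 2 * (G I l * R I) = G I l * ((n * R I) * Real.log 2) := by ring
        _ ≤ _ := mul_le_mul_of_nonneg_left h3 (G_nonneg I l)
    have h4 := (mul_le_mul_of_nonneg_left h2
      (by linarith : 0 ≤ 1 - 2 * (C n).errorProb)).trans h1
    have h5 : ∑ J, G J l * (ν.real {J.castSucc} * Real.log q) =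
        Real.log 2 * ∑ J, G J l * Rs J := by
      rw [Finset.mul_sum]
      exact Finset.sum_congr rfl fun J _ => by rw [hα]; ring
    rw [h5] at h4
    have h6 : (n * Real.log 2) * ((1 - 2 * (C n).errorProb) * ∑ I, G I l * R I) ≤
        (n * Real.log 2) * (∑ I, G I l * Rs I + 3 / n) := by
      have : (n * Real.log 2) * (3 / n : ℝ) = 3 * Real.log 2 := by field_simp
      rw [mul_add, this]
      linarith
    exact le_of_mul_le_mul_left h6 (by positivity)
  have ht1 : Tendsto (fun n => (1 - 2 * (C n).errorProb) * ∑ I, G I l * R I) atTop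
      (𝓝 (∑ I, G I l * R I)) := by
    have := ((hC.const_mul 2).const_sub 1).mul_const (∑ I, G I l * R I)
    simpa using this
  have ht2 : Tendsto (fun n : ℕ => ∑ I, G I l * Rs I + 3 / (n : ℝ)) atTop
      (𝓝 (∑ I, G I l * Rs I)) := by
    have := (tendsto_const_div_atTop_nhds_zero_nat (3 : ℝ)).const_add (∑ I, G I l * Rs I)
    simpa using this
  exact le_of_tendsto_of_tendsto ht1 ht2 hbound

end LinkChannel


/-! ### Random coding for the link channel -/

/-- The number of functions that satisfy equations expressing some values by others. -/
lemma card_functions_mul_le {K : Type*} [Fintype K] [DecidableEq K] {q : ℕ} (A : Finset K)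
    (σ : K → K) (hσ : ∀ k ∈ A, σ k ∉ A) (s : Finset (K → Fin q))
    (hs : ∀ f ∈ s, ∀ k ∈ A, f k = f (σ k)) :
    s.card * q ^ A.card ≤ Fintype.card (K → Fin q) := by
  -- The values on `A` may be overwritten freely: a function in `s` is recovered from its values off
  -- `A`, where `σ` takes the points of `A`.
  have hinj : Function.Injective fun (p : s × (A → Fin q)) (k : K) =>
      if h : k ∈ A then p.2 ⟨k, h⟩ else p.1.1 k := by
    rintro ⟨⟨f, hf⟩, u⟩ ⟨⟨f', hf'⟩, u'⟩ h
    have h' : ∀ k, (if h : k ∈ A then u ⟨k, h⟩ else f k) =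
        if h : k ∈ A then u' ⟨k, h⟩ else f' k := fun k => congrFun h k
    have hout : ∀ k, k ∉ A → f k = f' k := fun k hk => by simpa [hk] using h' k
    have hff : f = f' := by
      funext k
      by_cases hk : k ∈ A
      · rw [hs f hf k hk, hs f' hf' k hk, hout _ (hσ k hk)]
      · exact hout k hk
    subst hff
    refine Prod.ext rfl (funext fun k => ?_)
    simpa [k.2] using h' k
  have := Fintype.card_le_of_injective _ hinj
  simpa using this

section RandomCoding

variable {q : ℕ} [NeZero q] {ν : Measure (Fin 8)} [IsProbabilityMeasure ν] {n : ℕ} {m : Fin 7 → ℕ}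

open Classical in
/-- The code in which every message is sent on its own link, by a codebook. -/
def codeOf (ν : Measure (Fin 8)) [IsProbabilityMeasure ν] (hm : ∀ I, 0 < m I)
    (cb : (Σ J, Fin (m J)) × Fin n → Fin q) : Code (linkChannel q ν) n m where
  enc w t J := cb (⟨J, w J⟩, t)
  dec _ I y := if h : ∃ v, ∀ t, (y t).1 = I.1.castSucc → (y t).2 I.1 = cb (⟨I.1, v⟩, t) then
    h.choose else ⟨0, hm I.1⟩
  measurable_dec _ _ := Measurable.of_discrete

/-- Some other codeword of link `J` agrees with that of `v` whenever the link is on. -/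
def Confused (cb : (Σ J, Fin (m J)) × Fin n → Fin q) (s : Fin n → Fin 8) (J : Fin 7)
    (v : Fin (m J)) : Prop :=
  ∃ v', v' ≠ v ∧ ∀ t, s t = J.castSucc → cb (⟨J, v⟩, t) = cb (⟨J, v'⟩, t)

/-- The true message always agrees with what is received, so the decoder errs only by choosing
another message that agrees as well. -/
lemma confused_of_errs {hm : ∀ I, 0 < m I} {cb : (Σ J, Fin (m J)) × Fin n → Fin q}
    {w : ∀ I, Fin (m I)} {s : Fin n → Fin 8} (h : (codeOf ν hm cb).Errs w s) :
    ∃ J, Confused cb s J (w J) := by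
  obtain ⟨i, I, hne⟩ := h
  have hex : ∃ v : Fin (m I.1), ∀ t, s t = I.1.castSucc →
      (if i ∈ receivers I.1 ∧ s t = I.1.castSucc then cb (⟨I.1, w I.1⟩, t) else 0) =
        cb (⟨I.1, v⟩, t) := ⟨w I.1, fun t ht => by rw [if_pos ⟨I.2, ht⟩]⟩
  have hne' : (if h : ∃ v : Fin (m I.1), ∀ t, s t = I.1.castSucc →
      (if i ∈ receivers I.1 ∧ s t = I.1.castSucc then cb (⟨I.1, w I.1⟩, t) else 0) =
        cb (⟨I.1, v⟩, t) then h.choose else ⟨0, hm I.1⟩) ≠ w I.1 := hne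
  rw [dif_pos hex] at hne'
  refine ⟨I.1, hex.choose, hne', fun t ht => ?_⟩
  have := hex.choose_spec t ht
  rwa [if_pos ⟨I.2, ht⟩] at this

-- Gallager's form of the union bound: a probability at most min(1, x) is at most x^θ. With x = m
-- q^{-(times on)} this is a product over time, so its mean over the states factorizes. A single
-- message is never confused, which settles vanishing rates.
open Classical in
lemma sum_confused_le (s : Fin n → Fin 8) (J : Fin 7) (v : Fin (m J)) {θ : ℝ} (hθ : 0 ≤ θ)
    (hθ1 : θ ≤ 1) :
    ∑ cb : (Σ J, Fin (m J)) × Fin n → Fin q, (if Confused cb s J v then (1 : ℝ) else 0) ≤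
      Fintype.card ((Σ J, Fin (m J)) × Fin n → Fin q) * (if m J = 1 then 0 else
        (m J : ℝ) ^ θ * ∏ t, if s t = J.castSucc then (q : ℝ) ^ (-θ) else 1) := by
  set K := (Σ J, Fin (m J)) × Fin n
  have hq : (0 : ℝ) < q := Nat.cast_pos.2 (NeZero.pos q)
  by_cases hm1 : m J = 1
  · have hsub : Subsingleton (Fin (m J)) := by rw [hm1]; infer_instance
    rw [if_pos hm1, mul_zero]
    refine le_of_eq (Finset.sum_eq_zero fun cb _ => if_neg ?_)
    rintro ⟨v', hv', -⟩
    exact hv' (Subsingleton.elim _ _)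
  rw [if_neg hm1]
  set T := Finset.univ.filter fun t => s t = J.castSucc with hT
  have hprod : (∏ t, if s t = J.castSucc then (q : ℝ) ^ (-θ) else 1) = ((q : ℝ) ^ T.card)⁻¹ ^ θ := by
    rw [← Finset.prod_filter, Finset.prod_const, ← Real.rpow_natCast, ← Real.rpow_natCast,
      ← Real.rpow_neg hq.le, ← Real.rpow_mul hq.le, ← Real.rpow_mul hq.le]
    congr 1; ring
  have hU : (0 : ℝ) ≤ Fintype.card (K → Fin q) := Nat.cast_nonneg _
  have h1 : ∑ cb : K → Fin q, (if Confused cb s J v then (1 : ℝ) else 0) ≤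
      Fintype.card (K → Fin q) := by
    calc _ ≤ ∑ _cb : K → Fin q, (1 : ℝ) := Finset.sum_le_sum fun _ _ => by
          split_ifs <;> norm_num
      _ = _ := by simp
  have hagree : ∀ v', v' ≠ v → ∑ cb : K → Fin q,
      (if ∀ t, s t = J.castSucc → cb (⟨J, v⟩, t) = cb (⟨J, v'⟩, t) then (1 : ℝ) else 0) ≤
      Fintype.card (K → Fin q) * ((q : ℝ) ^ T.card)⁻¹ := by
    intro v' hv'
    rw [← div_eq_mul_inv, le_div_iff₀ (by positivity), Finset.sum_boole]
    have hinj : Function.Injective fun t : Fin n => (((⟨J, v'⟩ : Σ J, Fin (m J)), t) : K) :=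
      fun t t' h => (Prod.ext_iff.1 h).2
    have := card_functions_mul_le (q := q) (T.image fun t => (((⟨J, v'⟩ : Σ J, Fin (m J)), t) : K))
      (fun k => (⟨J, v⟩, k.2)) (fun k _ h => by
        obtain ⟨t, -, ht⟩ := Finset.mem_image.1 h
        have h2 := (Prod.ext_iff.1 ht).1
        simp only [Sigma.mk.injEq, heq_eq_eq, true_and] at h2
        exact hv' h2)
      (Finset.univ.filter fun cb : K → Fin q =>
        ∀ t, s t = J.castSucc → cb (⟨J, v⟩, t) = cb (⟨J, v'⟩, t)) (fun f hf k hk => by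
        obtain ⟨t, ht, rfl⟩ := Finset.mem_image.1 hk
        exact ((Finset.mem_filter.1 hf).2 t (Finset.mem_filter.1 ht).2).symm)
    rw [Finset.card_image_of_injective _ hinj] at this
    exact_mod_cast this
  have h2 : ∑ cb : K → Fin q, (if Confused cb s J v then (1 : ℝ) else 0) ≤
      Fintype.card (K → Fin q) * (m J * ((q : ℝ) ^ T.card)⁻¹) := by
    calc ∑ cb : K → Fin q, (if Confused cb s J v then (1 : ℝ) else 0)
        ≤ ∑ cb : K → Fin q, ∑ v' ∈ Finset.univ.erase v,
            if ∀ t, s t = J.castSucc → cb (⟨J, v⟩, t) = cb (⟨J, v'⟩, t) then (1 : ℝ) else 0 := by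
          refine Finset.sum_le_sum fun cb _ => ?_
          have hnn : ∀ v' ∈ Finset.univ.erase v, (0 : ℝ) ≤
              if ∀ t, s t = J.castSucc → cb (⟨J, v⟩, t) = cb (⟨J, v'⟩, t) then (1 : ℝ) else 0 :=
            fun v' _ => by split_ifs <;> norm_num
          split_ifs with hc
          · obtain ⟨v', hv', hag⟩ := hc
            refine le_of_eq_of_le ?_ (Finset.single_le_sum hnn
              (Finset.mem_erase.2 ⟨hv', Finset.mem_univ _⟩))
            rw [if_pos hag]
          · exact Finset.sum_nonneg hnn
      _ = ∑ v' ∈ Finset.univ.erase v, ∑ cb : K → Fin q,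
            if ∀ t, s t = J.castSucc → cb (⟨J, v⟩, t) = cb (⟨J, v'⟩, t) then (1 : ℝ) else 0 :=
          Finset.sum_comm
      _ ≤ ∑ v' ∈ Finset.univ.erase v, Fintype.card (K → Fin q) * ((q : ℝ) ^ T.card)⁻¹ :=
          Finset.sum_le_sum fun v' hv' => hagree v' (Finset.ne_of_mem_erase hv')
      _ ≤ ∑ _v' : Fin (m J), Fintype.card (K → Fin q) * ((q : ℝ) ^ T.card)⁻¹ :=
          Finset.sum_le_sum_of_subset_of_nonneg (Finset.erase_subset _ _)
            fun _ _ _ => by positivity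
      _ = _ := by simp; ring
  rw [hprod, ← Real.mul_rpow (Nat.cast_nonneg _) (by positivity)]
  set x := (m J : ℝ) * ((q : ℝ) ^ T.card)⁻¹ with hx
  have hx0 : 0 ≤ x := by positivity
  rcases le_total x 1 with hx1 | hx1
  · refine h2.trans (mul_le_mul_of_nonneg_left ?_ hU)
    exact Real.self_le_rpow_of_le_one hx0 hx1 hθ1
  · exact h1.trans (le_mul_of_one_le_right hU (Real.one_le_rpow hx1 hθ))

lemma exists_code_le (hm : ∀ I, 0 < m I) {θ : Fin 7 → ℝ} (hθ : ∀ J, 0 ≤ θ J ∧ θ J ≤ 1) :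
    ∃ C : Code (linkChannel q ν) n m, C.errorProb ≤ ∑ J, if m J = 1 then 0 else
      (m J : ℝ) ^ θ J *
        (1 - ν.real {J.castSucc} + ν.real {J.castSucc} * (q : ℝ) ^ (-θ J)) ^ n := by
  classical
  set K := (Σ J, Fin (m J)) × Fin n
  have : Nonempty (∀ I, Fin (m I)) := ⟨fun I => ⟨0, hm I⟩⟩
  set W : ℝ := ((Fintype.card (∀ I, Fin (m I)) : ℕ) : ℝ) with hW
  have hW0 : 0 < W := Nat.cast_pos.2 Fintype.card_pos
  set U : ℝ := ((Fintype.card (K → Fin q) : ℕ) : ℝ) with hU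
  have hU0 : 0 < U := Nat.cast_pos.2 Fintype.card_pos
  -- `b J s` bounds the confusion on link J, averaged over codebooks, in the states s; `B J` is its
  -- mean over s. Some codebook is at least as good as the average.
  set b : Fin 7 → (Fin n → Fin 8) → ℝ := fun J s => if m J = 1 then 0 else
    (m J : ℝ) ^ θ J * ∏ t, if s t = J.castSucc then (q : ℝ) ^ (-θ J) else 1 with hb
  set B : Fin 7 → ℝ := fun J => if m J = 1 then 0 else (m J : ℝ) ^ θ J *
        (1 - ν.real {J.castSucc} + ν.real {J.castSucc} * (q : ℝ) ^ (-θ J)) ^ n with hB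
  have hbB : ∀ J, ∑ s, stateProb ν s * b J s = B J := by
    intro J
    simp only [hb, hB]
    by_cases h : m J = 1
    · simp [h]
    simp only [if_neg h]
    have h1 := sum_stateProb_mul_prod (ν := ν) (n := n)
      fun _ x => if x = J.castSucc then (q : ℝ) ^ (-θ J) else 1
    have h2 : ∑ x : Fin 8, ν.real {x} * (if x = J.castSucc then (q : ℝ) ^ (-θ J) else 1) =
        1 - ν.real {J.castSucc} + ν.real {J.castSucc} * (q : ℝ) ^ (-θ J) := by
      have key := sum_real_singleton (ν := ν)
      rw [← Finset.add_sum_erase _ _ (Finset.mem_univ J.castSucc)] at key ⊢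
      have he : ∑ x ∈ Finset.univ.erase J.castSucc,
          ν.real {x} * (if x = J.castSucc then (q : ℝ) ^ (-θ J) else 1) =
          ∑ x ∈ Finset.univ.erase J.castSucc, ν.real {x} :=
        Finset.sum_congr rfl fun x hx => by
          rw [if_neg (Finset.ne_of_mem_erase hx), mul_one]
      rw [he, if_pos rfl]
      linarith
    rw [h2, Finset.prod_const, Finset.card_univ, Fintype.card_fin] at h1
    rw [← h1, Finset.mul_sum]
    exact Finset.sum_congr rfl fun s _ => by ring
  obtain ⟨cb, -, hcb⟩ := Finset.exists_le_of_sum_le (s := (Finset.univ : Finset (K → Fin q)))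
    (f := fun cb => (codeOf ν hm cb).errorProb) (g := fun _ => ∑ J, B J) Finset.univ_nonempty (by
    calc ∑ cb : K → Fin q, (codeOf ν hm cb).errorProb
        ≤ ∑ cb : K → Fin q, (∑ w : ∀ I, Fin (m I), ∑ s, stateProb ν s *
            ∑ J, if Confused cb s J (w J) then 1 else 0) / W := by
          refine Finset.sum_le_sum fun cb _ => ?_
          rw [Code.errorProb_linkChannel]
          refine div_le_div_of_nonneg_right (Finset.sum_le_sum fun w _ => Finset.sum_le_sum
            fun s _ => mul_le_mul_of_nonneg_left ?_ (stateProb_nonneg s)) hW0.le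
          have hnn : ∀ J ∈ Finset.univ, (0 : ℝ) ≤ if Confused cb s J (w J) then (1 : ℝ) else 0 :=
            fun J _ => by split_ifs <;> norm_num
          split_ifs with he
          · obtain ⟨J, hJ⟩ := confused_of_errs he
            refine le_of_eq_of_le ?_ (Finset.single_le_sum hnn (Finset.mem_univ J))
            rw [if_pos hJ]
          · exact Finset.sum_nonneg hnn
      _ = (∑ w : ∀ I, Fin (m I), ∑ s, stateProb ν s * ∑ J, ∑ cb : K → Fin q,
            if Confused cb s J (w J) then 1 else 0) / W := by
          rw [← Finset.sum_div, Finset.sum_comm]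
          congr 1
          refine Finset.sum_congr rfl fun w _ => ?_
          rw [Finset.sum_comm]
          refine Finset.sum_congr rfl fun s _ => ?_
          rw [← Finset.mul_sum]
          congr 1
          exact Finset.sum_comm
      _ ≤ (∑ w : ∀ I, Fin (m I), ∑ s, stateProb ν s * ∑ J, U * b J s) / W := by
          refine div_le_div_of_nonneg_right (Finset.sum_le_sum fun w _ => Finset.sum_le_sum
            fun s _ => mul_le_mul_of_nonneg_left (Finset.sum_le_sum fun J _ => ?_)
              (stateProb_nonneg s)) hW0.le
          exact sum_confused_le s J (w J) (hθ J).1 (hθ J).2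
      _ = U * ∑ J, B J := by
          rw [Finset.sum_const, nsmul_eq_mul, Finset.card_univ, ← hW,
            mul_div_cancel_left₀ _ hW0.ne', Finset.mul_sum]
          simp only [Finset.mul_sum]
          rw [Finset.sum_comm]
          refine Finset.sum_congr rfl fun J _ => ?_
          rw [← hbB J, Finset.mul_sum]
          exact Finset.sum_congr rfl fun s _ => by ring
      _ = _ := by rw [Finset.sum_const, nsmul_eq_mul, Finset.card_univ])
  exact ⟨codeOf ν hm cb, hcb⟩

end RandomCoding

/-- A positive error exponent below capacity. -/
lemma exists_exponent {r α L : ℝ} (h : r < α * L) :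
    ∃ θ : ℝ, 0 < θ ∧ θ ≤ 1 ∧ Real.exp (θ * r) * (1 - α + α * Real.exp (-θ * L)) < 1 := by
  set ψ : ℝ → ℝ := fun θ => Real.exp (θ * r) * (1 - α + α * Real.exp (-θ * L)) with hψ
  -- ψ equals 1 at 0 and has negative derivative there, so it is below 1 at some small positive θ.
  have h1 : HasDerivAt ψ (r - α * L) 0 := by
    have e1 : HasDerivAt (fun θ : ℝ => Real.exp (θ * r)) (Real.exp (0 * r) * (1 * r)) 0 :=
      ((hasDerivAt_id (0 : ℝ)).mul_const r).exp
    have e2 : HasDerivAt (fun θ : ℝ => Real.exp (-θ * L)) (Real.exp (-0 * L) * (-1 * L)) 0 :=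
      ((hasDerivAt_id (0 : ℝ)).neg.mul_const L).exp
    have := e1.mul ((e2.const_mul α).const_add (1 - α))
    exact this.congr_deriv (by simp; ring)
  have h2 := (h1.hasDerivWithinAt (s := Set.Ici 0)).liminf_right_slope_le (sub_neg.2 h)
  obtain ⟨θ, hθ, hθ1⟩ := (h2.and_eventually (Ioo_mem_nhdsGT (zero_lt_one (α := ℝ)))).exists
  refine ⟨θ, hθ1.1, hθ1.2.le, ?_⟩
  rw [slope_def_field, sub_zero, div_neg_iff] at hθ
  have h0 : ψ 0 = 1 := by simp [hψ]
  rcases hθ with h | h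
  · linarith [hθ1.1]
  · have := h.1
    rw [h0] at this
    change ψ θ < 1
    linarith

/-- Achievability for the link channel. -/
lemma achievable_linkChannel {q : ℕ} [NeZero q] {ν : Measure (Fin 8)} [IsProbabilityMeasure ν]
    {R : Rates} (hR : 0 ≤ R)
    (h : ∀ J, R J ≠ 0 → R J * Real.log 2 < ν.real {J.castSucc} * Real.log q) :
    Achievable (linkChannel q ν) R := by
  have hq : (0 : ℝ) < q := Nat.cast_pos.2 (NeZero.pos q)
  have hex : ∀ J, ∃ θ : ℝ, (0 ≤ θ ∧ θ ≤ 1) ∧ (R J ≠ 0 →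
      Real.exp (θ * (R J * Real.log 2)) * (1 - ν.real {J.castSucc} +
        ν.real {J.castSucc} * Real.exp (-θ * Real.log q)) < 1) := by
    intro J
    by_cases hJ : R J = 0
    · exact ⟨0, ⟨le_rfl, zero_le_one⟩, fun h => absurd hJ h⟩
    · obtain ⟨θ, h1, h2, h3⟩ := exists_exponent (h J hJ)
      exact ⟨θ, ⟨h1.le, h2⟩, fun _ => h3⟩
  choose θ hθ hψ using hex
  choose C hC using fun n => exists_code_le (q := q) (ν := ν) (n := n) (size_pos n R) hθ
  refine ⟨hR, C, ?_⟩
  set ψ : Fin 7 → ℝ := fun J => Real.exp (θ J * (R J * Real.log 2)) * (1 - ν.real {J.castSucc} +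
        ν.real {J.castSucc} * Real.exp (-θ J * Real.log q)) with hψdef
  have hfac : ∀ J, 0 ≤ 1 - ν.real {J.castSucc} +
      ν.real {J.castSucc} * Real.exp (-θ J * Real.log q) := fun J => by
    have h1 : ν.real {J.castSucc} ≤ 1 := measureReal_le_one
    have h2 : 0 ≤ ν.real {J.castSucc} * Real.exp (-θ J * Real.log q) := by positivity
    linarith
  have hψ0 : ∀ J, 0 ≤ ψ J := fun J => mul_nonneg (Real.exp_nonneg _) (hfac J)
  have hbound : ∀ n, (C n).errorProb ≤ ∑ J, if R J = 0 then 0 else 2 * ψ J ^ n := by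
    intro n
    refine (hC n).trans (Finset.sum_le_sum fun J _ => ?_)
    by_cases hJ : R J = 0
    · simp [hJ, size]
    rw [if_neg hJ]
    have hpow : (q : ℝ) ^ (-θ J) = Real.exp (-θ J * Real.log q) := by
      rw [Real.rpow_def_of_pos hq, mul_comm]
    have hsize : (size n R J : ℝ) ^ θ J ≤ 2 * Real.exp (θ J * (R J * Real.log 2)) ^ n := by
      calc (size n R J : ℝ) ^ θ J ≤ (2 * 2 ^ ((n : ℝ) * R J)) ^ θ J :=
            Real.rpow_le_rpow (Nat.cast_nonneg _)
              (ceil_two_rpow_le (mul_nonneg (Nat.cast_nonneg n) (hR J))) (hθ J).1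
        _ = 2 ^ θ J * (2 ^ ((n : ℝ) * R J)) ^ θ J :=
            Real.mul_rpow two_pos.le (by positivity)
        _ ≤ 2 * (2 ^ ((n : ℝ) * R J)) ^ θ J := by
            gcongr
            calc (2 : ℝ) ^ θ J ≤ 2 ^ (1 : ℝ) :=
                  Real.rpow_le_rpow_of_exponent_le one_le_two (hθ J).2
              _ = 2 := Real.rpow_one 2
        _ = 2 * Real.exp (θ J * (R J * Real.log 2)) ^ n := by
            rw [← Real.rpow_mul two_pos.le, Real.rpow_def_of_pos two_pos, ← Real.exp_nat_mul]
            congr 2; ring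
    split_ifs
    · exact mul_nonneg two_pos.le (pow_nonneg (hψ0 J) n)
    · rw [hpow, hψdef]
      beta_reduce
      rw [mul_pow, ← mul_assoc]
      exact mul_le_mul_of_nonneg_right hsize (pow_nonneg (hfac J) n)
  have hlim : Tendsto (fun n => ∑ J, if R J = 0 then 0 else 2 * ψ J ^ n) atTop (𝓝 0) := by
    refine (tendsto_finsetSum (a := fun _ : Fin 7 => (0 : ℝ)) _ fun J _ => ?_).trans
      (by rw [Finset.sum_const_zero])
    by_cases hJ : R J = 0
    · simp only [if_pos hJ]
      exact tendsto_const_nhds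
    · simp only [if_neg hJ]
      simpa using (tendsto_pow_atTop_nhds_zero_of_lt_one (hψ0 J) (hψ J hJ)).const_mul 2
  exact squeeze_zero (fun n => (C n).errorProb_nonneg) hbound hlim

lemma mem_capacityRegion_linkChannel {q : ℕ} [NeZero q] {ν : Measure (Fin 8)}
    [IsProbabilityMeasure ν] {Rs : Rates} (hRs : 0 ≤ Rs)
    (hα : ∀ J : Fin 7, ν.real {J.castSucc} * Real.log q = Rs J * Real.log 2) :
    Rs ∈ capacityRegion (linkChannel q ν) := by
  have hcont : Continuous fun δ : ℝ => (1 - δ) • Rs := by fun_prop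
  have htend : Tendsto (fun δ : ℝ => (1 - δ) • Rs) (𝓝[>] 0) (𝓝 Rs) := by
    have := (hcont.tendsto 0).mono_left (nhdsWithin_le_nhds (s := Set.Ioi 0))
    simpa using this
  refine isClosed_closure.mem_of_tendsto htend ?_
  filter_upwards [Ioo_mem_nhdsGT (zero_lt_one (α := ℝ))] with δ hδ
  have h1 : 0 < 1 - δ := sub_pos.2 hδ.2
  -- Scaling by 1 - δ makes the rate of every nonzero component strictly smaller than its link
  -- capacity.
  refine subset_closure (achievable_linkChannel (smul_nonneg h1.le hRs) fun J hJ => ?_)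
  have hJ0 : 0 < Rs J := lt_of_le_of_ne (hRs J) fun h => hJ (by simp [← h])
  rw [hα J, Pi.smul_apply, smul_eq_mul, mul_assoc]
  have := mul_pos hJ0 (Real.log_pos one_lt_two)
  nlinarith [hδ.1]


/-! ### The multicast region -/

/-- Every nonnegative rate vector is the vector of link capacities of a finite channel. -/
lemma exists_linkChannel {Rs : Rates} (hRs : 0 ≤ Rs) :
    ∃ c : Channel, c.IsFinite ∧ Rs ∈ capacityRegion c ∧
      ∀ R ∈ capacityRegion c, ∀ l, ∑ I, G I l * R I ≤ ∑ I, G I l * Rs I := by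
  -- With alphabet size 2^N, link J must be on with probability R_J / N. `N` is taken so large that
  -- these probabilities add up to at most 1; the rest goes to the state with all links off.
  obtain ⟨N, hN⟩ := exists_nat_ge (max 1 (∑ J, Rs J))
  have hN1 : (1 : ℝ) ≤ N := (le_max_left _ _).trans hN
  have hN2 : ∑ J, Rs J ≤ N := (le_max_right _ _).trans hN
  have hN0 : (0 : ℝ) < N := one_pos.trans_le hN1
  set p : Fin 8 → ℝ := Fin.snoc (α := fun _ => ℝ) (fun J : Fin 7 => Rs J / N)
    (1 - (∑ J, Rs J) / N) with hp
  have hp0 : ∀ a, 0 ≤ p a := fun a => by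
    refine Fin.lastCases ?_ (fun J => ?_) a
    · rw [hp, Fin.snoc_last]
      exact sub_nonneg.2 (div_le_one_of_le₀ hN2 hN0.le)
    · simpa [hp] using div_nonneg (hRs J) hN0.le
  have hp1 : ∑ a, p a = 1 := by
    rw [Fin.sum_univ_castSucc, hp, Fin.snoc_last]
    simp only [Fin.snoc_castSucc, Finset.sum_div, add_sub_cancel]
  let μ : PMF (Fin 8) := PMF.ofFintype (fun a => ENNReal.ofReal (p a)) (by
    rw [← ENNReal.ofReal_sum_of_nonneg fun a _ => hp0 a, hp1, ENNReal.ofReal_one])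
  have hα : ∀ J : Fin 7, μ.toMeasure.real {J.castSucc} * Real.log ((2 ^ N : ℕ) : ℝ) =
      Rs J * Real.log 2 := fun J => by
    have h : μ.toMeasure.real {J.castSucc} = Rs J / N := by
      rw [Measure.real, PMF.toMeasure_apply_singleton _ _ (measurableSet_singleton _),
        PMF.ofFintype_apply, ENNReal.toReal_ofReal (hp0 _)]
      simp [hp]
    rw [h, Nat.cast_pow, Nat.cast_ofNat, Real.log_pow]
    field_simp
  exact ⟨linkChannel (2 ^ N) μ.toMeasure, linkChannel_isFinite,
    mem_capacityRegion_linkChannel hRs hα, fun R hR l => capacityRegion_linkChannel_le hα hR l⟩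

lemma sub_mem_multicastCone_iff {R Rs : Rates} :
    R - Rs ∈ multicastCone ↔ ∀ l, ∑ I, G I l * R I ≤ ∑ I, G I l * Rs I := by
  simp only [multicastCone, Set.mem_ofPred_eq, Pi.le_def, Matrix.mulVec, dotProduct,
    Matrix.transpose_apply, Pi.sub_apply, mul_sub, Finset.sum_sub_distrib, Pi.zero_apply,
    sub_nonpos]

/-- One finite channel already confines the intersection, so the class of channels does not matter
once it contains the finite ones. -/
theorem multicastRegion_eq {channels : Set Channel} (hfin : {c | c.IsFinite} ⊆ channels)
    {Rs : Rates} (hRs : 0 ≤ Rs) :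
    multicastRegion channels Rs = {R | 0 ≤ R ∧ R - Rs ∈ multicastCone} := by
  ext R
  simp only [multicastRegion, Set.mem_iInter]
  constructor
  · intro h
    obtain ⟨c, hc, hmem, hle⟩ := exists_linkChannel hRs
    have hR := h c ⟨hfin hc, hmem⟩
    exact ⟨capacityRegion_nonneg hR, sub_mem_multicastCone_iff.2 (hle R hR)⟩
  · rintro ⟨hR, hRRs⟩ c ⟨-, hc⟩
    exact capacityRegion_of_sub_mem_multicastCone hc hR hRRs

/-! ### The region as a polytope -/

/-- The affine functions that are nonpositive on the multicast region. -/
def regionConstraint (Rs : Rates) : Fin 7 ⊕ Fin 15 → Rates → ℝ :=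
  Sum.elim (fun J R => -R J) (fun l R => ∑ I, G I l * (R I - Rs I))

lemma regionConstraint_line (Rs R v : Rates) (k : Fin 7 ⊕ Fin 15) :
    ∃ b, ∀ t : ℝ, regionConstraint Rs k (R + t • v) = regionConstraint Rs k R + t * b := by
  rcases k with J | l
  · exact ⟨-v J, fun t => by simp [regionConstraint]; ring⟩
  · refine ⟨∑ I, G I l * v I, fun t => ?_⟩
    simp only [regionConstraint, Sum.elim_inr, Pi.add_apply, Pi.smul_apply, smul_eq_mul,
      Finset.mul_sum, ← Finset.sum_add_distrib]
    exact Finset.sum_congr rfl fun I _ => by ring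

lemma regionConstraint_nonpos_iff {R Rs : Rates} :
    (∀ k, regionConstraint Rs k R ≤ 0) ↔ R ∈ {R | 0 ≤ R ∧ R - Rs ∈ multicastCone} := by
  rw [Set.mem_ofPred_eq, sub_mem_multicastCone_iff, Sum.forall]
  simp only [regionConstraint, Sum.elim_inl, Sum.elim_inr, mul_sub, Finset.sum_sub_distrib,
    sub_nonpos, neg_nonpos]
  rfl

lemma continuous_regionConstraint (Rs : Rates) (k : Fin 7 ⊕ Fin 15) :
    Continuous (regionConstraint Rs k) := by
  rcases k with J | l
  · exact (continuous_apply J).neg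
  · change Continuous fun R : Rates => ∑ I, G I l * (R I - Rs I)
    fun_prop

lemma isCompact_region (Rs : Rates) : IsCompact {R | 0 ≤ R ∧ R - Rs ∈ multicastCone} := by
  have hclosed : IsClosed {R | 0 ≤ R ∧ R - Rs ∈ multicastCone} := by
    have : {R | 0 ≤ R ∧ R - Rs ∈ multicastCone} = ⋂ k, {R | regionConstraint Rs k R ≤ 0} := by
      ext R
      rw [← regionConstraint_nonpos_iff, Set.mem_iInter]
      rfl
    rw [this]
    exact isClosed_iInter fun k => isClosed_le (continuous_regionConstraint Rs k) continuous_const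
  refine (isCompact_Icc (a := (0 : Rates)) (b := fun _ => ∑ I, Rs I)).of_isClosed_subset hclosed
    fun R hR => ⟨hR.1, fun J => ?_⟩
  -- This column of `G` consists of ones, so the sum rate bounds every component.
  have h := sub_mem_multicastCone_iff.1 hR.2 6
  have hG : ∀ I, G I 6 = 1 := fun I => by fin_cases I <;> rfl
  simp only [hG, one_mul] at h
  exact (Finset.single_le_sum (fun I _ => hR.1 I) (Finset.mem_univ J)).trans h

lemma convex_region (Rs : Rates) : Convex ℝ {R | 0 ≤ R ∧ R - Rs ∈ multicastCone} := by
  intro x hx y hy a b ha hb hab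
  refine ⟨add_nonneg (smul_nonneg ha hx.1) (smul_nonneg hb hy.1),
    sub_mem_multicastCone_iff.2 fun l => ?_⟩
  have h1 := mul_le_mul_of_nonneg_left (sub_mem_multicastCone_iff.1 hx.2 l) ha
  have h2 := mul_le_mul_of_nonneg_left (sub_mem_multicastCone_iff.1 hy.2 l) hb
  calc ∑ I, G I l * (a • x + b • y) I = a * ∑ I, G I l * x I + b * ∑ I, G I l * y I := by
        simp only [Finset.mul_sum, ← Finset.sum_add_distrib, Pi.add_apply, Pi.smul_apply,
          smul_eq_mul]
        exact Finset.sum_congr rfl fun I _ => by ring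
    _ ≤ a * ∑ I, G I l * Rs I + b * ∑ I, G I l * Rs I := add_le_add h1 h2
    _ = ∑ I, G I l * Rs I := by rw [← add_mul, hab, one_mul]

/-- An extreme point is determined by its set of active constraints: if x and y share them, these
constraints are constant along the line through x and y, the others are slack at x, and x can be
moved both ways inside the region. -/
lemma finite_extremePoints_region (Rs : Rates) :
    ({R | 0 ≤ R ∧ R - Rs ∈ multicastCone}.extremePoints ℝ).Finite := by
  refine Set.Finite.of_injOn (f := fun R => {k | regionConstraint Rs k R = 0})
    (t := Set.univ) (fun _ _ => Set.mem_univ _) (fun x hx y hy hxy => ?_) Set.finite_univ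
  by_contra hne
  choose b hb using regionConstraint_line Rs x (y - x)
  have hx0 := regionConstraint_nonpos_iff.2 hx.1
  have hb0 : ∀ k, regionConstraint Rs k x = 0 → b k = 0 := fun k hk => by
    have h1 : regionConstraint Rs k y = 0 := by
      have : k ∈ {k | regionConstraint Rs k x = 0} := hk
      exact (Set.ext_iff.1 hxy k).1 this
    have h2 := hb k 1
    rw [one_smul, add_sub_cancel, h1, hk] at h2
    linarith
  have hev : ∀ᶠ t : ℝ in 𝓝 0, ∀ k, regionConstraint Rs k (x + t • (y - x)) ≤ 0 := by
    refine eventually_all.2 fun k => ?_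
    rcases (hx0 k).eq_or_lt with h | h
    · exact Eventually.of_forall fun t => by rw [hb, h, hb0 k h]; simp
    · have hc : Tendsto (fun t : ℝ => regionConstraint Rs k (x + t • (y - x))) (𝓝 0)
          (𝓝 (regionConstraint Rs k x)) := by
        have hcont : Continuous fun t : ℝ => regionConstraint Rs k (x + t • (y - x)) :=
          (continuous_regionConstraint Rs k).comp (by fun_prop)
        simpa using hcont.tendsto 0
      exact (hc.eventually_lt_const h).mono fun t ht => ht.le
  obtain ⟨ε, hε, h⟩ := Metric.eventually_nhds_iff.1 hev
  have hmem : ∀ t : ℝ, |t| < ε → x + t • (y - x) ∈ {R | 0 ≤ R ∧ R - Rs ∈ multicastCone} :=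
    fun t ht => regionConstraint_nonpos_iff.1 (h (by simpa using ht))
  have hpos : |ε / 2| < ε := by rw [abs_of_pos (half_pos hε)]; exact half_lt_self hε
  have := hx.2 (hmem (ε / 2) hpos) (hmem (-(ε / 2)) (by rwa [abs_neg]))
    ⟨1 / 2, 1 / 2, by norm_num, by norm_num, by norm_num, by module⟩
  have h0 : (ε / 2) • (y - x) = 0 := by simpa using this
  rcases smul_eq_zero.1 h0 with h0 | h0
  · exact (half_pos hε).ne' h0
  · exact hne (sub_eq_zero.1 h0).symm

/-- The multicast region is a polytope. -/
lemma exists_finite_convexHull_eq_region (Rs : Rates) :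
    ∃ S : Set Rates, S.Finite ∧ {R | 0 ≤ R ∧ R - Rs ∈ multicastCone} = convexHull ℝ S := by
  refine ⟨_, finite_extremePoints_region Rs, ?_⟩
  -- The Krein–Milman theorem; the hull of finitely many points is already closed.
  exact (closure_convexHull_extremePoints (isCompact_region Rs) (convex_region Rs)).symm.trans
    ((finite_extremePoints_region Rs).isClosed_convexHull ℝ).closure_eq

end MulticastBC

end

theorem theorem4p1 :
    -- the multicast region, over all channels as well as over those with finite alphabets
    (∀ Rs : MulticastBC.Rates, 0 ≤ Rs →
      MulticastBC.multicastRegion Set.univ Rs =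
          {R | 0 ≤ R ∧ MulticastBC.G.transpose.mulVec (R - Rs) ≤ 0} ∧
      MulticastBC.multicastRegion {c | c.IsFinite} Rs =
          {R | 0 ≤ R ∧ MulticastBC.G.transpose.mulVec (R - Rs) ≤ 0} ∧
      -- it is cut out of the nonnegative orthant by the translated cone, and is a polytope
      MulticastBC.multicastRegion Set.univ Rs =
          {R | 0 ≤ R ∧ R - Rs ∈ MulticastBC.multicastCone} ∧
      ∃ S : Set MulticastBC.Rates, S.Finite ∧
        MulticastBC.multicastRegion Set.univ Rs = convexHull ℝ S) ∧
    -- the extremal rays of the cone are the rays through the columns of `H`, sixteen in number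
    MulticastBC.extremalRays MulticastBC.multicastCone =
        Set.range (fun j : Fin 16 => MulticastBC.ray (MulticastBC.H.col j)) ∧
    (MulticastBC.extremalRays MulticastBC.multicastCone).ncard = 16 ∧
    -- the distinct universal operations have these directions, and so there are sixteen of them
    {d | MulticastBC.IsDistinct d} =
        Set.range (fun j : Fin 16 => MulticastBC.normalized (MulticastBC.H.col j)) ∧
    {d | MulticastBC.IsDistinct d}.ncard = 16 ∧
    -- the sixteenth is realized by an exclusive-or of the two bits of `M₁₂₃`
    MulticastBC.H.col 15 = ![0, 0, 0, -1, -1, -1, 2] ∧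
    (∃ u : MulticastBC.UniversalOperation 1 ![0, 0, 0, 1, 1, 1, 0] ![0, 0, 0, 0, 0, 0, 2],
      ∀ M, (u.enc M 3 : ℕ) = (M 6 : ℕ) / 2 ∧ (u.enc M 4 : ℕ) = (M 6 : ℕ) % 2 ∧
        (u.enc M 5 : ℕ) = (u.enc M 3 : ℕ) ^^^ (u.enc M 4 : ℕ)) := by
  refine ⟨fun Rs hRs => ⟨MulticastBC.multicastRegion_eq (Set.subset_univ _) hRs,
    MulticastBC.multicastRegion_eq subset_rfl hRs,
    MulticastBC.multicastRegion_eq (Set.subset_univ _) hRs, ?_⟩,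
    MulticastBC.extremalRays_multicastCone, MulticastBC.ncard_extremalRays,
    MulticastBC.setOf_isDistinct, MulticastBC.ncard_isDistinct, MulticastBC.H_col_fifteen,
    MulticastBC.exists_xor_operation⟩
  rw [MulticastBC.multicastRegion_eq (Set.subset_univ _) hRs]
  exact MulticastBC.exists_finite_convexHull_eq_region Rs
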